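/- Let $k\ge 0$ be an integer and let $G$ be a finite simple graph that is $50k$-connected, i.e. $G$ has more than $50k$ vertices and $G-S$ is connected for every set $S$ of fewer than $50k$ vertices. An odd cycle cover of $G$ is a set $X\subseteq V(G)$ such that $G-X$ is bipartite; it is minimum if no odd cycle cover of $G$ has fewer elements. For a partition $(A,B)$ of $V(G)$ into two (possibly empty) sets, let $G_{A,B}=G[A]\cup G[B]$. The partition $(A,B)$ is called nice if there is a minimum odd cycle cover $X$ of $G$ such that $A\setminus X$ and $B\setminus X$ are independent sets in $G$, every $x\in X$ with more neighbours in $B\setminus X$ than in $A\setminus X$ lies in $A$, and every $x\in X$ with more neighbours in $A\setminus X$ than in $B\setminus X$ lies in $B$. Then exactly one of the following two statements holds: 1. $G$ contains $k$ pairwise vertex-disjoint odd cycles. 2. For every nice partition $(A,B)$ of $V(G)$, the graph $G_{A,B}$ does not contain a matching of size $k$. -/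

import Mathlib

namespace OddCycles

variable {V : Type*}

/-- `G` is `m`-connected: it has more than `m` vertices, and deleting fewer than `m` vertices
always leaves a connected graph. (Meant for finite graphs.) -/
def IsVertexConnected (G : SimpleGraph V) (m : ℕ) : Prop :=
  m < Nat.card V ∧ ∀ S : Set V, S.ncard < m → (G.induce Sᶜ).Connected

/-- `G` contains `k` pairwise vertex-disjoint odd cycles. -/
def HasDisjointOddCycles (G : SimpleGraph V) (k : ℕ) : Prop :=
  ∃ (v : Fin k → V) (c : (i : Fin k) → G.Walk (v i) (v i)),
    (∀ i, (c i).IsCycle ∧ Odd (c i).length) ∧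
    ∀ i j, i ≠ j → List.Disjoint (c i).support (c j).support

/-- For a partition `(A, B)` of the vertex set, the graph `G[A] ∪ G[B]`: the edges of `G` having
both ends in `A` or both ends in `B`. -/
def partGraph (G : SimpleGraph V) (A B : Set V) : SimpleGraph V where
  Adj u v := G.Adj u v ∧ ((u ∈ A ∧ v ∈ A) ∨ (u ∈ B ∧ v ∈ B))
  symm := ⟨fun _ _ h => ⟨h.1.symm, h.2.imp And.symm And.symm⟩⟩
  loopless := ⟨fun v h => G.loopless.irrefl v h.1⟩

/-- `(A, B)` is a bipartition of `G`: a partition of the vertex set (a part may be empty) such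
that `G[A] ∪ G[B]` is edgeless. -/
def IsBipartition (G : SimpleGraph V) (A B : Set V) : Prop :=
  IsCompl A B ∧ partGraph G A B = ⊥

/-- `X` is an odd cycle cover of `G`: the graph `G - X` is bipartite. -/
def IsOddCycleCover (G : SimpleGraph V) (X : Set V) : Prop :=
  (G.induce Xᶜ).IsBipartite

/-- An odd cycle cover of minimum size. -/
def IsMinOddCycleCover (G : SimpleGraph V) (X : Set V) : Prop :=
  IsOddCycleCover G X ∧ ∀ Y : Set V, IsOddCycleCover G Y → X.ncard ≤ Y.ncard

/-- The odd cycle cover `X` induces the partition `(A, B)`: `(A \ X, B \ X)` is a bipartition of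
`G - X`, and a vertex of `X` lies in `A` (in `B`) if it has more neighbours in `B \ X` than in
`A \ X` (in `A \ X` than in `B \ X`). Ties are unconstrained. -/
def Induces (G : SimpleGraph V) (X A B : Set V) : Prop :=
  IsBipartition (G.induce Xᶜ) (Subtype.val ⁻¹' A) (Subtype.val ⁻¹' B) ∧
  ∀ x ∈ X,
    ((G.neighborSet x ∩ (A \ X)).ncard < (G.neighborSet x ∩ (B \ X)).ncard → x ∈ A) ∧
    ((G.neighborSet x ∩ (B \ X)).ncard < (G.neighborSet x ∩ (A \ X)).ncard → x ∈ B)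

/-- `(A, B)` is a nice partition of `G`: a partition of the vertex set that is induced by some
minimum odd cycle cover. -/
def IsNicePartition (G : SimpleGraph V) (A B : Set V) : Prop :=
  IsCompl A B ∧ ∃ X : Set V, IsMinOddCycleCover G X ∧ Induces G X A B

/-- `G` contains a matching with exactly `k` edges. -/
def HasMatchingOfSize (G : SimpleGraph V) (k : ℕ) : Prop :=
  ∃ M : G.Subgraph, M.IsMatching ∧ M.edgeSet.ncard = k

end OddCycles

/-! A graph is non-bipartite exactly when it contains an odd cycle, so k disjoint odd cycles amount
to k disjoint vertex sets with no proper 2-colouring (`hasDisjointOddCycles_iff`). For any partition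
(A, B), each such set has an edge inside A or inside B, and these edges form a matching
(`HasDisjointOddCycles.hasMatchingOfSize`). Since nice partitions exist, the two statements cannot
both hold.

It remains to turn a k-matching of G_{A,B}, with (A, B) induced by a minimum cover X, into k
disjoint odd cycles. An Erdős–Pósa dichotomy (`exists_disjoint_or_small_cover`) provides the cycles
at once or shows |X| < 2k. In the second case G - X is still highly connected. A matching end in X
has, by niceness, many neighbours outside X in the opposite part, so all such ends can be moved to
new distinct vertices outside X, always along an edge between A and B. Linking the moved ends
pairwise in G - X uses only edges between A and B; each matching edge joins two vertices of the same
part, so each of the resulting sets is non-bipartite (`hasDisjointOddCycles_of_matching`).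

For the dichotomy, a maximum cut contains a large set L in which any 2k vertices are linked by edges
of the cut (`exists_linked_crossing`). One then seeks k disjoint connections between vertices of L
whose parity disagrees with the cut; closing them up through the linkage gives non-bipartite sets.
These connections correspond to a matching in two layered copies of G (`layered`): alternating the
matching with the exchange of layers traces them out (`exists_orbits`). If the matching is missing,
the Tutte–Berge obstruction projects to an odd cycle cover of size less than 2k
(`exists_small_cover`).

Both uses of linkages rest on the Thomas–Wollan theorem (`Massed.linked`). In a minimal
counterexample, contracting or deleting an edge must destroy massedness. This forces adjacent
vertices outside X to have many common neighbours, so the neighbourhood of a vertex of small degree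
is dense enough to contain a highly linked set (`exists_linked_subset`). Menger's theorem carries X
into this set, or yields a small separation whose far side is already linked, and such a separation
can be reduced away (`linked_of_rigid_of_lt`). -/

namespace OddCycles

/-! ### Connections inside a vertex set, and Menger's theorem -/

variable {V : Type*}

/-- `a` and `b` are joined by a walk of `G` all of whose vertices lie in `P`. -/
def ConnIn (G : SimpleGraph V) (P : Set V) (a b : V) : Prop :=
  ∃ w : G.Walk a b, ∀ x ∈ w.support, x ∈ P

namespace ConnIn

variable {G G' : SimpleGraph V} {P Q : Set V} {a b c : V}

lemma refl (h : a ∈ P) : ConnIn G P a a := ⟨.nil, by simpa using h⟩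

lemma left_mem (h : ConnIn G P a b) : a ∈ P := by
  obtain ⟨w, hw⟩ := h
  exact hw _ w.start_mem_support

lemma right_mem (h : ConnIn G P a b) : b ∈ P := by
  obtain ⟨w, hw⟩ := h
  exact hw _ w.end_mem_support

lemma symm (h : ConnIn G P a b) : ConnIn G P b a := by
  obtain ⟨w, hw⟩ := h
  exact ⟨w.reverse, by simpa using hw⟩

lemma trans (h : ConnIn G P a b) (h' : ConnIn G P b c) : ConnIn G P a c := by
  obtain ⟨w, hw⟩ := h
  obtain ⟨w', hw'⟩ := h'
  refine ⟨w.append w', fun x hx => ?_⟩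
  rcases SimpleGraph.Walk.mem_support_append_iff _ _ |>.1 hx with h | h
  exacts [hw _ h, hw' _ h]

lemma mono (hPQ : P ⊆ Q) (h : ConnIn G P a b) : ConnIn G Q a b := by
  obtain ⟨w, hw⟩ := h
  exact ⟨w, fun x hx => hPQ (hw x hx)⟩

lemma of_adj (h : G.Adj a b) (ha : a ∈ P) (hb : b ∈ P) : ConnIn G P a b :=
  ⟨h.toWalk, by simp [ha, hb]⟩

/-- Adjacency inside `P` may be replaced by a connection in another graph and set. -/
lemma lift (h : ConnIn G P a b) (hb : b ∈ Q)
    (hadj : ∀ x ∈ P, ∀ y ∈ P, G.Adj x y → ConnIn G' Q x y) : ConnIn G' Q a b := by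
  obtain ⟨w, hw⟩ := h
  induction w with
  | nil => exact .refl hb
  | cons h w ih =>
    have h1 := hw _ (SimpleGraph.Walk.start_mem_support _)
    have h2 : ∀ x ∈ w.support, x ∈ P := fun x hx => hw x (by simp [hx])
    exact (hadj _ h1 _ (h2 _ w.start_mem_support) h).trans (ih hb h2)

lemma mono_graph (hG : G ≤ G') (h : ConnIn G P a b) : ConnIn G' P a b :=
  h.lift h.right_mem fun _ hx _ hy hxy => .of_adj (hG hxy) hx hy

/-- A set closed under adjacency inside `P` that contains one end contains the other one. -/
lemma mem_of_closed (h : ConnIn G P a b) {R : Set V} (ha : a ∈ R)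
    (hR : ∀ x ∈ P, ∀ y ∈ P, x ∈ R → G.Adj x y → y ∈ R) : b ∈ R := by
  obtain ⟨w, hw⟩ := h
  induction w with
  | nil => exact ha
  | cons h w ih =>
    have h1 := hw _ (SimpleGraph.Walk.start_mem_support _)
    have h2 : ∀ x ∈ w.support, x ∈ P := fun x hx => hw x (by simp [hx])
    exact ih (hR _ h1 _ (h2 _ w.start_mem_support) ha h) h2

/-- Cut a connection at the first vertex of `T`. -/
lemma first_hit (h : ConnIn G P a b) {T : Set V} (hb : b ∈ T) :
    ∃ t ∈ T, ∃ P' ⊆ P, a ∈ P' ∧ ConnIn G P' a t ∧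
      ∀ p ∈ P', p ≠ t → p ∉ T ∧ ConnIn G (P' \ {t}) a p := by
  obtain ⟨w, hw⟩ := h
  induction w with
  | nil =>
    refine ⟨_, hb, {_}, ?_, rfl, .refl rfl, ?_⟩
    · simpa using hw
    · simp
  | @cons u v x h w ih =>
    have h1 : u ∈ P := hw _ (SimpleGraph.Walk.start_mem_support _)
    have h2 : ∀ x ∈ w.support, x ∈ P := fun x hx => hw x (by simp [hx])
    by_cases hu : u ∈ T
    · exact ⟨u, hu, {u}, by simpa using h1, rfl, .refl rfl, by simp⟩
    obtain ⟨t, ht, P', hP', hv, hc, hp⟩ := ih hb h2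
    have hut : u ≠ t := fun h => hu (h ▸ ht)
    have hsub : P' ⊆ insert u P' := Set.subset_insert _ _
    refine ⟨t, ht, insert u P', Set.insert_subset h1 hP', by simp,
      (of_adj h (by simp) (hsub hv)).trans (hc.mono hsub), ?_⟩
    intro p hp' hpt
    rcases hp' with rfl | hp'
    · exact ⟨hu, .refl ⟨by simp, hut⟩⟩
    · have := hp p hp' hpt
      refine ⟨this.1, (of_adj h (show u ∈ insert u P' \ {t} from ⟨by simp, hut⟩)
        (show _ ∈ insert u P' \ {t} from ⟨hsub hv, this.2.left_mem.2⟩)).trans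
        (this.2.mono (Set.sdiff_subset_sdiff_left hsub))⟩

end ConnIn

/-- `S` meets every walk from `A` to `B`. -/
def Separates (G : SimpleGraph V) (A B S : Finset V) : Prop :=
  ∀ a ∈ A, ∀ b ∈ B, ¬ ConnIn G (↑S)ᶜ a b

/-- A set with exactly `n` elements is exhausted by the representatives of `n` disjoint sets. -/
lemma exists_index_of_mem {n : ℕ} {P : Fin n → Set V} (hP : Pairwise (Function.onFun Disjoint P))
    {T : Finset V} (hT : T.card = n) {t : Fin n → V} (ht : ∀ i, t i ∈ T) (htP : ∀ i, t i ∈ P i)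
    {x : V} (hx : x ∈ T) : ∃ i, t i = x := by
  classical
  have hinj : Function.Injective t := by
    intro i j hij
    by_contra hne
    exact Set.disjoint_left.1 (hP hne) (htP i) (hij ▸ htP j)
  have : Finset.univ.image t = T := by
    refine Finset.eq_of_subset_of_card_le (by simpa [Finset.subset_iff] using ht) ?_
    rw [Finset.card_image_of_injective _ hinj]
    simp [hT]
  rw [← this] at hx
  simpa using hx

set_option maxHeartbeats 1000000 in
/-- **Menger's theorem**, with disjoint connecting sets instead of paths. -/
theorem menger [Finite V] (G : SimpleGraph V) (A B : Finset V) (n : ℕ)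
    (h : ∀ S, Separates G A B S → n ≤ S.card) :
    ∃ P : Fin n → Set V, Pairwise (Function.onFun Disjoint P) ∧
      ∀ i, ∃ a ∈ A, ∃ b ∈ B, ConnIn G (P i) a b := by
  classical
  induction hN : G.edgeSet.ncard using Nat.strong_induction_on generalizing G A B n with
  | _ N ih =>
  subst hN
  by_cases hbot : G = ⊥
  · subst hbot
    -- Without edges, A ∩ B is itself a separator and its elements are the required connections.
    have hn : n ≤ (A ∩ B).card := by
      refine h _ fun a ha b hb ⟨w, hw⟩ => ?_
      cases w with
      | nil => exact hw a (by simp) (by simp [ha, hb])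
      | cons h _ => exact h
    obtain ⟨f⟩ : Nonempty (Fin n ↪ (A ∩ B : Finset V)) :=
      Function.Embedding.nonempty_of_card_le (by simpa using hn)
    refine ⟨fun i => {(f i : V)}, fun i j hij => ?_, fun i => ⟨f i, ?_, f i, ?_, .refl rfl⟩⟩
    · simpa [Function.onFun, Subtype.ext_iff] using fun h => hij (f.injective (Subtype.ext h))
    · exact (Finset.mem_inter.1 (f i).2).1
    · exact (Finset.mem_inter.1 (f i).2).2
  obtain ⟨x₀, y₀, hxy₀⟩ : ∃ x y, G.Adj x y := by
    by_contra! hno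
    exact hbot (by ext x y; simpa using hno x y)
  have hdel : ∀ x y, G.Adj x y → (G.deleteEdges {s(x, y)}).edgeSet.ncard < G.edgeSet.ncard := by
    intro x y hxy
    refine Set.ncard_lt_ncard ?_ (Set.toFinite _)
    rw [SimpleGraph.edgeSet_deleteEdges]
    exact ⟨Set.sdiff_subset, fun hsub => (hsub (show s(x, y) ∈ G.edgeSet from hxy)).2 rfl⟩
  set G' := G.deleteEdges {s(x₀, y₀)} with hG'
  have hle : G' ≤ G := SimpleGraph.deleteEdges_le _
  by_cases hsep : ∀ S, Separates G' A B S → n ≤ S.card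
  · obtain ⟨P, hP, hc⟩ := ih _ (hdel _ _ hxy₀) G' A B n hsep rfl
    refine ⟨P, hP, fun i => ?_⟩
    obtain ⟨a, ha, b, hb, hab⟩ := hc i
    exact ⟨a, ha, b, hb, hab.mono_graph hle⟩
  push Not at hsep
  obtain ⟨S, hS, hSn⟩ := hsep
  -- orient the deleted edge
  obtain ⟨x, y, hxy, hGxy, hxR, hyR⟩ : ∃ x y, G.Adj x y ∧ G' = G.deleteEdges {s(x, y)} ∧
      (∃ a ∈ A, ConnIn G' (↑S)ᶜ a x) ∧ ¬ ∃ a ∈ A, ConnIn G' (↑S)ᶜ a y := by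
    have : ¬ Separates G A B S := fun hs => absurd (h S hs) (by omega)
    simp only [Separates, not_forall, not_not] at this
    obtain ⟨a, ha, b, hb, hab⟩ := this
    by_contra! hno
    have hbR : b ∈ {v | ∃ a ∈ A, ConnIn G' (↑S)ᶜ a v} := by
      refine hab.mem_of_closed ⟨a, ha, .refl hab.left_mem⟩ ?_
      rintro u hu v hv ⟨a', ha', hau⟩ huv
      by_cases he : s(u, v) = s(x₀, y₀)
      · have := hno u v huv (by rw [hG', he]) ⟨a', ha', hau⟩
        exact this
      · exact ⟨a', ha', hau.trans (.of_adj (by simp [hG', huv, he]) hu hv)⟩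
    obtain ⟨a', ha', hab'⟩ := hbR
    exact hS a' ha' b hb hab'
  have hG'adj : ∀ u v, G.Adj u v → G'.Adj u v ∨ (u = x ∧ v = y) ∨ (u = y ∧ v = x) := by
    intro u v huv
    rw [hGxy]
    by_cases he : s(u, v) = s(x, y)
    · right
      simpa using he
    · left
      simp [huv, he]
  have hlt := hdel x y hxy
  rw [← hGxy] at hlt
  clear_value G'
  have key : ∀ z, (z = x ∨ z = y) → ∀ P : Set V, z ∉ P → ∀ a b, ConnIn G P a b → ConnIn G' P a b := by
    intro z hz P hzP a b hab
    refine hab.lift hab.right_mem fun u hu v hv huv => .of_adj ?_ hu hv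
    rcases hG'adj u v huv with h | ⟨rfl, rfl⟩ | ⟨rfl, rfl⟩
    · exact h
    all_goals rcases hz with rfl | rfl <;> contradiction
  have hsepz : ∀ z, (z = x ∨ z = y) → Separates G A B (insert z S) := by
    intro z hz a ha b hb hab
    refine hS a ha b hb ((key z hz _ (by simp) _ _ hab).mono ?_)
    intro v
    simp
  have hcard : ∀ z, (z = x ∨ z = y) → (insert z S).card = n ∧ z ∉ S := by
    intro z hz
    have h1 := h _ (hsepz z hz)
    have h2 := Finset.card_insert_le z S
    refine ⟨by omega, fun hzS => ?_⟩
    rw [Finset.insert_eq_of_mem hzS] at h1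
    omega
  obtain ⟨hcx, hxS⟩ := hcard x (.inl rfl)
  obtain ⟨hcy, hyS⟩ := hcard y (.inr rfl)
  -- A set separating C from S + z after the deletion already separates C from D in G: a C–D walk of
  -- G must meet S + z, and up to its first hit it cannot use the deleted edge, since z' is not
  -- reachable from C in G' - S.
  have side : ∀ z z', (z = x ∧ z' = y ∨ z = y ∧ z' = x) → ∀ C D : Finset V,
      (¬ ∃ c ∈ C, ConnIn G' (↑S)ᶜ c z') → Separates G C D (insert z S) →
      (∀ S', Separates G C D S' → n ≤ S'.card) →
      ∀ S', Separates G' C (insert z S) S' → n ≤ S'.card := by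
    intro z z' hz C D hz' hsz hCD S' hS'
    refine hCD S' fun a ha b hb hab => ?_
    have hhit : ∃ c ∈ (insert z S : Finset V), ConnIn G (↑S')ᶜ a c := by
      by_contra! hno
      refine hsz a ha b hb ?_
      have : b ∈ {v | ConnIn G (↑S')ᶜ a v ∧ ConnIn G (↑(insert z S))ᶜ a v} := by
        have haa : a ∉ (insert z S) := fun h' => hno a h' (.refl hab.left_mem)
        refine hab.mem_of_closed ⟨.refl hab.left_mem, .refl haa⟩ ?_
        rintro u hu v hv ⟨h1, h2⟩ huv
        have h3 := h1.trans (.of_adj huv hu hv)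
        exact ⟨h3, h2.trans (.of_adj huv h2.right_mem fun h' => hno v h' h3)⟩
      exact this.2
    obtain ⟨c, hc, hac⟩ := hhit
    obtain ⟨t, ht, P', hP', haP, hc', hp⟩ := hac.first_hit (T := ↑(insert z S)) hc
    have hzP : z ∉ P' \ {t} := fun hx => (hp z hx.1 hx.2).1 (by simp)
    have hnear : ∀ u ∈ P', u ≠ t → u ≠ z' := by
      rintro u hu hut rfl
      have := key z (by tauto) _ hzP _ _ (hp u hu hut).2
      exact hz' ⟨a, ha, this.mono fun w hw hwS => (hp w hw.1 hw.2).1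
        (by simp at hwS; simp [hwS])⟩
    refine hS' a ha t ht (hc'.lift (Q := (↑S')ᶜ) (hP' hc'.right_mem) fun u hu v hv huv => ?_)
    have hat : ∀ w ∈ P', w = z → w = t := fun w hw hwz => by
      by_contra hne
      exact hzP ⟨hwz ▸ hw, hwz ▸ hne⟩
    have := huv.ne
    rcases hG'adj u v huv with h | h
    · exact .of_adj h (hP' hu) (hP' hv)
    · grind
  have hxB : ¬ ∃ b ∈ B, ConnIn G' (↑S)ᶜ b x := by
    rintro ⟨b, hb, hbx⟩
    obtain ⟨a, ha, hax⟩ := hxR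
    exact hS a ha b hb (hax.trans hbx.symm)
  obtain ⟨P, hP, hPc⟩ := ih _ hlt G' A (insert x S) n
    (side x y (.inl ⟨rfl, rfl⟩) A B hyR (hsepz x (.inl rfl)) h) rfl
  have hsymm : ∀ {C D S'}, Separates G C D S' → Separates G D C S' :=
    fun hs a ha b hb hab => hs b hb a ha hab.symm
  obtain ⟨Q, hQ, hQc⟩ := ih _ hlt G' B (insert y S) n
    (side y x (.inr ⟨rfl, rfl⟩) B A hxB (hsymm (hsepz y (.inr rfl))) fun S' hS' => h S' (hsymm hS'))
    rfl
  choose a ha t₀ ht₀ hat₀ using hPc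
  choose b hb r₀ hr₀ hbr₀ using hQc
  choose t ht P' hP' haP' hat hPt using fun i => (hat₀ i).first_hit (T := ↑(insert x S)) (ht₀ i)
  choose r hr Q' hQ' hbQ' hbr hQr using fun i => (hbr₀ i).first_hit (T := ↑(insert y S)) (hr₀ i)
  have hPA : ∀ i, ∀ p ∈ P' i, p ≠ t i → ConnIn G' (↑S)ᶜ (a i) p := fun i p hp hpt =>
    (hPt i p hp hpt).2.mono fun w hw hwS => (hPt i w hw.1 hw.2).1 (by simp at hwS; simp [hwS])
  have hQB : ∀ i, ∀ p ∈ Q' i, p ≠ r i → ConnIn G' (↑S)ᶜ (b i) p := fun i p hp hpt =>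
    (hQr i p hp hpt).2.mono fun w hw hwS => (hQr i w hw.1 hw.2).1 (by simp at hwS; simp [hwS])
  -- Any other common vertex would join A to B, A to y or B to x in G' - S.
  have hmeet : ∀ i j p, p ∈ P' i → p ∈ Q' j → p = t i ∧ p = r j ∧ p ∈ S := by
    intro i j p hpP hpQ
    by_cases h1 : p = t i <;> by_cases h2 : p = r j
    · refine ⟨h1, h2, ?_⟩
      have h3 : p ∈ insert x S := h1 ▸ ht i
      have h4 : p ∈ insert y S := h2 ▸ hr j
      have := hxy.ne
      grind
    · have h3 : p ∈ insert x S := h1 ▸ ht i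
      have h4 := hQB j p hpQ h2
      rcases Finset.mem_insert.1 h3 with rfl | h3
      · exact absurd ⟨b j, hb j, h4⟩ hxB
      · exact absurd h3 h4.right_mem
    · have h3 : p ∈ insert y S := h2 ▸ hr j
      have h4 := hPA i p hpP h1
      rcases Finset.mem_insert.1 h3 with rfl | h3
      · exact absurd ⟨a i, ha i, h4⟩ hyR
      · exact absurd h3 h4.right_mem
    · exact absurd ((hPA i p hpP h1).trans (hQB j p hpQ h2).symm) (hS _ (ha i) _ (hb j))
  have hP'd : Pairwise (Function.onFun Disjoint P') := fun i j hij =>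
    (hP hij).mono (hP' i) (hP' j)
  have hQ'd : Pairwise (Function.onFun Disjoint Q') := fun i j hij =>
    (hQ hij).mono (hQ' i) (hQ' j)
  have htS : ∀ i, t i = x ∨ t i ∈ S := fun i => by simpa using ht i
  -- Gluing rule: a connection from A ending in S continues with the one from B ending at the same
  -- vertex; the one ending at x continues through the deleted edge with the one ending at y.
  have hex : ∀ i, ∃ j, r j = if t i = x then y else t i := fun i =>
    exists_index_of_mem hQ'd hcy hr (fun j => (hbr j).right_mem) (by
      rcases htS i with h1 | h1
      · simp [h1]
      · by_cases h2 : t i = x <;> simp [h1, h2])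
  choose φ hφ using hex
  have htP : ∀ i, t i ∈ P' i := fun i => (hat i).right_mem
  have htinj : ∀ i j, t i = t j → i = j := fun i j hij => by
    by_contra hne
    exact Set.disjoint_left.1 (hP'd hne) (htP i) (hij ▸ htP j)
  have hφinj : ∀ i j, φ i = φ j → i = j := by
    intro i j hij
    have h1 := hφ i
    rw [hij, hφ j] at h1
    apply htinj
    have hi : t i ≠ y := fun h2 => by
      rcases htS i with h3 | h3
      · exact hxy.ne (h3.symm.trans h2)
      · exact hyS (h2 ▸ h3)
    have hj : t j ≠ y := fun h2 => by
      rcases htS j with h3 | h3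
      · exact hxy.ne (h3.symm.trans h2)
      · exact hyS (h2 ▸ h3)
    by_cases h2 : t i = x <;> by_cases h3 : t j = x
    · rw [h2, h3]
    · exact absurd (by simpa [h2, h3] using h1) hj
    · exact absurd (by simpa [h2, h3] using h1.symm) hi
    · simpa [h2, h3] using h1.symm
  refine ⟨fun i => P' i ∪ Q' (φ i), fun i j hij => ?_, fun i => ⟨a i, ha i, b (φ i), hb _, ?_⟩⟩
  · have h0 : ∀ i j p, p ∈ P' i → p ∈ Q' (φ j) → i = j := by
      intro i j p hpP hpQ
      obtain ⟨h1, h2, h3⟩ := hmeet i (φ j) p hpP hpQ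
      have h4 := hφ j
      apply htinj
      split_ifs at h4
      · exact absurd (by rwa [← h4, ← h2]) hyS
      · rw [← h4, ← h2, ← h1]
    refine Set.disjoint_left.2 fun p hp hp' => ?_
    rcases hp with hp | hp <;> rcases hp' with hp' | hp'
    · exact Set.disjoint_left.1 (hP'd hij) hp hp'
    · exact hij (h0 i j p hp hp')
    · exact hij (h0 j i p hp' hp).symm
    · exact Set.disjoint_left.1 (hQ'd fun h => hij (hφinj _ _ h)) hp hp'
  · have h1 := ((hat i).mono_graph hle).mono (Q := P' i ∪ Q' (φ i)) Set.subset_union_left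
    have h2 := ((hbr (φ i)).mono_graph hle).mono (Q := P' i ∪ Q' (φ i)) Set.subset_union_right
    refine h1.trans (ConnIn.trans ?_ h2.symm)
    have := hφ i
    split_ifs at this with hx
    · rw [hx] at h1 ⊢
      rw [this] at h2 ⊢
      exact .of_adj hxy h1.right_mem h2.right_mem
    · rw [this]
      exact .refl h1.right_mem

end OddCycles

/-! ### Two-colourings and odd cycles -/

namespace OddCycles

variable {V : Type*}

/-- `c` is a proper 2-colouring of the subgraph of `G` induced by `Z`. -/
def ProperOn (G : SimpleGraph V) (Z : Set V) (c : V → Bool) : Prop :=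
  ∀ x ∈ Z, ∀ y ∈ Z, G.Adj x y → c x ≠ c y

lemma ProperOn.even_length_iff {G : SimpleGraph V} {Z : Set V} {c : V → Bool}
    (h : ProperOn G Z c) {u v : V} (w : G.Walk u v) (hw : ∀ x ∈ w.support, x ∈ Z) :
    Even w.length ↔ c u = c v := by
  induction w with
  | nil => simp
  | cons hadj w ih =>
    have h1 := h _ (hw _ (by simp)) _ (hw _ (by simp)) hadj
    rw [SimpleGraph.Walk.length_cons, Nat.even_add_one, ih fun x hx => hw x (by simp [hx])]
    revert h1
    generalize c _ = p, c _ = q, c _ = r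
    cases p <;> cases q <;> cases r <;> simp

lemma isBipartite_induce_iff {G : SimpleGraph V} {Z : Set V} :
    (G.induce Z).IsBipartite ↔ ∃ c, ProperOn G Z c := by
  classical
  constructor
  · rintro ⟨f⟩
    refine ⟨fun v => if h : v ∈ Z then decide (f ⟨v, h⟩ = 0) else false, fun x hx y hy hxy => ?_⟩
    have : f ⟨x, hx⟩ ≠ f ⟨y, hy⟩ := f.valid (by simpa using hxy)
    simp only [hx, hy, dif_pos]
    intro h
    have h1 := decide_eq_decide.1 h
    revert this h1
    generalize f _ = p, f _ = q
    revert p q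
    decide
  · rintro ⟨c, hc⟩
    refine ⟨SimpleGraph.Coloring.mk (fun v => if c v then 0 else 1) ?_⟩
    intro x y hxy
    have := hc x x.2 y y.2 (by simpa using hxy)
    revert this
    generalize c _ = p, c _ = q
    cases p <;> cases q <;> simp

/-- Each closed piece cut off by `bypass` is either a cycle, hence even, or an edge traversed back
and forth, hence of length 2; so the parity of the walk does not change. -/
lemma even_length_add_bypass_length [DecidableEq V] {G : SimpleGraph V}
    (h : ∀ u, ∀ c : G.Walk u u, c.IsCycle → Even c.length) {u v : V} (p : G.Walk u v) :
    Even (p.length + p.bypass.length) := by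
  induction p with
  | nil => simp [SimpleGraph.Walk.bypass]
  | @cons u v w hadj q ih =>
    simp only [SimpleGraph.Walk.bypass, SimpleGraph.Walk.length_cons]
    split_ifs with hu
    · have hlen : (q.bypass.takeUntil u hu).length + (q.bypass.dropUntil u hu).length =
          q.bypass.length := by
        rw [← SimpleGraph.Walk.length_append, SimpleGraph.Walk.take_spec]
      have hev : Even ((q.bypass.takeUntil u hu).length + 1) := by
        have hp : (q.bypass.takeUntil u hu).IsPath := q.bypass_isPath.takeUntil hu
        by_cases he : s(u, v) ∈ (q.bypass.takeUntil u hu).edges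
        · have hl : (q.bypass.takeUntil u hu).length = 1 := by
            generalize q.bypass.takeUntil u hu = r at hp he
            cases r with
            | nil => simp at he
            | @cons _ z _ h' r =>
              rw [SimpleGraph.Walk.cons_isPath_iff] at hp
              rw [SimpleGraph.Walk.edges_cons, List.mem_cons] at he
              rcases he with he | he
              · obtain rfl : u = z := Sym2.congr_right.1 (Sym2.eq_swap.trans he)
                rw [SimpleGraph.Walk.length_cons,
                  SimpleGraph.Walk.length_eq_zero_iff.2 (SimpleGraph.Walk.isPath_iff_nil.1 hp.1)]
              · exact absurd (r.snd_mem_support_of_mem_edges he) hp.2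
          rw [hl]
          decide
        · have := h u _ ((SimpleGraph.Walk.cons_isCycle_iff _ hadj).2 ⟨hp, he⟩)
          simpa using this
      rw [← hlen] at ih
      rw [Nat.even_add] at *
      rw [Nat.even_add_one] at *
      rw [Nat.even_add] at ih
      tauto
    · rw [SimpleGraph.Walk.length_cons]
      have : q.length + 1 + (q.bypass.length + 1) = q.length + q.bypass.length + 2 := by ring
      rw [this]
      exact ih.add even_two

lemma exists_odd_cycle {G : SimpleGraph V} (h : ¬ G.Colorable 2) :
    ∃ u, ∃ c : G.Walk u u, c.IsCycle ∧ Odd c.length := by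
  classical
  by_contra! hno
  refine h (SimpleGraph.two_colorable_iff_forall_loop_even.2 fun u w => ?_)
  have := even_length_add_bypass_length (fun u c hc => by simpa using hno u c hc) w
  have h0 : w.bypass.length = 0 := by
    rw [SimpleGraph.Walk.length_eq_zero_iff, ← SimpleGraph.Walk.isPath_iff_nil]
    exact w.bypass_isPath
  simpa [h0] using this

/-- This removes cycles from the argument: from here on it suffices to exhibit disjoint vertex sets
and refute every colouring of each. -/
theorem hasDisjointOddCycles_iff {G : SimpleGraph V} {k : ℕ} :
    HasDisjointOddCycles G k ↔ ∃ Z : Fin k → Set V, Pairwise (Function.onFun Disjoint Z) ∧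
      ∀ i, ¬ ∃ c, ProperOn G (Z i) c := by
  constructor
  · rintro ⟨v, c, hc, hd⟩
    refine ⟨fun i => {x | x ∈ (c i).support}, fun i j hij => ?_, fun i => ?_⟩
    · exact Set.disjoint_left.2 fun x hx hx' => hd i j hij hx hx'
    · rintro ⟨f, hf⟩
      have := (hf.even_length_iff (c i) fun x hx => hx).2 rfl
      exact Nat.not_even_iff_odd.2 (hc i).2 this
  · rintro ⟨Z, hZ, hn⟩
    have : ∀ i, ∃ u, ∃ c : (G.induce (Z i)).Walk u u, c.IsCycle ∧ Odd c.length := fun i =>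
      exists_odd_cycle fun h => hn i (isBipartite_induce_iff.1 h)
    choose u c hc using this
    refine ⟨fun i => (SimpleGraph.Embedding.induce (Z i)).toHom (u i), fun i => (c i).map (SimpleGraph.Embedding.induce (Z i)).toHom,
      fun i => ⟨?_, ?_⟩, fun i j hij => ?_⟩
    · exact (SimpleGraph.Walk.isCycle_map_iff_of_injective Subtype.val_injective).2 (hc i).1
    · rw [SimpleGraph.Walk.length_map]
      exact (hc i).2
    · have hsub : ∀ i x, x ∈ ((c i).map (SimpleGraph.Embedding.induce (Z i)).toHom).support →
          x ∈ Z i := by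
        intro i x hx
        rw [SimpleGraph.Walk.support_map] at hx
        obtain ⟨y, -, rfl⟩ := List.mem_map.1 hx
        exact y.2
      exact fun x hx hx' => Set.disjoint_left.1 (hZ hij) (hsub i x hx) (hsub j x hx')

end OddCycles

/-! ### Linkages and how they are transported -/

namespace OddCycles

variable {V : Type*}

/-- Any family of disjoint pairs of `X` can be joined by disjoint connected sets inside `W` that
contain no further elements of `X`. A pair may consist of two equal elements. -/
def Linked (G : SimpleGraph V) (W X : Finset V) : Prop :=
  ∀ (ι : Type) [Finite ι] (s t : ι → V), (∀ i, s i ∈ X ∧ t i ∈ X) →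
    (∀ i j, i ≠ j → s i ≠ s j ∧ s i ≠ t j ∧ t i ≠ t j) →
    ∃ P : ι → Set V, Pairwise (Function.onFun Disjoint P) ∧
      ∀ i, P i ⊆ W ∧ ConnIn G (P i) (s i) (t i) ∧ P i ∩ X ⊆ {s i, t i}

lemma Linked.mono {G G' : SimpleGraph V} {W W' X X' : Finset V} (h : Linked G W X) (hG : G ≤ G')
    (hW : W ⊆ W') (hX : X' ⊆ X) : Linked G' W' X' := by
  intro ι _ s t hst hd
  obtain ⟨P, hP, hPi⟩ := h ι s t (fun i => ⟨hX (hst i).1, hX (hst i).2⟩) hd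
  refine ⟨P, hP, fun i => ⟨(hPi i).1.trans (by exact_mod_cast hW), (hPi i).2.1.mono_graph hG,
    (Set.inter_subset_inter_right _ ?_).trans (hPi i).2.2⟩⟩
  exact_mod_cast hX

/-- A linkage is carried back along disjoint connections that first meet `L` in its ground set. -/
lemma Linked.of_landing {G : SimpleGraph V} {W X L T : Finset V} (hL : Linked G L T) (hLW : L ⊆ W)
    (P : V → Set V) (f : V → V)
    (hP : ∀ x ∈ X, P x ⊆ W ∧ ConnIn G (P x) x (f x) ∧ P x ∩ L ⊆ {f x} ∧ f x ∈ T)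
    (hd : ∀ x ∈ X, ∀ y ∈ X, x ≠ y → Disjoint (P x) (P y)) : Linked G W X := by
  intro ι _ s t hst hdist
  have hmem : ∀ x ∈ X, x ∈ P x := fun x hx => (hP x hx).2.1.left_mem
  have hfmem : ∀ x ∈ X, f x ∈ P x := fun x hx => (hP x hx).2.1.right_mem
  have heq : ∀ x ∈ X, ∀ y ∈ X, ∀ p, p ∈ P x → p ∈ P y → x = y := by
    intro x hx y hy p hpx hpy
    by_contra hne
    exact Set.disjoint_left.1 (hd x hx y hy hne) hpx hpy
  have hfinj : ∀ x ∈ X, ∀ y ∈ X, f x = f y → x = y := fun x hx y hy h =>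
    heq x hx y hy _ (hfmem x hx) (h ▸ hfmem y hy)
  obtain ⟨R, hR, hRi⟩ := hL ι (fun i => f (s i)) (fun i => f (t i))
    (fun i => ⟨(hP _ (hst i).1).2.2.2, (hP _ (hst i).2).2.2.2⟩) (fun i j hij => by
      obtain ⟨h1, h2, h3⟩ := hdist i j hij
      exact ⟨fun h => h1 (hfinj _ (hst i).1 _ (hst j).1 h),
        fun h => h2 (hfinj _ (hst i).1 _ (hst j).2 h), fun h => h3 (hfinj _ (hst i).2 _ (hst j).2 h)⟩)
  have hPR : ∀ x ∈ X, ∀ j p, p ∈ P x → p ∈ R j → x = s j ∨ x = t j := by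
    intro x hx j p hpx hpj
    have h1 : p = f x := (hP x hx).2.2.1 ⟨hpx, (hRi j).1 hpj⟩
    have h2 : p ∈ ({f (s j), f (t j)} : Set V) :=
      (hRi j).2.2 ⟨hpj, by rw [h1]; exact (hP x hx).2.2.2⟩
    rcases h2 with h2 | h2
    · exact .inl (hfinj _ hx _ (hst j).1 (h1.symm.trans h2))
    · exact .inr (hfinj _ hx _ (hst j).2 (h1.symm.trans h2))
  have hu : ∀ i p, p ∈ P (s i) ∪ R i ∪ P (t i) → p ∈ R i ∨ ∃ x ∈ X, (x = s i ∨ x = t i) ∧ p ∈ P x := by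
    rintro i p ((h | h) | h)
    exacts [.inr ⟨_, (hst i).1, .inl rfl, h⟩, .inl h, .inr ⟨_, (hst i).2, .inr rfl, h⟩]
  refine ⟨fun i => P (s i) ∪ R i ∪ P (t i), fun i j hij => ?_, fun i => ⟨?_, ?_, ?_⟩⟩
  · refine Set.disjoint_left.2 fun p hp hp' => ?_
    have h0 := hdist i j hij
    have h0' := hdist j i hij.symm
    rcases hu i p hp with hp | ⟨x, hx, hxi, hp⟩ <;> rcases hu j p hp' with hp' | ⟨y, hy, hyj, hp'⟩
    · exact Set.disjoint_left.1 (hR hij) hp hp'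
    · have := hPR y hy i p hp' hp
      grind
    · have := hPR x hx j p hp hp'
      grind
    · have := heq x hx y hy p hp hp'
      grind
  · exact Set.union_subset (Set.union_subset (hP _ (hst i).1).1
      ((hRi i).1.trans (by exact_mod_cast hLW))) (hP _ (hst i).2).1
  · refine (((hP _ (hst i).1).2.1.mono ?_).trans ((hRi i).2.1.mono ?_)).trans
      ((hP _ (hst i).2).2.1.symm.mono ?_)
    · exact fun x hx => .inl (.inl hx)
    · exact fun x hx => .inl (.inr hx)
    · exact fun x hx => .inr hx
  · rintro p ⟨hp, hpX⟩
    rcases hu i p hp with hp | ⟨x, hx, hxi, hp⟩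
    · exact hPR p hpX i p (hmem p hpX) hp
    · have := heq x hx p hpX p hp (hmem p hpX)
      rwa [this] at hxi

/-- The edges of `G` inside `W`. -/
def restrictTo (G : SimpleGraph V) (W : Finset V) : SimpleGraph V where
  Adj a b := G.Adj a b ∧ a ∈ W ∧ b ∈ W
  symm := ⟨fun _ _ h => ⟨h.1.symm, h.2.2, h.2.1⟩⟩
  loopless := ⟨fun v h => G.loopless.irrefl v h.1⟩

lemma ConnIn.of_restrictTo {G : SimpleGraph V} {W : Finset V} {P : Set V} {a b : V}
    (h : ConnIn (restrictTo G W) P a b) (ha : a ∈ W) : ConnIn G (P ∩ W) a b := by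
  have hb : b ∈ P ∩ W := ⟨h.right_mem, h.mem_of_closed (R := ↑W) ha fun x _ y _ _ hxy => hxy.2.2⟩
  exact h.lift hb fun x hx y hy hxy => .of_adj hxy.1 ⟨hx, hxy.2.1⟩ ⟨hy, hxy.2.2⟩

lemma ConnIn.to_restrictTo {G : SimpleGraph V} {W : Finset V} {P : Set V} {a b : V}
    (h : ConnIn G P a b) (hP : P ⊆ W) : ConnIn (restrictTo G W) P a b :=
  h.lift h.right_mem fun _ hx _ hy hxy => .of_adj ⟨hxy, hP hx, hP hy⟩ hx hy

/-- `(A, B)` is a separation of `G[W]` with `X` on its first side. -/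
structure Sep [DecidableEq V] (G : SimpleGraph V) (W X A B : Finset V) : Prop where
  union : A ∪ B = W
  sub : X ⊆ A
  not_adj : ∀ a ∈ A, a ∉ B → ∀ b ∈ B, b ∉ A → ¬ G.Adj a b

section Landing

variable [DecidableEq V] {G : SimpleGraph V} {W X L K : Finset V}

/-- The set `K` contains every vertex at which a connection from X can enter L, so the first vertex
of L lies in `K`. -/
lemma exists_first_hit (hX : X ⊆ W) (hK : ∀ v ∈ L, (v ∈ X ∨ ∃ u ∈ W, u ∉ L ∧ G.Adj u v) → v ∈ K)
    {P : Set V} {x l : V} (hx : x ∈ X) (hl : l ∈ L) (h : ConnIn (restrictTo G W) P x l) :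
    ∃ t ∈ K, ∃ P' ⊆ P ∩ W, ConnIn G P' x t ∧ t ∈ L ∧ P' ∩ L ⊆ {t} := by
  obtain ⟨t, ht, P', hP', hxP, hc, hp⟩ := (h.of_restrictTo (hX hx)).first_hit (T := ↑L) hl
  refine ⟨t, hK t ht ?_, P', hP', hc, ht, ?_⟩
  · by_contra! hno
    have htx : x ≠ t := fun h => hno.1 (h ▸ hx)
    refine hc.mem_of_closed (R := {p | p ≠ t}) htx (fun u hu v hv hut huv hvt => ?_) rfl
    exact hno.2 u (hP' hu).2 (hp u hu hut).1 (hvt ▸ huv)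
  · rintro p ⟨hpP, hpL⟩
    by_contra hne
    exact (hp p hpP hne).1 hpL

/-- Menger gives |X| disjoint X–L connections. Their number forces every vertex of X to start
exactly one, so a linkage of their landing points in L pulls back to X. -/
lemma linked_of_separators [Finite V] (hX : X ⊆ W) (hL : L ⊆ W)
    (hK : ∀ v ∈ L, (v ∈ X ∨ ∃ u ∈ W, u ∉ L ∧ G.Adj u v) → v ∈ K)
    (hlink : ∀ T ⊆ K, T.card ≤ X.card → Linked G L T)
    (hsep : ∀ S, Separates (restrictTo G W) X L S → X.card ≤ S.card) : Linked G W X := by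
  obtain ⟨P, hP, hc⟩ := menger _ X L _ hsep
  choose a ha l hl hal using hc
  choose t htK P' hP' hat htL hPt using fun i => exists_first_hit hX hK (ha i) (hl i) (hal i)
  have hP'd : Pairwise (Function.onFun Disjoint P') := fun i j hij =>
    (hP hij).mono ((hP' i).trans Set.inter_subset_left) ((hP' j).trans Set.inter_subset_left)
  have hex : ∀ x, ∃ (Q : Set V) (f : V), x ∈ X → ∃ i, a i = x ∧ Q = P' i ∧ f = t i := by
    intro x
    by_cases hx : x ∈ X
    · obtain ⟨i, hi⟩ := exists_index_of_mem hP'd rfl ha (fun i => (hat i).left_mem) hx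
      exact ⟨P' i, t i, fun _ => ⟨i, hi, rfl, rfl⟩⟩
    · exact ⟨∅, x, fun h => absurd h hx⟩
  choose Q f hQf using hex
  refine (hlink (X.image f) ?_ Finset.card_image_le).of_landing hL Q f (fun x hx => ?_) ?_
  · intro y hy
    obtain ⟨x, hx, rfl⟩ := Finset.mem_image.1 hy
    obtain ⟨i, -, -, h⟩ := hQf x hx
    rw [h]
    exact htK i
  · obtain ⟨i, h1, h2, h3⟩ := hQf x hx
    refine ⟨?_, ?_, ?_, Finset.mem_image_of_mem _ hx⟩
    · rw [h2]
      exact (hP' i).trans Set.inter_subset_right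
    · rw [h2, h3, ← h1]
      exact hat i
    · rw [h2, h3]
      exact hPt i
  · intro x hx y hy hxy
    obtain ⟨i, h1, h2, -⟩ := hQf x hx
    obtain ⟨j, h1', h2', -⟩ := hQf y hy
    rw [h2, h2']
    exact hP'd fun h => hxy (by rw [← h1, ← h1', h])

/-- Either the linkages of `L` extend to linkages of `X`, or some separation of smaller order than
`X` has `L` on its second side, and its separator is linked there. -/
lemma linked_or_exists_sep [Finite V] (hX : X ⊆ W) (hL : L ⊆ W)
    (hK : ∀ v ∈ L, (v ∈ X ∨ ∃ u ∈ W, u ∉ L ∧ G.Adj u v) → v ∈ K)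
    (hlink : ∀ T ⊆ K, T.card ≤ X.card → Linked G L T) :
    Linked G W X ∨ ∃ A B, Sep G W X A B ∧ L ⊆ B ∧ (A ∩ B).card < X.card ∧ Linked G B (A ∩ B) := by
  classical
  have hexS : ∃ n, ∃ S, Separates (restrictTo G W) X L S ∧ S.card = n :=
    ⟨_, X, fun a ha b hb h => h.left_mem ha, rfl⟩
  obtain ⟨S, hS, hSn⟩ := Nat.find_spec hexS
  have hmin : ∀ S', Separates (restrictTo G W) X L S' → S.card ≤ S'.card := fun S' hS' =>
    hSn ▸ Nat.find_min' hexS ⟨S', hS', rfl⟩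
  clear hSn
  by_cases hcard : X.card ≤ S.card
  · exact .inl (linked_of_separators hX hL hK hlink fun S' hS' => hcard.trans (hmin S' hS'))
  push Not at hcard
  right
  -- A minimum separator S has fewer than |X| elements here. The separation has S together with the
  -- part reachable from X on its first side, and everything not in that part on its second.
  set R : Finset V := W.filter fun v => ∃ x ∈ X, ConnIn (restrictTo G W) (↑S)ᶜ x v with hR
  have hRmem : ∀ v, v ∈ R ↔ v ∈ W ∧ ∃ x ∈ X, ConnIn (restrictTo G W) (↑S)ᶜ x v := by
    intro v
    simp [hR]
  have hRS : ∀ v ∈ R, v ∉ S := fun v hv => by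
    obtain ⟨-, x, -, h⟩ := (hRmem v).1 hv
    exact h.right_mem
  have hRadj : ∀ v ∈ R, ∀ u ∈ W, u ∉ S → G.Adj v u → u ∈ R := by
    intro v hv u hu huS hvu
    obtain ⟨hvW, x, hx, h⟩ := (hRmem v).1 hv
    exact (hRmem u).2 ⟨hu, x, hx, h.trans (.of_adj ⟨hvu, hvW, hu⟩ h.right_mem huS)⟩
  have hXR : ∀ x ∈ X, x ∉ S → x ∈ R := fun x hx hxS => (hRmem x).2 ⟨hX hx, x, hx, .refl hxS⟩
  have hLR : ∀ l ∈ L, l ∉ R := fun l hl h => by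
    obtain ⟨-, x, hx, h⟩ := (hRmem l).1 h
    exact hS x hx l hl h
  have hLB : L ⊆ W \ R := fun l hl => by simp [hL hl, hLR l hl]
  have hinter : ((S ∩ W) ∪ R) ∩ (W \ R) = S ∩ W := by
    ext v
    have := hRS v
    simp only [Finset.mem_inter, Finset.mem_union, Finset.mem_sdiff]
    tauto
  refine ⟨(S ∩ W) ∪ R, W \ R, ⟨?_, ?_, ?_⟩, hLB, ?_, ?_⟩
  · ext v
    have := hRmem v
    simp only [Finset.mem_inter, Finset.mem_union, Finset.mem_sdiff]
    tauto
  · intro x hx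
    have := hXR x hx
    have := hX hx
    simp only [Finset.mem_inter, Finset.mem_union]
    tauto
  · intro a ha haB b hb hbA hab
    simp only [Finset.mem_inter, Finset.mem_union, Finset.mem_sdiff, not_and, not_not] at *
    have := hRadj a (by tauto) b hb.1 (by tauto) hab
    tauto
  · rw [hinter]
    exact (Finset.card_le_card Finset.inter_subset_left).trans_lt hcard
  · rw [hinter]
    have hScard : (S ∩ W).card ≤ S.card := Finset.card_le_card Finset.inter_subset_left
    -- Whatever separates S from L on the second side also separates X from L in G[W], so it is no
    -- smaller than S.
    refine linked_of_separators (K := K) (fun v hv => ?_) hLB (fun v hvL hv => ?_)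
      (fun T hT hTc => hlink T hT (by omega)) (fun S' hS' => hScard.trans (hmin S' ?_))
    · have := hRS v
      simp only [Finset.mem_inter, Finset.mem_sdiff] at *
      tauto
    · rcases hv with hv | ⟨u, hu, huL, huv⟩
      -- By minimality some X–L connection avoids all of S except v. It enters L at a vertex of `K`;
      -- if v were not in `K`, the connection up to there would avoid S altogether.
      · by_contra hvK
        have hvS := (Finset.mem_inter.1 hv).1
        have : ¬ Separates (restrictTo G W) X L (S.erase v) := fun h => by
          have h1 := hmin _ h
          have h2 := Finset.card_erase_lt_of_mem hvS
          omega
        simp only [Separates, not_forall, not_not] at this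
        obtain ⟨x, hx, l, hl, hxl⟩ := this
        obtain ⟨t, ht, P', hP', hc, htL, hPL⟩ := exists_first_hit hX hK hx hl hxl
        refine hS x hx t htL ((hc.mono (Q := (↑S)ᶜ ∩ ↑W) fun p hp => ?_).to_restrictTo
          Set.inter_subset_right |>.mono Set.inter_subset_left)
        have h1 := hP' hp
        refine ⟨fun hpS => h1.1 ?_, h1.2⟩
        have : p ≠ v := by
          rintro rfl
          have h3 : p = t := hPL ⟨hp, hvL⟩
          exact hvK (h3 ▸ ht)
        simp [this]
        exact hpS
      · exact hK v hvL (.inr ⟨u, (Finset.mem_sdiff.1 hu).1, huL, huv⟩)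
    · intro x hx l hl hxl
      by_contra hno
      have hxR : x ∈ {v | ConnIn (restrictTo G (W \ R)) (↑S')ᶜ l v} := by
        refine hxl.symm.mem_of_closed (.refl hxl.right_mem) ?_
        intro v hv u hu hlv hvu
        have hvB : v ∈ W \ R := by
          rcases eq_or_ne l v with rfl | hne
          · exact hLB hl
          · exact hlv.mem_of_closed (R := ↑(W \ R)) (hLB hl) fun _ _ _ _ _ h => h.2.2
        have hvS : v ∉ S := fun hvS => hS' v (by simp [hvS, (Finset.mem_sdiff.1 hvB).1]) l hl hlv.symm
        have huB : u ∈ W \ R := by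
          refine Finset.mem_sdiff.2 ⟨hvu.2.2, fun huR => ?_⟩
          exact (Finset.mem_sdiff.1 hvB).2 (hRadj u huR v hvu.2.1 hvS hvu.1.symm)
        exact hlv.trans (.of_adj ⟨hvu.1, hvB, huB⟩ hv hu)
      have hxB : x ∈ W \ R := hxR.mem_of_closed (R := ↑(W \ R)) (hLB hl) fun _ _ _ _ _ h => h.2.2
      have hxS : x ∈ S := by
        by_contra hxS
        exact (Finset.mem_sdiff.1 hxB).2 (hXR x hx hxS)
      exact hS' x (by simp [hxS, hX hx]) l hl hxR.symm

end Landing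

section Substitution

variable [DecidableEq V] {G G₁ : SimpleGraph V} {A B K X : Finset V}

/-- A connection that meets a clique can jump directly from the clique vertex first reached from one
end to the one first reached from the other. -/
lemma exists_conn_inter_clique (hcl : ∀ a ∈ K, ∀ b ∈ K, a ≠ b → G.Adj a b) {P : Set V} {a b : V}
    (h : ConnIn G P a b) : ∃ P' ⊆ P, ConnIn G P' a b ∧
      (P' ∩ K = ∅ ∨ ∃ u ∈ K, ∃ v ∈ K, P' ∩ K = {u, v}) := by
  by_cases hex : ∃ k ∈ K, ConnIn G P a k
  · obtain ⟨k, hk, hak⟩ := hex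
    obtain ⟨u, hu, P₁, hP₁, haP, hau, h1⟩ := hak.first_hit (T := ↑K) hk
    obtain ⟨v, hv, P₂, hP₂, hbP, hbv, h2⟩ := (h.symm.trans hak).first_hit (T := ↑K) hk
    refine ⟨P₁ ∪ P₂, Set.union_subset hP₁ hP₂, ?_, .inr ⟨u, hu, v, hv, ?_⟩⟩
    · have h3 := hau.mono (Q := P₁ ∪ P₂) Set.subset_union_left
      have h4 := hbv.mono (Q := P₁ ∪ P₂) Set.subset_union_right
      refine (h3.trans ?_).trans h4.symm
      by_cases huv : u = v
      · subst huv
        exact .refl h3.right_mem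
      · exact .of_adj (hcl u hu v hv huv) h3.right_mem h4.right_mem
    · ext p
      constructor
      · rintro ⟨hp | hp, hpK⟩
        · left
          by_contra hne
          exact (h1 p hp hne).1 hpK
        · right
          by_contra hne
          exact (h2 p hp hne).1 hpK
      · rintro (rfl | rfl)
        · exact ⟨.inl hau.right_mem, hu⟩
        · exact ⟨.inr hbv.right_mem, hv⟩
  · push Not at hex
    refine ⟨P \ K, Set.sdiff_subset, ?_, .inl (by simp)⟩
    have haK : a ∉ K := fun h' => hex a h' (.refl h.left_mem)
    have : b ∈ {v | ConnIn G (P \ K) a v} := by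
      refine h.mem_of_closed (.refl ⟨h.left_mem, haK⟩) ?_
      intro u hu v hv hau huv
      have h1 : ConnIn G P a v := (hau.mono Set.sdiff_subset).trans (.of_adj huv hu hv)
      exact hau.trans (.of_adj huv hau.right_mem ⟨hv, fun hvK => hex v hvK h1⟩)
    exact this

/-- Virtual edges between vertices of `K` are replaced by a linkage of `K` on the other side. -/
lemma Linked.substitute (hAB : A ∩ B = K) (h₁ : Linked G₁ A X)
    (hG₁ : ∀ a ∈ A, ∀ b ∈ A, G₁.Adj a b → G.Adj a b ∨ a ∈ K ∧ b ∈ K)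
    (hcl : ∀ a ∈ K, ∀ b ∈ K, a ≠ b → G₁.Adj a b) (h₂ : Linked G B K) (hX : X ⊆ A) :
    Linked G (A ∪ B) X := by
  intro ι _ s t hst hd
  obtain ⟨P, hP, hPi⟩ := h₁ ι s t hst hd
  choose P' hP' hc hK using fun i => exists_conn_inter_clique hcl (hPi i).2.1
  have heq : ∀ i j p, p ∈ P' i → p ∈ P' j → i = j := by
    intro i j p hi hj
    by_contra hne
    exact Set.disjoint_left.1 (hP hne) (hP' i hi) (hP' j hj)
  -- Only connections meeting `K` can use virtual edges. Each has at most two vertices there, so one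
  -- connection on the other side replaces its virtual edge.
  let J := {i : ι // ∃ u ∈ K, ∃ v ∈ K, P' i ∩ K = {u, v}}
  choose u hu v hv huv using fun j : J => j.2
  have huP : ∀ j : J, u j ∈ P' j := fun j => by
    have : u j ∈ P' j ∩ K := by simp [huv]
    exact this.1
  have hvP : ∀ j : J, v j ∈ P' j := fun j => by
    have : v j ∈ P' j ∩ K := by simp [huv]
    exact this.1
  obtain ⟨R, hR, hRi⟩ := h₂ J u v (fun j => ⟨hu j, hv j⟩) (by
    intro i j hij
    refine ⟨fun h => hij (Subtype.ext (heq _ _ _ (huP i) (h ▸ huP j))),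
      fun h => hij (Subtype.ext (heq _ _ _ (huP i) (h ▸ hvP j))),
      fun h => hij (Subtype.ext (heq _ _ _ (hvP i) (h ▸ hvP j)))⟩)
  have hRK : ∀ j : J, ∀ p ∈ R j, p ∈ A → p ∈ P' j := by
    intro j p hp hpA
    have : p ∈ K := by
      rw [← hAB]
      exact Finset.mem_inter.2 ⟨hpA, by exact_mod_cast (hRi j).1 hp⟩
    rcases (hRi j).2.2 ⟨hp, this⟩ with h | h
    · exact h ▸ huP j
    · exact h ▸ hvP j
  have hPA : ∀ i, ∀ p ∈ P' i, p ∈ A := fun i p hp => by exact_mod_cast (hPi i).1 (hP' i hp)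
  refine ⟨fun i => {p | p ∈ P' i ∨ ∃ j : J, j.1 = i ∧ p ∈ R j}, fun i j hij => ?_,
    fun i => ⟨?_, ?_, ?_⟩⟩
  · refine Set.disjoint_left.2 ?_
    rintro p (hp | ⟨i', rfl, hp⟩) (hp' | ⟨j', rfl, hp'⟩)
    · exact hij (heq _ _ _ hp hp')
    · exact hij (heq _ _ _ hp (hRK j' p hp' (hPA _ p hp)))
    · exact hij (heq _ _ _ (hRK i' p hp (hPA _ p hp')) hp')
    · exact Set.disjoint_left.1 (hR fun h => hij (congrArg Subtype.val h)) hp hp'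
  · rintro p (hp | ⟨i', rfl, hp⟩)
    · simp [hPA _ p hp]
    · have : p ∈ B := by exact_mod_cast (hRi i').1 hp
      simp [this]
  · refine (hc i).lift (.inl (hc i).right_mem) fun x hx y hy hxy => ?_
    rcases hG₁ x (hPA i x hx) y (hPA i y hy) hxy with h | ⟨hxK, hyK⟩
    · exact .of_adj h (.inl hx) (.inl hy)
    · have hx' : x ∈ P' i ∩ K := ⟨hx, hxK⟩
      have hy' : y ∈ P' i ∩ K := ⟨hy, hyK⟩
      rcases hK i with h0 | h0
      · rw [h0] at hx'
        exact absurd hx' (by simp)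
      · have hj := (hRi ⟨i, h0⟩).2.1
        have hsub : R ⟨i, h0⟩ ⊆ {p | p ∈ P' i ∨ ∃ j : J, j.1 = i ∧ p ∈ R j} :=
          fun p hp => .inr ⟨⟨i, h0⟩, rfl, hp⟩
        have hj := hj.mono hsub
        have heq2 := huv ⟨i, h0⟩
        simp only at heq2
        rw [heq2] at hx' hy'
        rcases hx' with rfl | rfl <;> rcases hy' with rfl | rfl
        · exact absurd rfl hxy.ne
        · exact hj
        · exact hj.symm
        · exact absurd rfl hxy.ne
  · rintro p ⟨hp | ⟨i', rfl, hp⟩, hpX⟩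
    · exact (hPi i).2.2 ⟨hP' i hp, hpX⟩
    · exact (hPi _).2.2 ⟨hP' _ (hRK i' p hp (hX (by exact_mod_cast hpX))), hpX⟩

end Substitution

section Contraction

variable [DecidableEq V] {G : SimpleGraph V} {W X : Finset V} {u v : V}

/-- Contract `v` into `u`; the vertex `v` becomes isolated. -/
def contractTo (G : SimpleGraph V) (u v : V) : SimpleGraph V where
  Adj a b := a ≠ b ∧ a ≠ v ∧ b ≠ v ∧ (G.Adj a b ∨ a = u ∧ G.Adj v b ∨ b = u ∧ G.Adj v a)
  symm := ⟨fun _ _ h => ⟨h.1.symm, h.2.2.1, h.2.1, by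
    have := h.2.2.2
    rw [G.adj_comm]
    tauto⟩⟩
  loopless := ⟨fun _ h => h.1 rfl⟩

/-- Undo the contraction by adding v to the connecting set containing u, if there is one. As v is
not a terminal, no condition on X is violated. -/
lemma Linked.of_contractTo (huv : G.Adj u v) (hv : v ∉ W) (hvX : v ∉ X)
    (h : Linked (contractTo G u v) W X) : Linked G (insert v W) X := by
  intro ι _ s t hst hd
  obtain ⟨P, hP, hPi⟩ := h ι s t hst hd
  have hvP : ∀ i, v ∉ P i := fun i hi => hv (by exact_mod_cast (hPi i).1 hi)
  refine ⟨fun i => {p | p ∈ P i ∨ p = v ∧ u ∈ P i}, fun i j hij => ?_, fun i => ⟨?_, ?_, ?_⟩⟩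
  · refine Set.disjoint_left.2 ?_
    rintro p (hp | ⟨rfl, hp⟩) (hp' | ⟨hpv, hp'⟩)
    · exact Set.disjoint_left.1 (hP hij) hp hp'
    · exact hvP i (hpv ▸ hp)
    · exact hvP j hp'
    · exact Set.disjoint_left.1 (hP hij) hp hp'
  · rintro p (hp | ⟨rfl, hp⟩)
    · have : p ∈ W := by exact_mod_cast (hPi i).1 hp
      simp [this]
    · simp
  · refine (hPi i).2.1.lift (.inl (hPi i).2.1.right_mem) fun x hx y hy hxy => ?_
    rcases hxy.2.2.2 with h' | ⟨rfl, h'⟩ | ⟨rfl, h'⟩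
    · exact .of_adj h' (.inl hx) (.inl hy)
    · exact (ConnIn.of_adj huv (.inl hx) (.inr ⟨rfl, hx⟩)).trans (.of_adj h' (.inr ⟨rfl, hx⟩) (.inl hy))
    · exact (ConnIn.of_adj h'.symm (.inl hx) (.inr ⟨rfl, hy⟩)).trans
        (.of_adj huv.symm (.inr ⟨rfl, hy⟩) (.inl hy))
  · rintro p ⟨hp | ⟨rfl, hp⟩, hpX⟩
    · exact (hPi i).2.2 ⟨hp, hpX⟩
    · exact absurd (by exact_mod_cast hpX) hvX

end Contraction

end OddCycles

/-! ### Massed pairs and rigid separations -/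

namespace OddCycles

variable {V : Type*}

/-- The number of ordered pairs of adjacent vertices of `G[W]` that meet `Y`, that is, twice the
number of edges of `G[W]` that meet `Y`. -/
noncomputable def dartCount (G : SimpleGraph V) (W Y : Finset V) : ℕ :=
  {p : V × V | p.1 ∈ W ∧ p.2 ∈ W ∧ G.Adj p.1 p.2 ∧ (p.1 ∈ Y ∨ p.2 ∈ Y)}.ncard

lemma dartCount_mono [Finite V] {G G' : SimpleGraph V} {W W' Y Y' : Finset V} (hW : W ⊆ W')
    (hY : Y ⊆ Y') (hG : ∀ a ∈ W, ∀ b ∈ W, (a ∈ Y ∨ b ∈ Y) → G.Adj a b → G'.Adj a b) :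
    dartCount G W Y ≤ dartCount G' W' Y' :=
  Set.ncard_le_ncard (fun _ h => ⟨hW h.1, hW h.2.1, hG _ h.1 _ h.2.1 h.2.2.2 h.2.2.1,
    h.2.2.2.imp (@hY _) (@hY _)⟩) (Set.toFinite _)

lemma dartCount_empty {G : SimpleGraph V} {W : Finset V} : dartCount G W ∅ = 0 := by
  simp [dartCount]

/-- Add all edges between vertices of `K`. -/
def addClique (G : SimpleGraph V) (K : Finset V) : SimpleGraph V where
  Adj a b := a ≠ b ∧ (G.Adj a b ∨ a ∈ K ∧ b ∈ K)
  symm := ⟨fun _ _ h => ⟨h.1.symm, h.2.imp SimpleGraph.Adj.symm And.symm⟩⟩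
  loopless := ⟨fun _ h => h.1 rfl⟩

lemma le_addClique {G : SimpleGraph V} (K : Finset V) : G ≤ addClique G K := fun _ _ h => ⟨h.ne, .inl h⟩

section

variable [DecidableEq V]

/-- `(G[W], X)` is `lam`-massed: more than `lam * |W \ X|` edges of `G[W]` meet `W \ X`, and no
separation of order less than `|X|` has this property on its second side. -/
structure Massed (lam : ℕ) (G : SimpleGraph V) (W X : Finset V) : Prop where
  lt : 2 * lam * (W \ X).card < dartCount G W (W \ X)
  le : ∀ A B, Sep G W X A B → (A ∩ B).card < X.card →
    dartCount G W (B \ A) ≤ 2 * lam * (B \ A).card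

variable {lam m : ℕ} {G : SimpleGraph V} {W X A B : Finset V}

lemma Sep.left_subset (hs : Sep G W X A B) : A ⊆ W := hs.union ▸ Finset.subset_union_left

lemma Sep.right_subset (hs : Sep G W X A B) : B ⊆ W := hs.union ▸ Finset.subset_union_right

lemma Sep.mem_or (hs : Sep G W X A B) {v : V} (hv : v ∈ W) : v ∈ A ∨ v ∈ B := by
  rwa [← hs.union, Finset.mem_union] at hv

/-- Edges at B \ A do not leave B. -/
lemma Sep.dartCount_right_le [Finite V] (hs : Sep G W X A B) :
    dartCount G W (B \ A) ≤ dartCount G B (B \ A) := by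
  refine Set.ncard_le_ncard ?_ (Set.toFinite _)
  rintro ⟨a, b⟩ ⟨ha, hb, hab, h⟩
  have h1 := hs.not_adj a
  have h2 := hs.not_adj b
  have h3 := hs.mem_or ha
  have h4 := hs.mem_or hb
  have h5 := hab.symm
  simp only [Finset.mem_sdiff] at h
  refine ⟨?_, ?_, hab, by simpa using h⟩
  · by_contra haB
    have := h1 (by tauto) haB b
    tauto
  · by_contra hbB
    have := h2 (by tauto) hbB a
    tauto

lemma Sep.dartCount_le_add [Finite V] (hs : Sep G W X A B) :
    dartCount G W (W \ X) ≤ dartCount G A (A \ X) + dartCount G W (B \ A) := by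
  refine (Set.ncard_le_ncard ?_ (Set.toFinite _)).trans (Set.ncard_union_le _ _)
  rintro ⟨a, b⟩ ⟨ha, hb, hab, h⟩
  have h3 := hs.mem_or ha
  have h4 := hs.mem_or hb
  simp only [Finset.mem_sdiff, Set.mem_union, Set.mem_ofPred_eq] at *
  tauto

lemma Sep.card_sdiff (hs : Sep G W X A B) : (W \ X).card = (A \ X).card + (B \ A).card := by
  rw [← Finset.card_union_of_disjoint]
  · congr 1
    ext v
    have h1 := @hs.sub v
    rw [← hs.union]
    simp only [Finset.mem_sdiff, Finset.mem_union]
    tauto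
  · exact Finset.disjoint_left.2 fun v h1 h2 => (Finset.mem_sdiff.1 h2).2 (Finset.mem_sdiff.1 h1).1

/-- The strict density bound rules out B \ A = ∅. This makes the inductions over separations
progress. -/
lemma Massed.not_subset (h : Massed lam G B (A ∩ B)) : ¬ B ⊆ A := by
  intro hBA
  have h1 := h.lt
  rw [Finset.sdiff_eq_empty_iff_subset.2 (Finset.subset_inter hBA subset_rfl), dartCount_empty] at h1
  omega

/-- A separation with a dense second side can be chosen so that this side is massed. -/
lemma Sep.exists_massed [Finite V] {n : ℕ} (hs : Sep G W X A B) (hn : (A ∩ B).card ≤ n)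
    (hD : 2 * lam * (B \ A).card < dartCount G W (B \ A)) :
    ∃ A' B', Sep G W X A' B' ∧ (A' ∩ B').card ≤ n ∧ B' ⊆ B ∧ Massed lam G B' (A' ∩ B') := by
  induction hN : B.card using Nat.strong_induction_on generalizing A B with
  | _ N ih =>
  subst hN
  have hBA : B \ (A ∩ B) = B \ A := by
    ext
    simp only [Finset.mem_sdiff, Finset.mem_inter]
    tauto
  by_cases hM : ∀ A₁ B₁, Sep G B (A ∩ B) A₁ B₁ → (A₁ ∩ B₁).card < (A ∩ B).card →
    dartCount G B (B₁ \ A₁) ≤ 2 * lam * (B₁ \ A₁).card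
  · exact ⟨A, B, hs, hn, subset_rfl, by rw [hBA]; exact hD.trans_le hs.dartCount_right_le, hM⟩
  push Not at hM
  -- A separation of G[B] violating massedness extends to the separation (A ∪ A₁, B₁) of G[W], which
  -- has smaller order, a dense second side, and fewer vertices on that side.
  obtain ⟨A₁, B₁, hs₁, hlt, hD₁⟩ := hM
  have hsub : ∀ v, v ∈ A → v ∈ B → v ∈ A₁ := fun v h1 h2 => hs₁.sub (Finset.mem_inter.2 ⟨h1, h2⟩)
  have hB₁ := hs₁.right_subset
  have hA₁ := hs₁.left_subset
  have h1 : B₁ \ (A ∪ A₁) = B₁ \ A₁ := by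
    ext v
    have := hsub v
    have := @hB₁ v
    simp only [Finset.mem_sdiff, Finset.mem_union]
    tauto
  have h2 : (A ∪ A₁) ∩ B₁ = A₁ ∩ B₁ := by
    ext v
    have := hsub v
    have := @hB₁ v
    simp only [Finset.mem_inter, Finset.mem_union]
    tauto
  have hs' : Sep G W X (A ∪ A₁) B₁ := by
    refine ⟨?_, hs.sub.trans Finset.subset_union_left, fun a ha haB b hb hbA => ?_⟩
    · rw [Finset.union_assoc, hs₁.union, hs.union]
    · rw [Finset.mem_union] at ha hbA
      push Not at hbA
      by_cases haB' : a ∈ B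
      · exact hs₁.not_adj a ((hs₁.mem_or haB').resolve_right haB) haB b hb hbA.2
      · exact hs.not_adj a (ha.resolve_right fun h => haB' (hA₁ h)) haB' b (hB₁ hb) hbA.1
  have hcard : B₁.card < B.card := by
    refine Finset.card_lt_card ⟨hB₁, fun h => ?_⟩
    refine hlt.not_ge (Finset.card_le_card fun v hv => Finset.mem_inter.2 ⟨hs₁.sub hv, h ?_⟩)
    exact (Finset.mem_inter.1 hv).2
  obtain ⟨A', B', h3, h4, h5, h6⟩ := ih _ hcard hs' (by rw [h2]; omega) (by
    rw [h1]
    exact hD₁.trans_le (dartCount_mono hs.right_subset subset_rfl fun _ _ _ _ _ h => h)) rfl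
  exact ⟨A', B', h3, h4, h5.trans hB₁, h6⟩

/-- Every massed pair on fewer than `n` vertices with at most `m` terminals is linked. -/
def MassedLinkedBelow (V : Type*) [DecidableEq V] (lam m n : ℕ) : Prop :=
  ∀ (G : SimpleGraph V) (W X : Finset V), W.card < n → X.card ≤ m → X ⊆ W → Massed lam G W X →
    Linked G W X

/-- The side B can be replaced by a clique on the separator K: it contributes few edges by
massedness, and linkages through the clique can be rerouted through B. If the reduced pair is not
massed, a dense separation of it leads either to a contradiction or to a rigid separation with a
smaller first side. -/
lemma linked_of_rigid_of_lt [Finite V] (ih : MassedLinkedBelow V lam m W.card) (hXm : X.card ≤ m)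
    (hM : Massed lam G W X) (hs : Sep G W X A B) (hlt : (A ∩ B).card < X.card) (hAW : A ≠ W)
    (hr : Linked G B (A ∩ B)) : Linked G W X := by
  induction hN : A.card using Nat.strong_induction_on generalizing A B with
  | _ N ihA =>
  subst hN
  have hcard : A.card < W.card :=
    Finset.card_lt_card (hs.left_subset.ssubset_of_ne hAW)
  set K := A ∩ B with hK
  have hcl : ∀ a ∈ K, ∀ b ∈ K, a ≠ b → (addClique G K).Adj a b := fun a ha b hb hab =>
    ⟨hab, .inr ⟨ha, hb⟩⟩
  by_cases hM' : Massed lam (addClique G K) A X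
  · have h1 := ih _ _ _ hcard hXm hs.sub hM'
    have := h1.substitute (G := G) hK.symm (fun _ _ _ _ h => h.2) hcl hr hs.sub
    rwa [hs.union] at this
  obtain ⟨A₁, B₁, hs₁, hlt₁, hD₁⟩ : ∃ A₁ B₁, Sep (addClique G K) A X A₁ B₁ ∧
      (A₁ ∩ B₁).card < X.card ∧
      2 * lam * (B₁ \ A₁).card < dartCount (addClique G K) A (B₁ \ A₁) := by
    by_contra! hno
    refine hM' ⟨?_, hno⟩
    have h1 := hs.dartCount_le_add
    have h2 := hM.lt
    have h3 := hM.le A B hs hlt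
    have h4 : dartCount G A (A \ X) ≤ dartCount (addClique G K) A (A \ X) :=
      dartCount_mono subset_rfl subset_rfl fun _ _ _ _ _ h => le_addClique K h
    rw [hs.card_sdiff, Nat.mul_add] at h2
    omega
  obtain ⟨A₂, B₂, hs₂, hn₂, -, hM₂⟩ := hs₁.exists_massed (n := X.card - 1) (by omega) hD₁
  have hlt₂ : (A₂ ∩ B₂).card < X.card := by omega
  have hA₂ := hs₂.left_subset
  have hB₂ := hs₂.right_subset
  by_cases hKA : K ⊆ A₂
  -- With the clique on the first side, B can be put back there. The separation then violates
  -- massedness of the original pair, since no virtual edge meets B₂ \ A₂.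
  · exfalso
    have h1 : B₂ \ (A₂ ∪ B) = B₂ \ A₂ := by
      ext v
      have := @hB₂ v
      have := @hKA v
      simp only [Finset.mem_sdiff, Finset.mem_union, hK, Finset.mem_inter] at *
      tauto
    have h2 : (A₂ ∪ B) ∩ B₂ = A₂ ∩ B₂ := by
      ext v
      have := @hB₂ v
      have := @hKA v
      simp only [Finset.mem_inter, Finset.mem_union, hK, Finset.mem_inter] at *
      tauto
    have h3 := hM.le (A₂ ∪ B) B₂ ⟨?_, hs₂.sub.trans Finset.subset_union_left, ?_⟩ (by rwa [h2])
    · have h4 := hM₂.lt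
      rw [h1] at h3
      have h5 : B₂ \ (A₂ ∩ B₂) = B₂ \ A₂ := by
        ext
        simp only [Finset.mem_sdiff, Finset.mem_inter]
        tauto
      rw [h5] at h4
      have h6 : dartCount (addClique G K) B₂ (B₂ \ A₂) ≤ dartCount G W (B₂ \ A₂) := by
        refine dartCount_mono (hB₂.trans hs.left_subset) subset_rfl ?_
        rintro a - b - hab ⟨-, h | ⟨ha, hb⟩⟩
        · exact h
        · have := hKA ha
          have := hKA hb
          simp only [Finset.mem_sdiff] at hab
          tauto
      omega
    · rw [← hs.union, ← hs₂.union]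
      ext
      simp only [Finset.mem_union]
      tauto
    · intro a ha haB b hb hbA hab
      rw [Finset.mem_union] at ha hbA
      push Not at hbA
      by_cases ha' : a ∈ A₂
      · exact hs₂.not_adj a ha' haB b hb hbA.1 (le_addClique K hab)
      · have haA : a ∉ A := fun h => (hs₂.mem_or h).elim ha' haB
        exact hs.not_adj b (hB₂ hb) hbA.2 a (ha.resolve_left ha') haA hab.symm
  -- A clique cannot be split by a separation, so now K lies in B₂. The massed side B₂ is linked by
  -- induction, and substituting B for the virtual edges makes B₂ ∪ B the linked side of a new
  -- separation.
  · have hKB : K ⊆ B₂ := by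
      intro x hx
      by_contra hxB
      obtain ⟨y, hy, hyA⟩ := Finset.not_subset.1 hKA
      have hxA : x ∈ A₂ := (hs₂.mem_or (Finset.mem_inter.1 hx).1).resolve_right hxB
      have hyB : y ∈ B₂ := (hs₂.mem_or (Finset.mem_inter.1 hy).1).resolve_left hyA
      exact hs₂.not_adj x hxA hxB y hyB hyA (hcl x hx y hy fun h => hxB (h ▸ hyB))
    have h1 := ih _ _ _ ((Finset.card_le_card hB₂).trans_lt hcard) (hlt₂.le.trans hXm)
      Finset.inter_subset_right hM₂
    have hBK : B₂ ∩ B = K := by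
      ext v
      have := @hB₂ v
      have := @hKB v
      simp only [hK, Finset.mem_inter] at *
      tauto
    have h2 := h1.substitute (G := G) hBK (fun _ _ _ _ h => h.2) hcl hr Finset.inter_subset_right
    have h3 : A₂ ∩ (B₂ ∪ B) = A₂ ∩ B₂ := by
      ext v
      have := @hA₂ v
      have := @hKB v
      simp only [hK, Finset.mem_inter, Finset.mem_union] at *
      tauto
    have hssub : A₂ ⊂ A := hA₂.ssubset_of_ne fun h => hM₂.not_subset (h ▸ hB₂)
    refine ihA _ (Finset.card_lt_card hssub) (A := A₂) (B := B₂ ∪ B) ⟨?_, hs₂.sub, ?_⟩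
      (by rwa [h3]) (fun h => (hssub.trans_subset hs.left_subset).ne h) (by rwa [h3]) rfl
    · rw [← Finset.union_assoc, hs₂.union, hs.union]
    · intro a ha haB b hb hbA hab
      rw [Finset.mem_union] at haB hb
      push Not at haB
      by_cases hb' : b ∈ B₂
      · exact hs₂.not_adj a ha haB.1 b hb' hbA (le_addClique K hab)
      · have hbA' : b ∉ A := fun h => (hs₂.mem_or h).elim hbA hb'
        exact hs.not_adj a (hA₂ ha) haB.2 b (hb.resolve_left hb') hbA' hab

/-- If the order is exactly |X|, either Menger carries X into the separator, or there is a rigid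
separation of smaller order, whose first side is proper because its second side contains B. -/
lemma linked_of_rigid [Finite V] (ih : MassedLinkedBelow V lam m W.card) (hXm : X.card ≤ m)
    (hM : Massed lam G W X) (hs : Sep G W X A B) (hle : (A ∩ B).card ≤ X.card) (hAW : A ≠ W)
    (hr : Linked G B (A ∩ B)) : Linked G W X := by
  rcases hle.lt_or_eq with hlt | heq
  · exact linked_of_rigid_of_lt ih hXm hM hs hlt hAW hr
  have hK : ∀ v ∈ B, (v ∈ X ∨ ∃ u ∈ W, u ∉ B ∧ G.Adj u v) → v ∈ A ∩ B := by
    refine fun v hv h => Finset.mem_inter.2 ⟨?_, hv⟩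
    rcases h with h | ⟨u, hu, huB, huv⟩
    · exact hs.sub h
    · by_contra hvA
      exact hs.not_adj u ((hs.mem_or hu).resolve_right huB) huB v hv hvA huv
  rcases linked_or_exists_sep (hs.sub.trans hs.left_subset) hs.right_subset hK
    (fun T hT _ => hr.mono le_rfl subset_rfl hT) with h | ⟨A', B', hs', hBB, hlt, hr'⟩
  · exact h
  · refine linked_of_rigid_of_lt ih hXm hM hs' hlt (fun h => ?_) hr'
    have h1 : B ⊆ A' ∩ B' := Finset.subset_inter (h ▸ hs.right_subset) hBB
    have h2 := Finset.card_le_card h1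
    have h3 := Finset.card_le_card (Finset.inter_subset_right (s₁ := A) (s₂ := B))
    omega

/-- A dense proper side contains a massed side, which is linked by induction and therefore rigid.
Order |X| is allowed, one more than massedness itself controls; this pays for the vertex added when
an edge operation is undone. -/
lemma linked_of_dense_side [Finite V] (ih : MassedLinkedBelow V lam m W.card) (hXm : X.card ≤ m)
    (hM : Massed lam G W X) (hs : Sep G W X A B) (hle : (A ∩ B).card ≤ X.card) (hBW : B ≠ W)
    (hD : 2 * lam * (B \ A).card < dartCount G W (B \ A)) : Linked G W X := by
  obtain ⟨A', B', hs', hn, hB', hM'⟩ := hs.exists_massed hle hD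
  have h1 := ih _ _ _ (Finset.card_lt_card ((hB'.trans_ssubset
    (hs.right_subset.ssubset_of_ne hBW)))) (hn.trans hXm) Finset.inter_subset_right hM'
  exact linked_of_rigid ih hXm hM hs' hn (fun h => hM'.not_subset (h ▸ hs'.right_subset)) h1

end

end OddCycles

/-! ### Minimal counterexamples: contracting and deleting edges -/

namespace OddCycles

variable {V : Type*} [DecidableEq V] {lam m : ℕ} {G : SimpleGraph V} {W X A B : Finset V} {u v : V}

/-- The common neighbours of `u` and `v` in `G[W]`. -/
def commonNbrs (G : SimpleGraph V) (W : Finset V) (u v : V) : Set V :=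
  {w | w ∈ W ∧ G.Adj u w ∧ G.Adj v w}

lemma eq_and_eq_of_collapse {a b a' b' : V} (h : G.Adj a b) (h' : G.Adj a' b')
    (ha : a = v → b ≠ u ∧ ¬ G.Adj u b) (hb : b = v → a ≠ u ∧ ¬ G.Adj u a)
    (ha' : a' = v → b' ≠ u ∧ ¬ G.Adj u b') (hb' : b' = v → a' ≠ u ∧ ¬ G.Adj u a')
    (e₁ : (if a = v then u else a) = if a' = v then u else a')
    (e₂ : (if b = v then u else b) = if b' = v then u else b') : a = a' ∧ b = b' := by
  have := h.symm
  have := h'.symm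
  have := h.ne
  have := h'.ne
  grind

/-- Contracting uv loses the edge itself and merges one pair of edges for each common neighbour.
After discarding the darts of uv and those from v to common neighbours, collapsing v onto u is
injective. -/
lemma dartCount_le_contractTo [Finite V] (hu : u ∈ W \ X) (hv : v ∈ W \ X) (huv : G.Adj u v) :
    dartCount G W (W \ X) ≤ dartCount (contractTo G u v) (W.erase v) (W.erase v \ X) + 2 +
      2 * (commonNbrs G W u v).ncard := by
  have hne := huv.ne
  set S : Set (V × V) :=
    {p | p.1 ∈ W ∧ p.2 ∈ W ∧ G.Adj p.1 p.2 ∧ (p.1 ∈ W \ X ∨ p.2 ∈ W \ X)} with hS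
  set E : Set (V × V) := {(u, v), (v, u)} with hE
  set C₁ : Set (V × V) := (fun w => (v, w)) '' commonNbrs G W u v with hC₁
  set C₂ : Set (V × V) := (fun w => (w, v)) '' commonNbrs G W u v with hC₂
  set good : Set (V × V) := S \ (E ∪ (C₁ ∪ C₂)) with hgood
  have h1 : S.ncard ≤ good.ncard + (E ∪ (C₁ ∪ C₂)).ncard := by
    rw [hgood]
    have h := Set.ncard_le_ncard (s := S) (t := (S \ (E ∪ (C₁ ∪ C₂))) ∪ (E ∪ (C₁ ∪ C₂)))
      (by intro x hx; by_cases h : x ∈ E ∪ (C₁ ∪ C₂) <;> simp [h, hx]) (Set.toFinite _)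
    exact h.trans (Set.ncard_union_le _ _)
  have h2 : (E ∪ (C₁ ∪ C₂)).ncard ≤ 2 + 2 * (commonNbrs G W u v).ncard := by
    have h3 := Set.ncard_union_le E (C₁ ∪ C₂)
    have h4 := Set.ncard_union_le C₁ C₂
    have h5 : C₁.ncard ≤ (commonNbrs G W u v).ncard := Set.ncard_image_le (Set.toFinite _)
    have h6 : C₂.ncard ≤ (commonNbrs G W u v).ncard := Set.ncard_image_le (Set.toFinite _)
    have h7 : E.ncard ≤ 2 := by
      refine (Set.ncard_insert_le _ _).trans ?_
      simp
    omega
  let r : V → V := fun a => if a = v then u else a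
  have hgoodmem : ∀ a b, (a, b) ∈ good → a ∈ W ∧ b ∈ W ∧ G.Adj a b ∧ (a ∉ X ∨ b ∉ X) ∧
      (a = v → b ≠ u ∧ ¬ G.Adj u b) ∧ (b = v → a ≠ u ∧ ¬ G.Adj u a) := by
    rintro a b ⟨⟨g1, g2, g3, g4⟩, g5⟩
    simp only [hE, hC₁, hC₂, commonNbrs, Set.mem_union, Set.mem_insert_iff,
      Set.mem_singleton_iff, Prod.mk.injEq, Set.mem_image, Set.mem_ofPred_eq, not_or] at g5
    simp only [Finset.mem_sdiff] at g4
    refine ⟨g1, g2, g3, by tauto, ?_, ?_⟩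
    · rintro rfl
      exact ⟨fun h => g5.1.2 ⟨rfl, h⟩, fun h => g5.2.1 ⟨b, ⟨g2, h, g3⟩, rfl, rfl⟩⟩
    · rintro rfl
      exact ⟨fun h => g5.1.1 ⟨h, rfl⟩, fun h => g5.2.2 ⟨a, ⟨g1, h, g3.symm⟩, rfl, rfl⟩⟩
  have h3 : good.ncard ≤ dartCount (contractTo G u v) (W.erase v) (W.erase v \ X) := by
    rw [Finset.mem_sdiff] at hu hv
    refine Set.ncard_le_ncard_of_injOn (fun p => (r p.1, r p.2)) ?_ ?_ (Set.toFinite _)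
    · rintro ⟨a, b⟩ hp
      obtain ⟨g1, g2, g3, g4, g5, g6⟩ := hgoodmem a b hp
      have hab := g3.ne
      simp only [Set.mem_ofPred_eq, contractTo, Finset.mem_sdiff, Finset.mem_erase, r]
      split_ifs with ha hb hb
      · exact absurd (ha.trans hb.symm) hab
      · subst ha
        refine ⟨⟨hne, hu.1⟩, ⟨hb, g2⟩, ⟨(g5 rfl).1.symm, hne, hb, .inr (.inl ⟨rfl, g3⟩)⟩,
          .inl ⟨⟨hne, hu.1⟩, hu.2⟩⟩
      · subst hb
        refine ⟨⟨ha, g1⟩, ⟨hne, hu.1⟩, ⟨(g6 rfl).1, ha, hne, .inr (.inr ⟨rfl, g3.symm⟩)⟩,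
          .inr ⟨⟨hne, hu.1⟩, hu.2⟩⟩
      · exact ⟨⟨ha, g1⟩, ⟨hb, g2⟩, ⟨hab, ha, hb, .inl g3⟩, by tauto⟩
    · rintro ⟨a, b⟩ hp ⟨a', b'⟩ hp' heq
      obtain ⟨-, -, h3, -, h5, h6⟩ := hgoodmem a b hp
      obtain ⟨-, -, h3', -, h5', h6'⟩ := hgoodmem a' b' hp'
      simp only [Prod.mk.injEq, r] at heq ⊢
      exact eq_and_eq_of_collapse h3 h3' h5 h6 h5' h6' heq.1 heq.2
  change S.ncard ≤ _
  omega

lemma card_erase_sdiff (hv : v ∈ W \ X) : (W.erase v \ X).card + 1 = (W \ X).card := by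
  rw [Finset.erase_sdiff_comm, Finset.card_erase_add_one hv]

/-- Contract uv. If the result is massed, induction applies. If it is too sparse, the lost edges
must come from common neighbours. If a small separation becomes dense, it lifts back to G according
to the side on which u lies. -/
lemma linked_or_commonNbrs [Finite V] (ih : MassedLinkedBelow V lam m W.card) (hXm : X.card ≤ m)
    (hX : X ⊆ W) (hM : Massed lam G W X) (hu : u ∈ W \ X) (hv : v ∈ W \ X) (huv : G.Adj u v) :
    Linked G W X ∨ lam ≤ (commonNbrs G W u v).ncard := by
  classical
  have hne := huv.ne
  have hu' := Finset.mem_sdiff.1 hu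
  have hv' := Finset.mem_sdiff.1 hv
  have hcard : (W.erase v).card < W.card := Finset.card_erase_lt_of_mem hv'.1
  have hXW : X ⊆ W.erase v := fun x hx => Finset.mem_erase.2 ⟨fun h => hv'.2 (h ▸ hx), hX hx⟩
  have hvW : v ∉ W.erase v := Finset.notMem_erase v W
  by_cases hM1 : 2 * lam * (W.erase v \ X).card <
      dartCount (contractTo G u v) (W.erase v) (W.erase v \ X)
  swap
  · right
    have h1 := dartCount_le_contractTo hu hv huv
    have h2 := hM.lt
    have h3 := card_erase_sdiff hv
    rw [← h3, Nat.mul_add] at h2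
    omega
  left
  by_cases hM2 : ∀ A B, Sep (contractTo G u v) (W.erase v) X A B → (A ∩ B).card < X.card →
      dartCount (contractTo G u v) (W.erase v) (B \ A) ≤ 2 * lam * (B \ A).card
  · have h1 := (ih _ _ _ hcard hXm hXW ⟨hM1, hM2⟩).of_contractTo huv hvW hv'.2
    rwa [Finset.insert_erase hv'.1] at h1
  push Not at hM2
  obtain ⟨A₁, B₁, hs₁, hlt₁, hD₁⟩ := hM2
  obtain ⟨A, B, hs, hn, -, hM₂⟩ := hs₁.exists_massed (n := X.card - 1) (by omega) hD₁
  have hlt : (A ∩ B).card < X.card := by omega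
  have hA := hs.left_subset
  have hB := hs.right_subset
  have hvA : v ∉ A := fun h => hvW (hA h)
  have hvB : v ∉ B := fun h => hvW (hB h)
  have hBA : B \ (A ∩ B) = B \ A := by
    ext
    simp only [Finset.mem_sdiff, Finset.mem_inter]
    tauto
  have hD := hM₂.lt
  rw [hBA] at hD
  have hunion : insert v (A ∪ B) = W := by rw [hs.union, Finset.insert_erase hv'.1]
  have hnadj : ∀ a ∈ A, a ∉ B → ∀ b ∈ B, b ∉ A → ¬ G.Adj a b := by
    intro a ha haB b hb hbA hab
    exact hs.not_adj a ha haB b hb hbA ⟨hab.ne, fun h => hvA (h ▸ ha), fun h => hvB (h ▸ hb), .inl hab⟩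
  by_cases huA : u ∈ A
  · by_cases huB : u ∈ B
    · -- the contracted vertex lies in the separator
      have hsep : Sep G W X (insert v A) (insert v B) := by
        refine ⟨?_, hs.sub.trans (Finset.subset_insert _ _), fun a ha haB b hb hbA => ?_⟩
        · rw [← hunion]
          ext
          simp only [Finset.mem_union, Finset.mem_insert]
          tauto
        · rw [Finset.mem_insert] at *
          exact hnadj a (by tauto) (by tauto) b (by tauto) (by tauto)
      have h1 : insert v A ∩ insert v B = insert v (A ∩ B) := (Finset.insert_inter_distrib _ _ _).symm
      have h2 : insert v B \ insert v A = B \ A := by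
        ext x
        have : x ∈ B → x ≠ v := fun h h' => hvB (h' ▸ h)
        simp only [Finset.mem_sdiff, Finset.mem_insert]
        tauto
      refine linked_of_dense_side ih hXm hM hsep ?_ ?_ ?_
      · rw [h1]
        exact (Finset.card_insert_le _ _).trans (by omega)
      · intro hBW
        have : A ⊆ B := by
          intro x hx
          have h3 := Finset.mem_erase.1 (hA hx)
          have h4 : x ∈ insert v B := hBW ▸ h3.2
          exact (Finset.mem_insert.1 h4).resolve_left h3.1
        rw [Finset.inter_eq_left.2 this] at hlt
        exact hlt.not_ge (Finset.card_le_card hs.sub)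
      · rw [h2]
        refine hD.trans_le ?_
        -- Keep a dart of the contraction if it is present in G; otherwise it comes from an edge at
        -- v, so replace its end u by v.
        refine Set.ncard_le_ncard_of_injOn
          (fun p => if G.Adj p.1 p.2 then p else if p.1 = u then (v, p.2) else (p.1, v)) ?_ ?_
          (Set.toFinite _)
        · rintro ⟨a, b⟩ ⟨ha, hb, hab, hY⟩
          have haW := (Finset.mem_erase.1 (hB ha)).2
          have hbW := (Finset.mem_erase.1 (hB hb)).2
          simp only [Finset.mem_sdiff] at hY
          simp only [Set.mem_ofPred_eq, Finset.mem_sdiff]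
          split_ifs with h3 h4
          · exact ⟨haW, hbW, h3, hY⟩
          · subst h4
            rcases hab.2.2.2 with h | ⟨-, h⟩ | ⟨h, h'⟩
            · exact absurd h h3
            · exact ⟨hv'.1, hbW, h, by tauto⟩
            · exact absurd h.symm hab.1
          · rcases hab.2.2.2 with h | ⟨h, -⟩ | ⟨rfl, h⟩
            · exact absurd h h3
            · exact absurd h h4
            · exact ⟨haW, hv'.1, h.symm, by tauto⟩
        · rintro ⟨a, b⟩ ⟨ha, hb, hab, -⟩ ⟨a', b'⟩ ⟨ha', hb', hab', -⟩ heq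
          have e1 : a ≠ v := hab.2.1
          have e2 : b ≠ v := hab.2.2.1
          have e3 : a' ≠ v := hab'.2.1
          have e4 : b' ≠ v := hab'.2.2.1
          have e5 := hab.2.2.2
          have e6 := hab'.2.2.2
          simp only at heq
          split_ifs at heq <;> simp only [Prod.mk.injEq] at heq ⊢ <;> grind
    · -- the contracted vertex lies strictly on the first side
      exfalso
      have h2 : B \ insert v A = B \ A := by
        ext x
        have : x ∈ B → x ≠ v := fun h h' => hvB (h' ▸ h)
        simp only [Finset.mem_sdiff, Finset.mem_insert]
        tauto
      have h3 := hM.le (insert v A) B ⟨?_, hs.sub.trans (Finset.subset_insert _ _), ?_⟩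
        (by rwa [Finset.insert_inter_of_notMem hvB])
      · rw [h2] at h3
        refine hD.not_ge (le_trans ?_ h3)
        refine dartCount_mono (hB.trans (Finset.erase_subset _ _)) subset_rfl ?_
        intro a ha b hb _ hab
        rcases hab.2.2.2 with h | ⟨rfl, h⟩ | ⟨rfl, h⟩
        · exact h
        · exact absurd ha huB
        · exact absurd hb huB
      · rw [Finset.insert_union, hunion]
      · intro a ha haB b hb hbA hab
        rw [Finset.mem_insert] at ha hbA
        push Not at hbA
        rcases ha with rfl | ha
        · exact hs.not_adj u huA huB b hb hbA.2 ⟨fun h => huB (h ▸ hb), hne, hbA.1, .inr (.inl ⟨rfl, hab⟩)⟩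
        · exact hnadj a ha haB b hb hbA.2 hab
  · -- the contracted vertex lies strictly on the second side
    have huB : u ∈ B := (hs.mem_or (Finset.mem_erase.2 ⟨hne, hu'.1⟩)).resolve_left huA
    have h1 := (ih _ _ _ ((Finset.card_le_card hB).trans_lt hcard) (hlt.le.trans hXm)
      Finset.inter_subset_right hM₂).of_contractTo huv hvB fun h => hvA (Finset.mem_inter.1 h).1
    rw [← Finset.inter_insert_of_notMem hvA] at h1 hlt
    refine linked_of_rigid_of_lt ih hXm hM ⟨?_, hs.sub, ?_⟩ hlt (fun h => hvA (h ▸ hv'.1)) h1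
    · rw [Finset.union_insert, hunion]
    · intro a ha haB b hb hbA hab
      rw [Finset.mem_insert] at haB hb
      push Not at haB
      rcases hb with rfl | hb
      · exact hs.not_adj a ha haB.2 u huB huA ⟨fun h => huA (h ▸ ha), haB.1, hne, .inr (.inr ⟨rfl, hab.symm⟩)⟩
      · exact hnadj a ha haB.2 b hb hbA hab

/-- An edge accounts for two darts, so an excess of three leaves the strict density inequality
intact after the deletion. -/
lemma linked_of_deleteEdge [Finite V] (ih : MassedLinkedBelow V lam m W.card) (hXm : X.card ≤ m)
    (hM : Massed lam G W X) (hu : u ∈ W \ X) (hv : v ∈ W \ X) (huv : G.Adj u v)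
    (hD : 2 * lam * (W \ X).card + 3 ≤ dartCount G W (W \ X))
    (ih' : ∀ G' : SimpleGraph V, dartCount G' W (W \ X) < dartCount G W (W \ X) →
      Massed lam G' W X → Linked G' W X) : Linked G W X := by
  have hu' := Finset.mem_sdiff.1 hu
  have hv' := Finset.mem_sdiff.1 hv
  set G' := G.deleteEdges {s(u, v)} with hG'
  have hle : G' ≤ G := SimpleGraph.deleteEdges_le _
  have hadj : ∀ a b, G.Adj a b → G'.Adj a b ∨ a = u ∧ b = v ∨ a = v ∧ b = u := by
    intro a b hab
    by_cases he : s(a, b) = s(u, v)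
    · right
      simpa using he
    · left
      simp [hG', hab, he]
  have h1 : dartCount G W (W \ X) ≤ dartCount G' W (W \ X) + 2 := by
    have : ({(u, v), (v, u)} : Set (V × V)).ncard ≤ 2 :=
      (Set.ncard_insert_le _ _).trans (by simp)
    refine le_trans ?_ (Nat.add_le_add_left this _)
    refine (Set.ncard_le_ncard ?_ (Set.toFinite _)).trans (Set.ncard_union_le _ _)
    rintro ⟨a, b⟩ ⟨ha, hb, hab, hY⟩
    rcases hadj a b hab with h | h | h
    · exact .inl ⟨ha, hb, h, hY⟩
    · exact .inr (by simp [h])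
    · exact .inr (by simp [h])
  have h2 : dartCount G' W (W \ X) < dartCount G W (W \ X) := by
    refine Set.ncard_lt_ncard ⟨fun p hp => ⟨hp.1, hp.2.1, hle hp.2.2.1, hp.2.2.2⟩, fun h => ?_⟩
      (Set.toFinite _)
    have := @h (u, v) ⟨hu'.1, hv'.1, huv, .inl hu⟩
    have := this.2.2.1
    simp [hG'] at this
  by_cases hM2 : ∀ A B, Sep G' W X A B → (A ∩ B).card < X.card →
      dartCount G' W (B \ A) ≤ 2 * lam * (B \ A).card
  · exact (ih' G' h2 ⟨by omega, hM2⟩).mono hle subset_rfl subset_rfl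
  push Not at hM2
  obtain ⟨A, B, hs, hlt, hD'⟩ := hM2
  have hDG : 2 * lam * (B \ A).card < dartCount G W (B \ A) :=
    hD'.trans_le (dartCount_mono subset_rfl subset_rfl fun _ _ _ _ _ h => hle h)
  -- A newly dense separation must be crossed by the deleted edge. Adding its end x to B makes it a
  -- separation of G again, and its order is then at most |X|.
  by_cases hcross : ∃ x y, x ∈ A ∧ x ∉ B ∧ y ∈ B ∧ y ∉ A ∧ x ∈ W \ X ∧
      ∀ a b, G.Adj a b → G'.Adj a b ∨ a = x ∧ b = y ∨ a = y ∧ b = x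
  · obtain ⟨x, y, hxA, hxB, hyB, hyA, hxX, hxy⟩ := hcross
    have h3 : insert x B \ A = B \ A := by
      rw [Finset.insert_sdiff_of_mem _ hxA]
    refine linked_of_dense_side ih hXm hM (A := A) (B := insert x B) ⟨?_, hs.sub, ?_⟩ ?_ ?_
      (by rwa [h3])
    · rw [Finset.union_insert, hs.union, Finset.insert_eq_of_mem (hs.left_subset hxA)]
    · intro a ha haB b hb hbA hab
      rw [Finset.mem_insert] at haB hb
      push Not at haB
      have hbB : b ∈ B := hb.resolve_left fun h => hbA (h ▸ hxA)
      rcases hxy a b hab with h | h | h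
      · exact hs.not_adj a ha haB.2 b hbB hbA h
      · exact haB.1 h.1
      · exact haB.2 (h.1 ▸ hyB)
    · rw [Finset.inter_insert_of_mem hxA]
      exact (Finset.card_insert_le _ _).trans (by omega)
    · intro hBW
      have h4 : A ⊆ insert x (A ∩ B) := by
        rw [← Finset.inter_insert_of_mem hxA, hBW]
        exact Finset.subset_inter subset_rfl hs.left_subset
      have h5 : insert x X ⊆ A := Finset.insert_subset hxA hs.sub
      have h6 := Finset.card_le_card (h5.trans h4)
      rw [Finset.card_insert_of_notMem (Finset.mem_sdiff.1 hxX).2] at h6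
      have := Finset.card_insert_le x (A ∩ B)
      omega
  · exfalso
    refine hDG.not_ge (hM.le A B ⟨hs.union, hs.sub, fun a ha haB b hb hbA hab => hcross ?_⟩ hlt)
    rcases hadj a b hab with h | ⟨rfl, rfl⟩ | ⟨rfl, rfl⟩
    · exact absurd h (hs.not_adj a ha haB b hb hbA)
    · exact ⟨a, b, ha, haB, hb, hbA, hu, hadj⟩
    · exact ⟨a, b, ha, haB, hb, hbA, hv, fun c d hcd => by have := hadj c d hcd; tauto⟩

/-- Deleting u loses at most |X| ≤ lam edges, which the density condition allows for one vertex. In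
any separation of the rest, u can be returned to the side containing X. -/
lemma linked_of_nbrs_subset [Finite V] (ih : MassedLinkedBelow V lam m W.card) (hXm : X.card ≤ m)
    (hX : X ⊆ W) (hM : Massed lam G W X) (hlam : X.card ≤ lam) (hu : u ∈ W \ X)
    (hn : ∀ w ∈ W, G.Adj u w → w ∈ X) : Linked G W X := by
  have hu' := Finset.mem_sdiff.1 hu
  have hcard : (W.erase u).card < W.card := Finset.card_erase_lt_of_mem hu'.1
  have hXW : X ⊆ W.erase u := fun x hx => Finset.mem_erase.2 ⟨fun h => hu'.2 (h ▸ hx), hX hx⟩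
  refine (ih G _ _ hcard hXm hXW ⟨?_, fun A B hs hlt => ?_⟩).mono le_rfl (Finset.erase_subset _ _)
    subset_rfl
  · have h1 := hM.lt
    have h2 := card_erase_sdiff hu
    have h3 : dartCount G W (W \ X) ≤
        dartCount G (W.erase u) (W.erase u \ X) + (X.card + X.card) := by
      have h4 : ((fun x => (u, x)) '' (X : Set V) ∪ (fun x => (x, u)) '' (X : Set V)).ncard ≤
          X.card + X.card := by
        refine (Set.ncard_union_le _ _).trans (Nat.add_le_add ?_ ?_) <;>
        · refine (Set.ncard_image_le (Set.toFinite _)).trans ?_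
          rw [Set.ncard_coe_finset]
      refine le_trans ?_ (Nat.add_le_add_left h4 _)
      refine (Set.ncard_le_ncard ?_ (Set.toFinite _)).trans (Set.ncard_union_le _ _)
      rintro ⟨a, b⟩ ⟨ha, hb, hab, hY⟩
      by_cases hau : a = u
      · subst hau
        exact .inr (.inl ⟨b, hn b hb hab, rfl⟩)
      by_cases hbu : b = u
      · subst hbu
        exact .inr (.inr ⟨a, hn a ha hab.symm, rfl⟩)
      refine .inl ⟨?_, ?_, hab, ?_⟩
      · simp only [Finset.mem_erase]
        exact ⟨hau, ha⟩
      · simp only [Finset.mem_erase]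
        exact ⟨hbu, hb⟩
      · simp only [Finset.mem_erase, Finset.mem_sdiff] at *
        tauto
    rw [← h2, Nat.mul_add] at h1
    omega
  · have huA : u ∉ A := fun h => Finset.notMem_erase u W (hs.left_subset h)
    have huB : u ∉ B := fun h => Finset.notMem_erase u W (hs.right_subset h)
    have h2 : B \ insert u A = B \ A := by
      ext x
      have : x ∈ B → x ≠ u := fun h h' => huB (h' ▸ h)
      simp only [Finset.mem_sdiff, Finset.mem_insert]
      tauto
    have h3 := hM.le (insert u A) B ⟨?_, hs.sub.trans (Finset.subset_insert _ _), ?_⟩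
      (by rwa [Finset.insert_inter_of_notMem huB])
    · rw [h2] at h3
      exact (dartCount_mono (Finset.erase_subset _ _) subset_rfl fun _ _ _ _ _ h => h).trans h3
    · rw [Finset.insert_union, hs.union, Finset.insert_erase hu'.1]
    · intro a ha haB b hb hbA hab
      rw [Finset.mem_insert] at ha hbA
      push Not at hbA
      rcases ha with rfl | ha
      · exact hbA.2 (hs.sub (hn b (Finset.erase_subset _ _ (hs.right_subset hb)) hab))
      · exact hs.not_adj a ha haB b hb hbA.2 hab

end OddCycles

/-! ### Common neighbours, shortcuts and short walks -/

namespace OddCycles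

variable {V : Type*}

/-- A coinciding pair is joined by its singleton, which the other connections avoid because they
contain no further elements of X. -/
lemma linked_of_ne {G : SimpleGraph V} {W X : Finset V} (hX : X ⊆ W)
    (h : ∀ (ι : Type) [Finite ι] (s t : ι → V), (∀ i, s i ∈ X ∧ t i ∈ X) →
      (∀ i j, i ≠ j → s i ≠ s j ∧ s i ≠ t j ∧ t i ≠ t j) → (∀ i, s i ≠ t i) →
      ∃ P : ι → Set V, Pairwise (Function.onFun Disjoint P) ∧
        ∀ i, P i ⊆ W ∧ ConnIn G (P i) (s i) (t i) ∧ P i ∩ X ⊆ {s i, t i}) : Linked G W X := by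
  classical
  intro ι _ s t hst hd
  obtain ⟨P, hP, hPi⟩ := h {i // s i ≠ t i} (fun i => s i) (fun i => t i) (fun i => hst i)
    (fun i j hij => hd i j fun h => hij (Subtype.ext h)) fun i => i.2
  have hnot : ∀ (i : {i // s i ≠ t i}) (j : ι), i.1 ≠ j → s j ∉ P i := by
    intro i j hij hj
    have h1 := (hPi i).2.2 ⟨hj, (hst j).1⟩
    have h2 := hd i j hij
    have h3 := hd j i hij.symm
    rcases h1 with h1 | h1
    · exact h2.1 h1.symm
    · exact h3.2.1 h1
  refine ⟨fun i => if hi : s i ≠ t i then P ⟨i, hi⟩ else {s i}, fun i j hij => ?_, fun i => ?_⟩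
  · simp only [Function.onFun]
    split_ifs with h1 h2 h2
    · exact hP fun h => hij (congrArg Subtype.val h)
    · exact Set.disjoint_singleton_right.2 (hnot ⟨i, h1⟩ j hij)
    · exact Set.disjoint_singleton_left.2 (hnot ⟨j, h2⟩ i hij.symm)
    · simpa using (hd i j hij).1
  · simp only
    split_ifs with h1
    · exact hPi ⟨i, h1⟩
    · push Not at h1
      refine ⟨?_, ?_, ?_⟩
      · simpa using hX (hst i).1
      · rw [← h1]
        exact .refl rfl
      · intro x hx
        exact .inl hx.1

lemma two_mul_card_le {ι : Type} [Fintype ι] {X : Finset V} {s t : ι → V}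
    (hst : ∀ i, s i ∈ X ∧ t i ∈ X) (hd : ∀ i j, i ≠ j → s i ≠ s j ∧ s i ≠ t j ∧ t i ≠ t j)
    (hne : ∀ i, s i ≠ t i) : 2 * Fintype.card ι ≤ X.card := by
  have hinj : Function.Injective (fun p : ι × Bool =>
      (⟨if p.2 then s p.1 else t p.1, by split_ifs; exacts [(hst _).1, (hst _).2]⟩ : X)) := by
    rintro ⟨i, b⟩ ⟨j, c⟩ h
    have h1 := hd i j
    have h2 := hd j i
    have h3 := hne i
    simp only [Subtype.mk.injEq] at h
    by_cases hij : i = j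
    · subst hij
      have h4 := h3.symm
      cases b <;> cases c <;> simp_all
    · have h1 := h1 hij
      have h2 := h2 (Ne.symm hij)
      have h4 := h2.2.1.symm
      cases b <;> cases c <;> simp_all
  have := Fintype.card_le_of_injective _ hinj
  simp only [Fintype.card_prod, Fintype.card_bool, Fintype.card_coe] at this
  omega

open scoped Classical in
/-- The neighbours of `v` in the set `H`. -/
noncomputable def nbrsIn (G : SimpleGraph V) (H : Finset V) (v : V) : Finset V :=
  H.filter fun w => G.Adj v w

lemma mem_nbrsIn {G : SimpleGraph V} {H : Finset V} {v w : V} :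
    w ∈ nbrsIn G H v ↔ w ∈ H ∧ G.Adj v w := by
  simp [nbrsIn]

lemma nbrsIn_subset {G : SimpleGraph V} {H : Finset V} {v : V} : nbrsIn G H v ⊆ H :=
  fun _ hx => (mem_nbrsIn.1 hx).1

variable [DecidableEq V]

/-- Join each pair through a common neighbour outside T. At least 3k - 2k = k candidates remain for
each of at most k pairs, so Hall's theorem gives distinct choices. -/
lemma linked_of_many_common {G : SimpleGraph V} {C T : Finset V} {k : ℕ} (hT : T ⊆ C)
    (hTk : T.card ≤ 2 * k)
    (h : ∀ x ∈ C, ∀ y ∈ C, 3 * k ≤ (nbrsIn G C x ∩ nbrsIn G C y).card) : Linked G C T := by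
  classical
  refine linked_of_ne hT fun ι _ s t hst hd hne => ?_
  have := Fintype.ofFinite ι
  have hcard := two_mul_card_le hst hd hne
  obtain ⟨f, hf, hfm⟩ := (Finset.all_card_le_biUnion_card_iff_exists_injective
    (fun i => (nbrsIn G C (s i) ∩ nbrsIn G C (t i)) \ T)).1 (by
      intro S
      rcases S.eq_empty_or_nonempty with rfl | ⟨i, hi⟩
      · simp
      have h1 := Finset.card_le_card (Finset.subset_biUnion_of_mem
        (fun i => (nbrsIn G C (s i) ∩ nbrsIn G C (t i)) \ T) hi)
      have h2 := Finset.le_card_sdiff T (nbrsIn G C (s i) ∩ nbrsIn G C (t i))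
      have h3 := h _ (hT (hst i).1) _ (hT (hst i).2)
      have h4 := S.card_le_univ
      omega)
  have hfi : ∀ i, f i ∈ C ∧ G.Adj (s i) (f i) ∧ G.Adj (t i) (f i) ∧ f i ∉ T := by
    intro i
    have := hfm i
    simp only [Finset.mem_sdiff, Finset.mem_inter, mem_nbrsIn] at this
    tauto
  refine ⟨fun i => {s i, f i, t i}, fun i j hij => ?_, fun i => ⟨?_, ?_, ?_⟩⟩
  · refine Set.disjoint_left.2 ?_
    have h1 := hd i j hij
    have h2 := hd j i hij.symm
    have h3 : f i ≠ f j := fun h => hij (hf h)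
    have h4 := hfi i
    have h5 := hfi j
    have h6 := hst i
    have h7 := hst j
    have h8 : ∀ i, ∀ x ∈ T, f i ≠ x := fun i x hx h => (hfi i).2.2.2 (h ▸ hx)
    have h9 := h8 i
    have h10 := h8 j
    rintro p (hp | hp | hp) (hp' | hp' | hp') <;> grind
  · rintro p (rfl | rfl | rfl)
    exacts [hT (hst i).1, (hfi i).1, hT (hst i).2]
  · exact (ConnIn.of_adj (hfi i).2.1 (by simp) (by simp)).trans
      (.of_adj (hfi i).2.2.1.symm (by simp) (by simp))
  · rintro p ⟨rfl | rfl | rfl, hp⟩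
    · simp
    · exact absurd hp (hfi i).2.2.2
    · simp

/-- The last of n + 1 distinct neighbours of c on the walk is at least n steps from its start. -/
lemma exists_suffix_of_nbrs {G : SimpleGraph V} {a b c : V} (p : G.Walk a b) (n : ℕ)
    (h : n + 1 ≤ (nbrsIn G p.support.toFinset c).card) :
    ∃ z, ∃ q : G.Walk z b, G.Adj c z ∧ q.length + n ≤ p.length ∧ ∀ x ∈ q.support, x ∈ p.support := by
  induction p generalizing n with
  | @nil u =>
    have h1 : nbrsIn G (SimpleGraph.Walk.nil : G.Walk u u).support.toFinset c ⊆ {u} := by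
      intro x hx
      simpa using (mem_nbrsIn.1 hx).1
    have h2 := Finset.card_le_card h1
    rw [Finset.card_singleton] at h2
    obtain ⟨x, hx⟩ := Finset.card_pos.1 ((Nat.succ_pos n).trans_le h)
    have h3 := h1 hx
    rw [Finset.mem_singleton] at h3
    subst h3
    exact ⟨x, .nil, (mem_nbrsIn.1 hx).2, by simp; omega, fun _ h => h⟩
  | @cons u v w hadj p ih =>
    have hsub : nbrsIn G (SimpleGraph.Walk.cons hadj p).support.toFinset c ⊆
        insert u (nbrsIn G p.support.toFinset c) := by
      intro x hx
      rw [mem_nbrsIn] at hx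
      rw [Finset.mem_insert, mem_nbrsIn]
      simp only [SimpleGraph.Walk.support_cons, List.toFinset_cons, Finset.mem_insert] at hx
      tauto
    by_cases hu : G.Adj c u
    · rcases Nat.eq_zero_or_pos n with rfl | hn
      · exact ⟨u, _, hu, by rw [Nat.add_zero], fun _ h => h⟩
      · have h1 := (Finset.card_le_card hsub).trans (Finset.card_insert_le _ _)
        obtain ⟨z, q, hz, hq, hs⟩ := ih (n - 1) (by omega)
        exact ⟨z, q, hz, by simp; omega, fun x hx => by simp [hs x hx]⟩
    · have h1 : nbrsIn G (SimpleGraph.Walk.cons hadj p).support.toFinset c ⊆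
          nbrsIn G p.support.toFinset c := by
        intro x hx
        refine (Finset.mem_insert.1 (hsub hx)).resolve_left ?_
        rintro rfl
        exact hu (mem_nbrsIn.1 hx).2
      obtain ⟨z, q, hz, hq, hs⟩ := ih n (h.trans (Finset.card_le_card h1))
      exact ⟨z, q, hz, by simp; omega, fun x hx => by simp [hs x hx]⟩

/-- A vertex with four neighbours on a walk yields a shorter walk. -/
lemma exists_shortcut {G : SimpleGraph V} {a b c : V} (p : G.Walk a b)
    (h : 4 ≤ (nbrsIn G p.support.toFinset c).card) :
    ∃ q : G.Walk a b, q.length < p.length ∧ ∀ x ∈ q.support, x ∈ p.support ∨ x = c := by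
  induction p with
  | @nil u =>
    have h1 := Finset.card_le_card (nbrsIn_subset (G := G) (v := c)
      (H := (SimpleGraph.Walk.nil : G.Walk u u).support.toFinset))
    have h2 : (SimpleGraph.Walk.nil : G.Walk u u).support.toFinset.card = 1 := by simp
    omega
  | @cons u v w hadj p ih =>
    have hsub : nbrsIn G (SimpleGraph.Walk.cons hadj p).support.toFinset c ⊆
        insert u (nbrsIn G p.support.toFinset c) := by
      intro x hx
      rw [mem_nbrsIn] at hx
      rw [Finset.mem_insert, mem_nbrsIn]
      simp only [SimpleGraph.Walk.support_cons, List.toFinset_cons, Finset.mem_insert] at hx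
      tauto
    by_cases hu : G.Adj c u
    · have h1 := (Finset.card_le_card hsub).trans (Finset.card_insert_le _ _)
      obtain ⟨z, q, hz, hq, hs⟩ := exists_suffix_of_nbrs p 2 (c := c) (by omega)
      refine ⟨.cons hu.symm (.cons hz q), by simp; omega, fun x hx => ?_⟩
      simp only [SimpleGraph.Walk.support_cons, List.mem_cons] at hx ⊢
      rcases hx with rfl | rfl | hx
      · exact .inl (.inl rfl)
      · exact .inr rfl
      · exact .inl (.inr (hs x hx))
    · have h1 : nbrsIn G (SimpleGraph.Walk.cons hadj p).support.toFinset c ⊆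
          nbrsIn G p.support.toFinset c := by
        intro x hx
        refine (Finset.mem_insert.1 (hsub hx)).resolve_left ?_
        rintro rfl
        exact hu (mem_nbrsIn.1 hx).2
      obtain ⟨q, hq, hs⟩ := ih (h.trans (Finset.card_le_card h1))
      refine ⟨.cons hadj q, by simpa using hq, fun x hx => ?_⟩
      simp only [SimpleGraph.Walk.support_cons, List.mem_cons] at hx ⊢
      rcases hx with rfl | hx
      · exact .inl (.inl rfl)
      · exact (hs x hx).imp .inr id

/-- In a graph of large minimum degree, vertices of one component are at distance at most five. -/
lemma exists_walk_length_le_five {G : SimpleGraph V} {J : Finset V} {d : ℕ}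
    (hd : ∀ x ∈ J, d ≤ (nbrsIn G J x).card) (hJ : J.card < 3 * (d + 1)) {a b : V}
    (h : ConnIn G J a b) : ∃ w : G.Walk a b, w.length ≤ 5 ∧ ∀ x ∈ w.support, x ∈ J := by
  classical
  have hex : ∃ n, ∃ w : G.Walk a b, w.length = n ∧ ∀ x ∈ w.support, x ∈ J := by
    obtain ⟨w, hw⟩ := h
    exact ⟨_, w, rfl, hw⟩
  obtain ⟨p, hp, hpJ⟩ := Nat.find_spec hex
  have hmin : ∀ q : G.Walk a b, (∀ x ∈ q.support, x ∈ J) → p.length ≤ q.length := fun q hq =>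
    hp ▸ Nat.find_min' hex ⟨q, rfl, hq⟩
  refine ⟨p, ?_, hpJ⟩
  by_contra! hlen
  have hstep : ∀ x c, c ∈ insert x (nbrsIn G J x) → x ∈ J →
      ∃ w : G.Walk x c, w.length ≤ 1 ∧ ∀ y ∈ w.support, y ∈ J := by
    intro x c hc hx
    rcases Finset.mem_insert.1 hc with rfl | hc
    · exact ⟨.nil, by simp, by simpa using hx⟩
    · have := mem_nbrsIn.1 hc
      exact ⟨this.2.toWalk, by simp, by simp [hx, this.1]⟩
  have hgJ : ∀ i, p.getVert i ∈ J := fun i => hpJ _ (p.getVert_mem_support i)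
  have hdisj : ∀ i j, i + 3 ≤ j → j ≤ p.length →
      Disjoint (insert (p.getVert i) (nbrsIn G J (p.getVert i)))
        (insert (p.getVert j) (nbrsIn G J (p.getVert j))) := by
    intro i j hij hj
    refine Finset.disjoint_left.2 fun c hc hc' => ?_
    obtain ⟨w, hw, hwJ⟩ := hstep _ _ hc (hgJ i)
    obtain ⟨w', hw', hwJ'⟩ := hstep _ _ hc' (hgJ j)
    have := hmin ((((p.take i).append w).append w'.reverse).append (p.drop j)) (by
      intro x hx
      simp only [SimpleGraph.Walk.mem_support_append_iff, SimpleGraph.Walk.support_reverse,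
        List.mem_reverse] at hx
      rcases hx with ((hx | hx) | hx) | hx
      · exact hpJ _ ((p.isSubwalk_take i).support_subset hx)
      · exact hwJ _ hx
      · exact hwJ' _ hx
      · exact hpJ _ ((p.isSubwalk_drop j).support_subset hx))
    simp only [SimpleGraph.Walk.length_append, SimpleGraph.Walk.length_reverse,
      SimpleGraph.Walk.take_length, SimpleGraph.Walk.drop_length] at this
    omega
  have hball : ∀ x ∈ J, d + 1 ≤ (insert x (nbrsIn G J x)).card := by
    intro x hx
    rw [Finset.card_insert_of_notMem fun h => G.loopless.irrefl x (mem_nbrsIn.1 h).2]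
    have := hd x hx
    omega
  -- On a shortest walk of length at least six, the closed neighbourhoods of the vertices at
  -- positions 0, 3 and 6 are disjoint, which needs 3(d + 1) vertices.
  have h0 := hball _ (hgJ 0)
  have h3 := hball _ (hgJ 3)
  have h6 := hball _ (hgJ 6)
  have hsub : ∀ x ∈ J, insert x (nbrsIn G J x) ⊆ J := fun x hx =>
    Finset.insert_subset hx nbrsIn_subset
  have hc := Finset.card_le_card (Finset.union_subset (Finset.union_subset
    (hsub _ (hgJ 0)) (hsub _ (hgJ 3))) (hsub _ (hgJ 6)))
  rw [Finset.card_union_of_disjoint, Finset.card_union_of_disjoint (hdisj 0 3 (by omega) (by omega))]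
    at hc
  · omega
  · exact Finset.disjoint_union_left.2 ⟨hdisj 0 6 (by omega) (by omega), hdisj 3 6 (by omega) (by omega)⟩

end OddCycles

/-! ### Highly linked sets in dense graphs -/

namespace OddCycles

variable {V : Type*} [DecidableEq V]

/-- The walks chosen for the indices in `I` are short, disjoint and avoid further terminals. -/
structure ShortFamily (G : SimpleGraph V) (H T : Finset V) {ι : Type} (s t : ι → V)
    (I : Finset ι) (P : ι → Finset V) (l : ι → ℕ) : Prop where
  walk : ∀ i ∈ I, ∃ w : G.Walk (s i) (t i), w.length = l i ∧ w.support.toFinset = P i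
  len : ∀ i ∈ I, l i ≤ 7
  sub : ∀ i ∈ I, P i ⊆ H
  inter : ∀ i ∈ I, ∀ x ∈ P i, x ∈ T → x = s i ∨ x = t i
  disj : ∀ i ∈ I, ∀ j ∈ I, i ≠ j → Disjoint (P i) (P j)

namespace ShortFamily

variable {G : SimpleGraph V} {H T : Finset V} {ι : Type} {s t : ι → V} {I : Finset ι}
  {P : ι → Finset V} {l : ι → ℕ} {k : ℕ}

/-- The free index set `I'` lets this serve both to add a walk for a new index and to replace an
existing walk. -/
lemma update [DecidableEq ι] {I' : Finset ι} {i : ι} (h : ShortFamily G H T s t I P l)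
    (hI' : ∀ j ∈ I', j ≠ i → j ∈ I) (w : G.Walk (s i) (t i)) (hlen : w.length ≤ 7)
    (hw : ∀ x ∈ w.support, x ∈ H ∧ (x ∈ T → x = s i ∨ x = t i) ∧
      ∀ j ∈ I, j ≠ i → x ∉ P j) :
    ShortFamily G H T s t I' (Function.update P i w.support.toFinset)
      (Function.update l i w.length) := by
  have hdisj : ∀ j ∈ I, j ≠ i → Disjoint w.support.toFinset (P j) := fun j hj hji =>
    Finset.disjoint_left.2 fun x hx => (hw x (by simpa using hx)).2.2 j hj hji
  refine ⟨fun j hj => ?_, fun j hj => ?_, fun j hj => ?_, fun j hj x hx => ?_, fun j hj j' hj' hne => ?_⟩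
  · by_cases hji : j = i
    · subst hji
      exact ⟨w, by simp, by simp⟩
    · simpa [hji] using h.walk j (hI' j hj hji)
  · by_cases hji : j = i
    · subst hji
      simpa using hlen
    · simpa [hji] using h.len j (hI' j hj hji)
  · by_cases hji : j = i
    · subst hji
      intro x hx
      exact (hw x (by simpa using hx)).1
    · simpa [hji] using h.sub j (hI' j hj hji)
  · by_cases hji : j = i
    · subst hji
      exact (hw x (by simpa using hx)).2.1
    · exact h.inter j (hI' j hj hji) x (by simpa [hji] using hx)
  · by_cases hji : j = i
    · subst hji
      simpa [hne.symm] using hdisj j' (hI' j' hj' hne.symm) hne.symm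
    · by_cases hji' : j' = i
      · subst hji'
        simpa [hji] using (hdisj j (hI' j hj hji) hji).symm
      · simpa [hji, hji'] using h.disj j (hI' j hj hji) j' (hI' j' hj' hji') hne

lemma left_mem (h : ShortFamily G H T s t I P l) {i : ι} (hi : i ∈ I) : s i ∈ P i := by
  obtain ⟨w, -, hw⟩ := h.walk i hi
  simp [← hw]

lemma right_mem (h : ShortFamily G H T s t I P l) {i : ι} (hi : i ∈ I) : t i ∈ P i := by
  obtain ⟨w, -, hw⟩ := h.walk i hi
  simp [← hw]

lemma card_le (h : ShortFamily G H T s t I P l) {i : ι} (hi : i ∈ I) : (P i).card ≤ 8 := by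
  obtain ⟨w, hl, hw⟩ := h.walk i hi
  rw [← hw]
  refine (List.toFinset_card_le _).trans ?_
  rw [SimpleGraph.Walk.length_support, hl]
  have := h.len i hi
  omega

variable (T I P) in
/-- The terminals together with the vertices of the chosen walks. -/
def used : Finset V := T ∪ I.biUnion P

lemma not_mem_used {x : V} : x ∉ used T I P ↔ x ∉ T ∧ ∀ i ∈ I, x ∉ P i := by
  simp [used]

lemma card_used_le (h : ShortFamily G H T s t I P l) (hne : ∀ i, s i ≠ t i)
    (hst : ∀ i, s i ∈ T ∧ t i ∈ T) : (used T I P).card ≤ T.card + 6 * I.card := by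
  have h1 : used T I P ⊆ T ∪ I.biUnion fun i => P i \ {s i, t i} := by
    intro x hx
    by_cases hxT : x ∈ T
    · simp [hxT]
    · simp only [used, Finset.mem_union, hxT, false_or, Finset.mem_biUnion] at hx
      obtain ⟨i, hi, hx⟩ := hx
      have h2 : x ≠ s i := fun h' => hxT (h' ▸ (hst i).1)
      have h3 : x ≠ t i := fun h' => hxT (h' ▸ (hst i).2)
      simp only [Finset.mem_union, Finset.mem_biUnion, Finset.mem_sdiff, Finset.mem_insert,
        Finset.mem_singleton]
      exact .inr ⟨i, hi, hx, by tauto⟩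
  refine (Finset.card_le_card h1).trans ((Finset.card_union_le _ _).trans ?_)
  refine Nat.add_le_add_left (Finset.card_biUnion_le.trans ?_) _
  rw [mul_comm, ← smul_eq_mul]
  refine Finset.sum_le_card_nsmul _ _ _ fun i hi => ?_
  rw [Finset.card_sdiff_of_subset, Finset.card_pair (hne i)]
  · have := h.card_le hi
    omega
  · intro x hx
    rcases Finset.mem_insert.1 hx with rfl | hx
    · exact h.left_mem hi
    · rw [Finset.mem_singleton.1 hx]
      exact h.right_mem hi

/-- If each chosen walk contains at most three neighbours of `c`, then few used vertices are
neighbours of `c`. -/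
lemma card_nbrs_used_le (h : ShortFamily G H T s t I P l) (hne : ∀ i, s i ≠ t i)
    (hst : ∀ i, s i ∈ T ∧ t i ∈ T) {c : V} (hc : ∀ i ∈ I, (nbrsIn G (P i) c).card ≤ 3) :
    (nbrsIn G (used T I P) c).card ≤ T.card + I.card := by
  set Q : Finset V := I.biUnion fun i => {s i, t i} with hQ
  have hQT : Q ⊆ T := by
    intro x hx
    simp only [hQ, Finset.mem_biUnion, Finset.mem_insert, Finset.mem_singleton] at hx
    obtain ⟨i, -, rfl | rfl⟩ := hx
    exacts [(hst i).1, (hst i).2]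
  have hQc : Q.card = 2 * I.card := by
    rw [hQ, Finset.card_biUnion]
    · rw [Finset.sum_congr rfl fun i _ => Finset.card_pair (hne i)]
      simp [mul_comm]
    · intro i hi j hj hij
      refine (h.disj i hi j hj hij).mono ?_ ?_
      · simp [Finset.insert_subset_iff, h.left_mem hi, h.right_mem hi]
      · simp [Finset.insert_subset_iff, h.left_mem hj, h.right_mem hj]
  have h1 : nbrsIn G (used T I P) c ⊆ (T \ Q) ∪ I.biUnion fun i => nbrsIn G (P i) c := by
    intro x hx
    obtain ⟨hxu, hxc⟩ := mem_nbrsIn.1 hx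
    simp only [Finset.mem_union, Finset.mem_biUnion, mem_nbrsIn, Finset.mem_sdiff]
    by_cases hxi : ∃ i ∈ I, x ∈ P i
    · obtain ⟨i, hi, hxi⟩ := hxi
      exact .inr ⟨i, hi, hxi, hxc⟩
    · left
      push Not at hxi
      refine ⟨?_, fun hxQ => ?_⟩
      · by_contra hxT
        exact not_mem_used.2 ⟨hxT, hxi⟩ hxu
      · simp only [hQ, Finset.mem_biUnion, Finset.mem_insert, Finset.mem_singleton] at hxQ
        obtain ⟨i, hi, rfl | rfl⟩ := hxQ
        · exact hxi i hi (h.left_mem hi)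
        · exact hxi i hi (h.right_mem hi)
  have h2 := (Finset.card_le_card h1).trans (Finset.card_union_le _ _)
  have h3 : (I.biUnion fun i => nbrsIn G (P i) c).card ≤ I.card * 3 := by
    refine Finset.card_biUnion_le.trans ?_
    rw [← smul_eq_mul]
    exact Finset.sum_le_card_nsmul _ _ _ hc
  rw [Finset.card_sdiff_of_subset hQT] at h2
  have h4 := Finset.card_le_card hQT
  omega

end ShortFamily

/-- A graph in which every degree is at least half the order contains a highly linked subgraph. -/
lemma exists_linked_subset {G : SimpleGraph V} {H : Finset V} {k d : ℕ} (hk : 8 * k + 1 ≤ d)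
    (hH : H.Nonempty) (hd : ∀ x ∈ H, d ≤ (nbrsIn G H x).card) (hHd : H.card ≤ 2 * d + 1) :
    ∃ L ⊆ H, 2 * k ≤ L.card ∧ ∀ T ⊆ L, T.card = 2 * k → Linked G L T := by
  classical
  by_cases hlink : ∀ T ⊆ H, T.card = 2 * k → Linked G H T
  · obtain ⟨x, hx⟩ := hH
    have h1 := (hd x hx).trans (Finset.card_le_card nbrsIn_subset)
    exact ⟨H, subset_rfl, by omega, hlink⟩
  push Not at hlink
  obtain ⟨T, hTH, hTk, hnot⟩ := hlink
  have hnot' := mt (linked_of_ne hTH) hnot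
  push Not at hnot'
  obtain ⟨ι, hfin, s, t, hst, hdist, hne, hno⟩ := hnot'
  have := Fintype.ofFinite ι
  have hι := two_mul_card_le hst hdist hne
  -- choose as many indices as possible, then minimal total length
  obtain ⟨I, ⟨P₀, l₀, hF₀⟩, hImax⟩ : ∃ I : Finset ι, (∃ P l, ShortFamily G H T s t I P l) ∧
      ∀ I' : Finset ι, (∃ P l, ShortFamily G H T s t I' P l) → I'.card ≤ I.card := by
    obtain ⟨I, hI, hmax⟩ := Finset.exists_max_image
      (Finset.univ.filter fun I : Finset ι => ∃ P l, ShortFamily G H T s t I P l) Finset.card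
      ⟨∅, by simpa using ⟨fun _ => ∅, fun _ => 0, by simp, by simp, by simp, by simp, by simp⟩⟩
    exact ⟨I, by simpa using hI, fun I' hI' => hmax I' (by simpa using hI')⟩
  obtain ⟨P, l, hF, hmin⟩ : ∃ P l, ShortFamily G H T s t I P l ∧
      ∀ P' l', ShortFamily G H T s t I P' l' → ∑ i ∈ I, l i ≤ ∑ i ∈ I, l' i := by
    have hex : ∃ n, ∃ P l, ShortFamily G H T s t I P l ∧ ∑ i ∈ I, l i = n := ⟨_, P₀, l₀, hF₀, rfl⟩
    obtain ⟨P, l, hF, hn⟩ := Nat.find_spec hex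
    exact ⟨P, l, hF, fun P' l' hF' => hn ▸ Nat.find_min' hex ⟨P', l', hF', rfl⟩⟩
  obtain ⟨i₀, hi₀⟩ : ∃ i₀, i₀ ∉ I := by
    by_contra! hall
    obtain ⟨i, hi⟩ := hno (fun i => P i) fun i j hij =>
      Finset.disjoint_coe.2 (hF.disj i (hall i) j (hall j) hij)
    refine hi ?_ ?_ ?_
    · exact_mod_cast hF.sub i (hall i)
    · obtain ⟨w, -, hw⟩ := hF.walk i (hall i)
      exact ⟨w, fun x hx => by simpa [← hw] using hx⟩
    · rintro x ⟨hx, hxT⟩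
      exact hF.inter i (hall i) x hx hxT
  set U := ShortFamily.used T I P with hU
  set J := H \ U with hJ
  have hJmem : ∀ x ∈ J, x ∈ H ∧ x ∉ T ∧ ∀ i ∈ I, x ∉ P i := fun x hx =>
    ⟨(Finset.mem_sdiff.1 hx).1, ShortFamily.not_mem_used.1 (Finset.mem_sdiff.1 hx).2⟩
  have hIc : I.card ≤ k := by
    have := I.card_le_univ
    omega
  -- A short walk through unused vertices would contradict the maximality of `I`.
  have hext : ∀ w : G.Walk (s i₀) (t i₀), w.length ≤ 7 →
      ¬ ∀ x ∈ w.support, x = s i₀ ∨ x = t i₀ ∨ x ∈ J := by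
    intro w hw hsup
    have hterm : ∀ x, x = s i₀ ∨ x = t i₀ → x ∈ T ∧ ∀ j ∈ I, x ∉ P j := by
      intro x hx
      have hxT : x ∈ T := by
        rcases hx with rfl | rfl
        exacts [(hst i₀).1, (hst i₀).2]
      refine ⟨hxT, fun j hj hxj => ?_⟩
      have h1 := hF.inter j hj x hxj hxT
      have hij : i₀ ≠ j := fun h => hi₀ (h ▸ hj)
      have h2 := hdist i₀ j hij
      have h3 := hdist j i₀ hij.symm
      grind
    have h1 := hF.update (I' := insert i₀ I) (i := i₀)
      (fun j hj hji => (Finset.mem_insert.1 hj).resolve_left hji) w hw (fun x hx => by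
        rcases or_assoc.2 (hsup x hx) with h | h
        · exact ⟨hTH (hterm x h).1, fun _ => h, fun j hj _ => (hterm x h).2 j hj⟩
        · exact ⟨(hJmem x h).1, fun hxT => absurd hxT (hJmem x h).2.1,
            fun j hj _ => (hJmem x h).2.2 j hj⟩)
    have h2 := hImax _ ⟨_, _, h1⟩
    rw [Finset.card_insert_of_notMem hi₀] at h2
    omega
  -- Four neighbours on one walk would allow a shortcut through c, against the minimality of the
  -- total length.
  have hnb : ∀ c ∈ J, ∀ i ∈ I, (nbrsIn G (P i) c).card ≤ 3 := by
    intro c hc i hi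
    by_contra! hlt
    obtain ⟨w, hwl, hwP⟩ := hF.walk i hi
    obtain ⟨q, hq, hqs⟩ := exists_shortcut w (c := c) (by rw [hwP]; exact hlt)
    have hcJ := hJmem c hc
    have h1 := hF.update (I' := I) (i := i) (fun j hj _ => hj) q
      (by have := hF.len i hi; omega) (fun x hx => by
        rcases hqs x hx with h | rfl
        · have hxP : x ∈ P i := by simpa [← hwP] using h
          exact ⟨hF.sub i hi hxP, hF.inter i hi x hxP, fun j hj hji hxj =>
            Finset.disjoint_left.1 (hF.disj i hi j hj hji.symm) hxP hxj⟩
        · exact ⟨hcJ.1, fun h => absurd h hcJ.2.1, fun j hj _ => hcJ.2.2 j hj⟩)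
    have h2 := hmin _ _ h1
    refine h2.not_gt (Finset.sum_lt_sum (fun j _ => ?_) ⟨i, hi, ?_⟩)
    · by_cases hji : j = i
      · subst hji
        simp
        omega
      · simp [hji]
    · simp
      omega
  have hdeg : ∀ c ∈ J, d ≤ (nbrsIn G J c).card + 3 * k := by
    intro c hc
    have h1 : nbrsIn G H c ⊆ nbrsIn G J c ∪ nbrsIn G U c := by
      intro x hx
      simp only [Finset.mem_union, mem_nbrsIn, hJ, Finset.mem_sdiff] at *
      tauto
    have h2 := (Finset.card_le_card h1).trans (Finset.card_union_le _ _)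
    have h3 := hF.card_nbrs_used_le hne hst (hnb c hc)
    rw [← hU] at h3
    have h4 := hd c (hJmem c hc).1
    omega
  have hJc : J.card + 2 * k ≤ 2 * d + 1 := by
    have h1 : J ⊆ H \ T := fun x hx => Finset.mem_sdiff.2 ⟨(hJmem x hx).1, (hJmem x hx).2.1⟩
    have h2 := Finset.card_le_card h1
    rw [Finset.card_sdiff_of_subset hTH, hTk] at h2
    have h3 := Finset.card_le_card hTH
    omega
  have hUc : U.card ≤ 8 * k := by
    have := hF.card_used_le hne hst
    rw [← hU] at this
    omega
  -- A terminal has at least d > 8k neighbours in H, while at most 2k + 6k vertices are used.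
  have hnbr : ∀ x ∈ T, ∃ y ∈ J, G.Adj x y := by
    intro x hx
    by_contra! hno'
    have h1 : nbrsIn G H x ⊆ U := by
      intro y hy
      obtain ⟨hyH, hxy⟩ := mem_nbrsIn.1 hy
      by_contra hyU
      exact hno' y (Finset.mem_sdiff.2 ⟨hyH, hyU⟩) hxy
    have h2 := Finset.card_le_card h1
    have h3 := hd x (hTH hx)
    omega
  -- the component of a vertex of `J`, if small enough, is highly linked
  have hcomp : ∀ a ∈ J, 2 * (J.filter fun x => ConnIn G J a x).card ≤ J.card →
      ∃ L ⊆ H, 2 * k ≤ L.card ∧ ∀ T ⊆ L, T.card = 2 * k → Linked G L T := by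
    intro a ha hsmall
    set C := J.filter fun x => ConnIn G J a x with hC
    have hCJ : C ⊆ J := Finset.filter_subset _ _
    have haC : a ∈ C := by simpa [hC, ha] using ConnIn.refl (G := G) (P := ↑J) ha
    have hCn : ∀ x ∈ C, nbrsIn G J x ⊆ nbrsIn G C x := by
      intro x hx y hy
      obtain ⟨hyJ, hxy⟩ := mem_nbrsIn.1 hy
      have hx' := (Finset.mem_filter.1 hx)
      refine mem_nbrsIn.2 ⟨Finset.mem_filter.2 ⟨hyJ, ?_⟩, hxy⟩
      exact hx'.2.trans (.of_adj hxy hx'.1 hyJ)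
    have hCd : ∀ x ∈ C, d ≤ (nbrsIn G C x).card + 3 * k := fun x hx => by
      have h1 := hdeg x (hCJ hx)
      have h2 := Finset.card_le_card (hCn x hx)
      omega
    refine ⟨C, hCJ.trans Finset.sdiff_subset, ?_, fun T' hT' hT'k => ?_⟩
    · have h1 := hCd a haC
      have h2 := Finset.card_le_card (nbrsIn_subset (G := G) (H := C) (v := a))
      omega
    -- Here |C| ≤ d - k, so two neighbourhoods of size at least d - 3k in C share at least d - 5k ≥
    -- 3k vertices.
    · refine linked_of_many_common hT' hT'k.le fun x hx y hy => ?_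
      have h1 := hCd x hx
      have h2 := hCd y hy
      have h3 := Finset.card_union_add_card_inter (nbrsIn G C x) (nbrsIn G C y)
      have h4 := Finset.card_le_card (Finset.union_subset (nbrsIn_subset (G := G) (H := C) (v := x))
        (nbrsIn_subset (G := G) (H := C) (v := y)))
      omega
  obtain ⟨a, ha, hsa⟩ := hnbr _ (hst i₀).1
  obtain ⟨b, hb, htb⟩ := hnbr _ (hst i₀).2
  have hab : ¬ ConnIn G J a b := by
    intro hab
    -- The bound |J| ≤ 2d + 1 - 2k < 3(d - 3k + 1) follows from d ≥ 8k + 1. The two edges to the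
    -- terminals raise the length from five to at most seven.
    obtain ⟨w, hw, hwJ⟩ := exists_walk_length_le_five (d := d - 3 * k)
      (fun x hx => by have := hdeg x hx; omega) (by omega) hab
    refine hext (.cons hsa (w.append (.cons htb.symm .nil))) ?_ fun x hx => ?_
    · simp
      omega
    · simp only [SimpleGraph.Walk.support_cons, List.mem_cons,
        SimpleGraph.Walk.mem_support_append_iff, SimpleGraph.Walk.support_nil,
        List.not_mem_nil, or_false] at hx
      rcases hx with rfl | hx | rfl | rfl
      · exact .inl rfl
      · exact .inr (.inr (hwJ x hx))
      · exact .inr (.inr hb)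
      · exact .inr (.inl rfl)
  have hdisj : Disjoint (J.filter fun x => ConnIn G J a x) (J.filter fun x => ConnIn G J b x) := by
    refine Finset.disjoint_left.2 fun x hx hx' => hab ?_
    exact (Finset.mem_filter.1 hx).2.trans (Finset.mem_filter.1 hx').2.symm
  have hle := Finset.card_le_card (Finset.union_subset (Finset.filter_subset (fun x => ConnIn G J a x) J)
    (Finset.filter_subset (fun x => ConnIn G J b x) J))
  rw [Finset.card_union_of_disjoint hdisj] at hle
  rcases le_total (J.filter fun x => ConnIn G J a x).card (J.filter fun x => ConnIn G J b x).card
    with h | h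
  · exact hcomp a ha (by omega)
  · exact hcomp b hb (by omega)

end OddCycles

/-! ### The Thomas–Wollan linkage theorem -/

namespace OddCycles

variable {V : Type*} [DecidableEq V]

/-- An edge inside W \ X is seen from both ends, but an edge to X only from one; hence the factor 2
for its two darts. -/
lemma sum_card_nbrsIn_le_dartCount [Finite V] {G : SimpleGraph V} {W X : Finset V} (hX : X ⊆ W) :
    ∑ v ∈ W \ X, ((nbrsIn G (W \ X) v).card + 2 * (nbrsIn G X v).card) ≤
      dartCount G W (W \ X) := by
  classical
  set F₁ := (W \ X).sigma fun v => nbrsIn G W v with hF₁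
  set F₂ := (W \ X).sigma fun v => nbrsIn G X v with hF₂
  have h1 : ∑ v ∈ W \ X, ((nbrsIn G (W \ X) v).card + 2 * (nbrsIn G X v).card) ≤
      F₁.card + F₂.card := by
    rw [hF₁, hF₂, Finset.card_sigma, Finset.card_sigma, ← Finset.sum_add_distrib]
    refine Finset.sum_le_sum fun v _ => ?_
    have : (nbrsIn G (W \ X) v).card + (nbrsIn G X v).card ≤ (nbrsIn G W v).card := by
      rw [← Finset.card_union_of_disjoint]
      · refine Finset.card_le_card fun x hx => ?_
        simp only [Finset.mem_union, mem_nbrsIn, Finset.mem_sdiff] at hx ⊢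
        have := @hX x
        tauto
      · refine Finset.disjoint_left.2 fun x hx hx' => ?_
        exact (Finset.mem_sdiff.1 (mem_nbrsIn.1 hx).1).2 (mem_nbrsIn.1 hx').1
    omega
  refine h1.trans ?_
  rw [← Finset.card_image_of_injective F₁ (f := fun p => (p.1, p.2))
    (by rintro ⟨a, b⟩ ⟨c, d⟩ h; simpa using h),
    ← Finset.card_image_of_injective F₂ (f := fun p => (p.2, p.1))
    (by rintro ⟨a, b⟩ ⟨c, d⟩ h; simpa [and_comm] using h), ← Finset.card_union_of_disjoint,
    ← Set.ncard_coe_finset]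
  · refine Set.ncard_le_ncard ?_ (Set.toFinite _)
    rintro ⟨a, b⟩ hp
    simp only [Finset.coe_union, Finset.coe_image, Set.mem_union, Set.mem_image, Finset.mem_coe,
      hF₁, hF₂, Finset.mem_sigma, mem_nbrsIn, Prod.mk.injEq] at hp
    rcases hp with ⟨⟨c, e⟩, h, rfl, rfl⟩ | ⟨⟨c, e⟩, h, rfl, rfl⟩
    · exact ⟨(Finset.mem_sdiff.1 h.1).1, h.2.1, h.2.2, .inl h.1⟩
    · exact ⟨hX h.2.1, (Finset.mem_sdiff.1 h.1).1, h.2.2.symm, .inr h.1⟩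
  · refine Finset.disjoint_left.2 ?_
    rintro ⟨a, b⟩ hp hp'
    simp only [Finset.mem_image, hF₁, hF₂, Finset.mem_sigma, mem_nbrsIn, Prod.mk.injEq] at hp hp'
    obtain ⟨⟨c, e⟩, h, rfl, rfl⟩ := hp
    obtain ⟨⟨c', e'⟩, h', rfl, rfl⟩ := hp'
    exact (Finset.mem_sdiff.1 h.1).2 h'.2.1

/-- **Thomas–Wollan**: a massed pair with at most `2 * k` terminals is linked. -/
theorem Massed.linked [Finite V] {k : ℕ} {G : SimpleGraph V} {W X : Finset V}
    (hXk : X.card ≤ 2 * k) (hX : X ⊆ W) (hM : Massed (10 * k) G W X) : Linked G W X := by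
  induction hN : W.card using Nat.strong_induction_on generalizing G W X with
  | _ N ihW =>
  subst hN
  induction hN' : dartCount G W (W \ X) using Nat.strong_induction_on generalizing G with
  | _ N ihD =>
  subst hN'
  have ih : MassedLinkedBelow V (10 * k) (2 * k) W.card := fun G' W' X' hc hc' hs hM' =>
    ihW _ hc hc' hs hM' rfl
  by_contra hnot
  have hnbr : ∀ u ∈ W \ X, ∃ v ∈ W \ X, G.Adj u v := by
    intro u hu
    by_contra! hno
    refine hnot (linked_of_nbrs_subset ih hXk hX hM (by omega) hu fun w hw huw => ?_)
    by_contra hwX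
    exact hno w (Finset.mem_sdiff.2 ⟨hw, hwX⟩) huw
  have hpos : (W \ X).Nonempty := by
    by_contra hemp
    rw [Finset.not_nonempty_iff_eq_empty] at hemp
    have := hM.lt
    rw [hemp, dartCount_empty] at this
    omega
  -- Otherwise an edge outside X could be deleted and the inner induction on the number of darts
  -- applied.
  have hD : dartCount G W (W \ X) ≤ 2 * (10 * k) * (W \ X).card + 2 := by
    by_contra! hlt
    obtain ⟨u, hu⟩ := hpos
    obtain ⟨v, hv, huv⟩ := hnbr u hu
    exact hnot (linked_of_deleteEdge ih hXk hM hu hv huv (by omega) fun G' hlt' hM' =>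
      ihD _ hlt' hM' rfl)
  have hcommon : ∀ u ∈ W \ X, ∀ v ∈ W \ X, G.Adj u v → 10 * k ≤ (commonNbrs G W u v).ncard :=
    fun u hu v hv huv => (linked_or_commonNbrs ih hXk hX hM hu hv huv).resolve_left hnot
  obtain ⟨v, hv, hvd⟩ : ∃ v ∈ W \ X,
      (nbrsIn G (W \ X) v).card + 2 * (nbrsIn G X v).card ≤ 2 * (10 * k) + 2 := by
    by_contra! hno
    have h1 := Finset.card_nsmul_le_sum (W \ X) _ (2 * (10 * k) + 3) fun v hv => hno v hv
    have h2 := sum_card_nbrsIn_le_dartCount (G := G) hX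
    rw [smul_eq_mul, mul_comm, Nat.add_mul] at h1
    have := hpos.card_pos
    omega
  set j := (nbrsIn G X v).card with hj
  have hjk : j ≤ 2 * k := (Finset.card_le_card nbrsIn_subset).trans hXk
  have hvn : v ∉ nbrsIn G (W \ X) v := fun h => G.loopless.irrefl v (mem_nbrsIn.1 h).2
  set H := insert v (nbrsIn G (W \ X) v) with hH
  have hHY : H ⊆ W \ X := Finset.insert_subset hv nbrsIn_subset
  have hcomm' : ∀ u ∈ W \ X, G.Adj u v → 10 * k ≤ j +
      (nbrsIn G (nbrsIn G (W \ X) v) u).card := by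
    intro u hu huv
    refine (hcommon u hu v hv huv).trans (le_trans ?_ (Finset.card_union_le _ _))
    rw [← Set.ncard_coe_finset]
    refine Set.ncard_le_ncard ?_ (Set.toFinite _)
    rintro w ⟨hw, huw, hvw⟩
    simp only [Finset.coe_union, Set.mem_union, Finset.mem_coe, mem_nbrsIn, Finset.mem_sdiff]
    tauto
  -- A neighbour x of v outside X shares at least 10k neighbours with v, at most j of them in X, and
  -- v is one further neighbour in H. For v itself, count those it shares with some neighbour u, and
  -- u.
  have hHd : ∀ x ∈ H, 10 * k - j + 1 ≤ (nbrsIn G H x).card := by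
    intro x hx
    rcases Finset.mem_insert.1 hx with rfl | hx
    · obtain ⟨u, hu, hxu⟩ := hnbr x hv
      have h1 := hcomm' u hu hxu.symm
      have h2 : insert u (nbrsIn G (nbrsIn G (W \ X) x) u) ⊆ nbrsIn G H x := by
        refine Finset.insert_subset ?_ fun w hw => ?_
        · exact mem_nbrsIn.2 ⟨Finset.mem_insert_of_mem (mem_nbrsIn.2 ⟨hu, hxu⟩), hxu⟩
        · have h3 := (mem_nbrsIn.1 hw).1
          exact mem_nbrsIn.2 ⟨Finset.mem_insert_of_mem h3, (mem_nbrsIn.1 h3).2⟩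
      have h3 := Finset.card_le_card h2
      rw [Finset.card_insert_of_notMem fun h => G.loopless.irrefl u (mem_nbrsIn.1 h).2] at h3
      omega
    · obtain ⟨hxY, hvx⟩ := mem_nbrsIn.1 hx
      have h1 := hcomm' x hxY hvx.symm
      have h2 : insert v (nbrsIn G (nbrsIn G (W \ X) v) x) ⊆ nbrsIn G H x := by
        refine Finset.insert_subset ?_ fun w hw => ?_
        · exact mem_nbrsIn.2 ⟨Finset.mem_insert_self _ _, hvx.symm⟩
        · have h3 := mem_nbrsIn.1 hw
          exact mem_nbrsIn.2 ⟨Finset.mem_insert_of_mem h3.1, h3.2⟩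
      have h3 := Finset.card_le_card h2
      rw [Finset.card_insert_of_notMem fun h => hvn (mem_nbrsIn.1 h).1] at h3
      omega
  have hHc : H.card ≤ 2 * (10 * k - j + 1) + 1 := by
    rw [hH, Finset.card_insert_of_notMem hvn]
    omega
  obtain ⟨L, hLH, hLk, hL⟩ := exists_linked_subset (k := k) (by omega)
    ⟨v, Finset.mem_insert_self _ _⟩ hHd hHc
  have hLW : L ⊆ W := hLH.trans (hHY.trans Finset.sdiff_subset)
  -- In the second alternative the first side is proper: otherwise L would lie in a separator of
  -- size less than |X| ≤ 2k ≤ |L|.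
  rcases linked_or_exists_sep (G := G) (K := L) hX hLW (fun v hv _ => hv) (fun T hT hTc => by
    obtain ⟨T', hTT', hT'L, hT'c⟩ := Finset.exists_subsuperset_card_eq hT (hTc.trans hXk) hLk
    exact (hL T' hT'L hT'c).mono le_rfl subset_rfl hTT') with h | ⟨A, B, hs, hLB, hlt, hr⟩
  · exact hnot h
  · refine hnot (linked_of_rigid_of_lt ih hXk hM hs hlt (fun h => ?_) hr)
    have h1 := Finset.card_le_card (Finset.subset_inter (h ▸ hLW : L ⊆ A) hLB)
    omega

end OddCycles

/-! ### A highly linked set in a maximum cut -/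

namespace OddCycles

variable {V : Type*}

/-- The spanning subgraph of `G` formed by the edges whose ends get different colours. -/
def crossing (G : SimpleGraph V) (f : V → Bool) : SimpleGraph V where
  Adj u v := G.Adj u v ∧ f u ≠ f v
  symm := ⟨fun _ _ h => ⟨h.1.symm, h.2.symm⟩⟩
  loopless := ⟨fun v h => G.loopless.irrefl v h.1⟩

variable [DecidableEq V]

lemma dartCount_erase [Finite V] {G : SimpleGraph V} {W : Finset V} {v : V} (hv : v ∈ W) :
    dartCount G W W = dartCount G (W.erase v) (W.erase v) + 2 * (nbrsIn G W v).card := by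
  have h1 : {p : V × V | p.1 ∈ W ∧ p.2 ∈ W ∧ G.Adj p.1 p.2 ∧ (p.1 ∈ W ∨ p.2 ∈ W)} =
      {p : V × V | p.1 ∈ W.erase v ∧ p.2 ∈ W.erase v ∧ G.Adj p.1 p.2 ∧
        (p.1 ∈ W.erase v ∨ p.2 ∈ W.erase v)} ∪
      ((fun w => (v, w)) '' (nbrsIn G W v : Set V) ∪ (fun w => (w, v)) '' (nbrsIn G W v)) := by
    ext ⟨a, b⟩
    simp only [Finset.mem_erase, Set.mem_union, Set.mem_ofPred_eq, Set.mem_image, Finset.mem_coe,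
      mem_nbrsIn, Prod.mk.injEq]
    constructor
    · rintro ⟨ha, hb, hab, -⟩
      by_cases hav : a = v
      · subst hav
        exact .inr (.inl ⟨b, ⟨hb, hab⟩, rfl, rfl⟩)
      · by_cases hbv : b = v
        · subst hbv
          exact .inr (.inr ⟨a, ⟨ha, hab.symm⟩, rfl, rfl⟩)
        · exact .inl ⟨⟨hav, ha⟩, ⟨hbv, hb⟩, hab, .inl ⟨hav, ha⟩⟩
    · rintro (h | ⟨w, ⟨hw, hvw⟩, rfl, rfl⟩ | ⟨w, ⟨hw, hvw⟩, rfl, rfl⟩)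
      · exact ⟨h.1.2, h.2.1.2, h.2.2.1, .inl h.1.2⟩
      · exact ⟨hv, hw, hvw, .inl hv⟩
      · exact ⟨hw, hv, hvw.symm, .inl hw⟩
  rw [dartCount, h1, Set.ncard_union_eq _ (Set.toFinite _) (Set.toFinite _),
    Set.ncard_union_eq _ (Set.toFinite _) (Set.toFinite _),
    Set.ncard_image_of_injective _ (Prod.mk_right_injective v),
    Set.ncard_image_of_injective _ (Prod.mk_left_injective v), Set.ncard_coe_finset, two_mul,
    dartCount]
  · rw [Set.disjoint_left]
    rintro _ ⟨w, hw, rfl⟩ ⟨w', hw', h⟩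
    obtain ⟨rfl, rfl⟩ := Prod.mk.inj h
    exact G.loopless.irrefl _ (mem_nbrsIn.1 hw).2
  · rw [Set.disjoint_left]
    rintro ⟨a, b⟩ ⟨ha, hb, -⟩ (⟨w, hw, h⟩ | ⟨w, hw, h⟩)
    · exact Finset.ne_of_mem_erase ha (Prod.mk.inj h).1.symm
    · exact Finset.ne_of_mem_erase hb (Prod.mk.inj h).2.symm

lemma dartCount_le_add_sq [Finite V] {G : SimpleGraph V} {W T : Finset V} :
    dartCount G W W ≤ dartCount G W (W \ T) + T.card * T.card := by
  rw [← Finset.card_product, ← Set.ncard_coe_finset]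
  refine (Set.ncard_le_ncard ?_ (Set.toFinite _)).trans (Set.ncard_union_le _ _)
  rintro ⟨a, b⟩ ⟨ha, hb, hab, -⟩
  simp only [Finset.mem_sdiff, Set.mem_union, Set.mem_ofPred_eq, Finset.mem_coe,
    Finset.mem_product] at *
  tauto

/-- Every graph has a cut containing at least half of the edges at each vertex. -/
lemma exists_crossing [Fintype V] (G : SimpleGraph V) : ∃ f : V → Bool, ∀ v,
    (nbrsIn G Finset.univ v).card ≤ 2 * (nbrsIn (crossing G f) Finset.univ v).card := by
  obtain ⟨f, hf⟩ := Finite.exists_max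
    fun f : V → Bool => dartCount (crossing G f) Finset.univ Finset.univ
  refine ⟨f, fun v => ?_⟩
  have h1 := hf (Function.update f v (!f v))
  rw [dartCount_erase (Finset.mem_univ v), dartCount_erase (Finset.mem_univ v)] at h1
  have h2 : dartCount (crossing G f) (Finset.univ.erase v) (Finset.univ.erase v) ≤
      dartCount (crossing G (Function.update f v (!f v))) (Finset.univ.erase v)
        (Finset.univ.erase v) := by
    refine dartCount_mono subset_rfl subset_rfl fun a ha b hb _ h => ⟨h.1, ?_⟩
    rw [Function.update_of_ne (Finset.ne_of_mem_erase ha),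
      Function.update_of_ne (Finset.ne_of_mem_erase hb)]
    exact h.2
  have h3 : nbrsIn G Finset.univ v ⊆ nbrsIn (crossing G f) Finset.univ v ∪
      nbrsIn (crossing G (Function.update f v (!f v))) Finset.univ v := by
    intro w hw
    have hvw := (mem_nbrsIn.1 hw).2
    simp only [Finset.mem_union, mem_nbrsIn, Finset.mem_univ, true_and, crossing, hvw,
      Function.update_self, Function.update_of_ne hvw.ne']
    cases f v <;> cases f w <;> simp
  have h4 := (Finset.card_le_card h3).trans (Finset.card_union_le _ _)
  omega

/-- A graph of large minimum degree contains a highly linked bipartite subgraph. -/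
theorem exists_linked_crossing [Fintype V] [Nonempty V] {G : SimpleGraph V} {k : ℕ} (hk : 1 ≤ k)
    (hd : ∀ v, 50 * k ≤ (nbrsIn G Finset.univ v).card) :
    ∃ (f : V → Bool) (L : Finset V), 2 * k < L.card ∧
      ∀ T ⊆ L, T.card = 2 * k → Linked (crossing G f) L T := by
  obtain ⟨f, hf⟩ := exists_crossing G
  set F := crossing G f with hF
  have h0 : 25 * k * Fintype.card V ≤ dartCount F Finset.univ Finset.univ := by
    have h1 := sum_card_nbrsIn_le_dartCount (G := F) (Finset.empty_subset Finset.univ)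
    have h2 := Finset.card_nsmul_le_sum (Finset.univ \ ∅ : Finset V)
      (fun v => (nbrsIn F (Finset.univ \ ∅) v).card + 2 * (nbrsIn F ∅ v).card) (25 * k)
      fun v _ => by
        have := hd v
        have := hf v
        rw [Finset.sdiff_empty]
        omega
    rw [Finset.sdiff_empty] at h1 h2
    rw [smul_eq_mul, mul_comm, Finset.card_univ] at h2
    exact h2.trans h1
  have hn : 50 * k ≤ Fintype.card V :=
    (hd (Classical.arbitrary V)).trans (Finset.card_le_univ _)
  -- A Mader-type choice: L is minimal with |L| ≥ 4k and more than 12k(|L| - 2k) edges. The offset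
  -- is what makes the count across a separation of order less than 2k contradictory.
  obtain ⟨L, ⟨hL4, hLe⟩, hmin⟩ := (Set.toFinite {L : Finset V | 4 * k ≤ L.card ∧
      24 * k * L.card < dartCount F L L + 48 * (k * k)}).exists_minimal
    ⟨Finset.univ, by rw [Finset.card_univ]; omega, by rw [Finset.card_univ]; nlinarith⟩
  have hmin' : ∀ L' ⊆ L, L' ≠ L → 4 * k ≤ L'.card →
      dartCount F L' L' + 48 * (k * k) ≤ 24 * k * L'.card := by
    intro L' h1 h2 h3
    by_contra! h4
    exact h2 (h1.antisymm (hmin ⟨h3, h4⟩ h1))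
  -- At |L| = 4k the threshold is 48k² darts, but only 16k² ordered pairs exist.
  have hL5 : 4 * k < L.card := by
    refine lt_of_le_of_ne hL4 fun h => ?_
    have h1 := dartCount_le_add_sq (G := F) (W := L) (T := L)
    rw [Finset.sdiff_self, dartCount_empty, ← h] at h1
    rw [← h] at hLe
    nlinarith
  have hdeg : ∀ v ∈ L, 12 * k < (nbrsIn F L v).card := by
    intro v hv
    have h1 := Finset.card_erase_add_one hv
    have h2 := hmin' (L.erase v) (Finset.erase_subset _ _)
      (fun h => by rw [h] at h1; omega) (by omega)
    rw [dartCount_erase hv, ← h1] at hLe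
    nlinarith
  obtain ⟨v₀, hv₀⟩ : L.Nonempty := Finset.card_pos.1 (by omega)
  have hL12 : 12 * k < L.card := (hdeg v₀ hv₀).trans_le (Finset.card_le_card nbrsIn_subset)
  refine ⟨f, L, by omega, fun T hT hTk => Massed.linked hTk.le hT ⟨?_, fun A B hs hlt => ?_⟩⟩
  -- Ignoring edges inside T costs at most 4k² darts; the gap between 24k and 20k per vertex covers
  -- this, as |L \ T| ≥ 10k.
  · have h1 := dartCount_le_add_sq (G := F) (W := L) (T := T)
    have h2 := Finset.card_sdiff_add_card_eq_card hT
    rw [← h2, hTk] at hLe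
    rw [hTk] at h1
    have h3 : 10 * k ≤ (L \ T).card := by omega
    nlinarith
  -- If B \ A is nonempty, each side contains the more than 12k neighbours of a vertex off the
  -- separator, so minimality bounds the edges of both sides. Their sum is too small for L.
  · rcases (B \ A).eq_empty_or_nonempty with h | ⟨b, hb⟩
    · rw [h, dartCount_empty]
      exact Nat.zero_le _
    exfalso
    obtain ⟨a, ha, haB⟩ : ∃ a ∈ A, a ∉ B := by
      by_contra! h
      rw [Finset.inter_eq_left.2 h] at hlt
      exact absurd (Finset.card_le_card hs.sub) (by omega)
    obtain ⟨hb, hbA⟩ := Finset.mem_sdiff.1 hb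
    have hA : 12 * k < A.card := (hdeg a (hs.left_subset ha)).trans_le <|
      Finset.card_le_card fun x hx => by
        obtain ⟨hx, hax⟩ := mem_nbrsIn.1 hx
        by_contra hxA
        exact hs.not_adj a ha haB x ((hs.mem_or hx).resolve_left hxA) hxA hax
    have hB : 12 * k < B.card := (hdeg b (hs.right_subset hb)).trans_le <|
      Finset.card_le_card fun x hx => by
        obtain ⟨hx, hbx⟩ := mem_nbrsIn.1 hx
        by_contra hxB
        exact hs.not_adj x ((hs.mem_or hx).resolve_right hxB) hxB b hb hbA hbx.symm
    have h1 := hmin' A hs.left_subset (fun h => hbA (h ▸ hs.right_subset hb)) (by omega)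
    have h2 := hmin' B hs.right_subset (fun h => haB (h ▸ hs.left_subset ha)) (by omega)
    have h3 : dartCount F L L ≤ dartCount F A A + dartCount F B B := by
      refine (Set.ncard_le_ncard ?_ (Set.toFinite _)).trans (Set.ncard_union_le _ _)
      rintro ⟨x, y⟩ ⟨hx, hy, hxy, -⟩
      have h3 := hs.not_adj x
      have h4 := hs.not_adj y
      have h5 := hs.mem_or hx
      have h6 := hs.mem_or hy
      have h7 := hxy.symm
      simp only [Set.mem_union, Set.mem_ofPred_eq] at *
      by_cases hxA : x ∈ A <;> by_cases hyA : y ∈ A <;> by_cases hxB : x ∈ B <;>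
        by_cases hyB : y ∈ B <;> simp_all
    have h4 := Finset.card_union_add_card_inter A B
    rw [hs.union] at h4
    rw [hTk] at hlt
    have h5 : 24 * k * A.card + 24 * k * B.card = 24 * k * L.card + 24 * k * (A ∩ B).card := by
      rw [← Nat.mul_add, ← Nat.mul_add, h4]
    have h6 : 24 * k * (A ∩ B).card ≤ 24 * k * (2 * k) := Nat.mul_le_mul_left _ hlt.le
    nlinarith

end OddCycles

/-! ### Tutte–Berge from Tutte's theorem -/

namespace OddCycles

/-- Join `Γ` completely to a clique on `β`. -/
def joinClique {α : Type*} (Γ : SimpleGraph α) (β : Type*) : SimpleGraph (α ⊕ β) where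
  Adj x y := x ≠ y ∧ ∀ a b, x = .inl a → y = .inl b → Γ.Adj a b
  symm := ⟨fun _ _ h => ⟨h.1.symm, fun a b ha hb => (h.2 b a hb ha).symm⟩⟩
  loopless := ⟨fun _ h => h.1 rfl⟩

/-- The **Tutte–Berge** dichotomy, derived from Tutte's theorem. The matching is given as an
involution whose fixed points are the unmatched vertices. -/
theorem tutte_berge {α : Type*} [Finite α] (Γ : SimpleGraph α) (d : ℕ)
    (hd : Even (Nat.card α + d)) :
    (∃ m : α → α, Function.Involutive m ∧ (∀ a, m a ≠ a → Γ.Adj a (m a)) ∧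
      {a | m a = a}.ncard ≤ d) ∨
    ∃ (U : Set α) (q : ℕ) (K : Fin q → Set α), U.ncard + d < q ∧
      Pairwise (Function.onFun Disjoint K) ∧ ∀ i, Disjoint (K i) U ∧ Odd (K i).ncard ∧
        ∀ x ∈ K i, ∀ y ∉ U, Γ.Adj x y → y ∈ K i := by
  classical
  -- The d universal vertices absorb up to d unmatched vertices of Γ.
  set Γ' := joinClique Γ (Fin d) with hΓ'
  by_cases hM : ∃ M : Γ'.Subgraph, M.IsPerfectMatching
  · left
    obtain ⟨M, hM⟩ := hM
    rw [SimpleGraph.Subgraph.isPerfectMatching_iff] at hM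
    choose n hn hn' using hM
    have hnn : ∀ x, n (n x) = x := fun x => (hn' _ _ (hn x).symm).symm
    have hadj : ∀ a b, n (.inl a) = .inl b → Γ.Adj a b := fun a b h =>
      (M.adj_sub (hn (.inl a))).2 a b rfl h
    set m : α → α := fun a => (n (.inl a)).elim id fun _ => a with hm
    have hm₁ : ∀ a b, n (.inl a) = .inl b → m a = b := fun a b h => by simp [hm, h]
    have hm₂ : ∀ a j, n (.inl a) = .inr j → m a = a := fun a b h => by simp [hm, h]
    refine ⟨m, fun a => ?_, fun a => ?_, ?_⟩
    · rcases h : n (.inl a) with b | j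
      · rw [hm₁ a b h]
        exact hm₁ b a (by rw [← h, hnn])
      · rw [hm₂ a j h, hm₂ a j h]
    · rcases h : n (.inl a) with b | j
      · rw [hm₁ a b h]
        exact fun _ => hadj a b h
      · exact fun h' => absurd (hm₂ a j h) h'
    · have hinj : Function.Injective n := Function.LeftInverse.injective hnn
      rw [← Set.ncard_image_of_injective _ (hinj.comp Sum.inl_injective)]
      refine (Set.ncard_le_ncard (t := Set.range Sum.inr) ?_ (Set.toFinite _)).trans ?_
      · rintro _ ⟨a, ha, rfl⟩
        rcases h : n (.inl a) with b | j
        · have h1 := hadj a b h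
          rw [← hm₁ a b h, show m a = a from ha] at h1
          exact absurd h1 (Γ.loopless.irrefl a)
        · exact ⟨j, h.symm⟩
      · rw [← Set.image_univ, Set.ncard_image_of_injective _ Sum.inr_injective, Set.ncard_univ,
          Nat.card_fin]
  · right
    rw [SimpleGraph.tutte] at hM
    push Not at hM
    obtain ⟨u, hu⟩ := hM
    rw [SimpleGraph.IsTutteViolator] at hu
    set H := ((⊤ : Γ'.Subgraph).deleteVerts u).coe with hH
    have hHadj : ∀ x y, H.Adj x y ↔ Γ'.Adj x.1 y.1 := fun x y => by
      rw [hH, SimpleGraph.Subgraph.coe_adj, SimpleGraph.Subgraph.deleteVerts_adj]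
      exact ⟨fun h => h.2.2.2.2, fun h => ⟨trivial, x.2.2, trivial, y.2.2, h⟩⟩
    -- A universal vertex outside u leaves a single component, so u is empty and that component is
    -- odd, contradicting the parity of |α| + d.
    have hinr : ∀ j, (.inr j : α ⊕ Fin d) ∈ u := by
      by_contra! hj
      obtain ⟨j, hj⟩ := hj
      have hconn : ∀ x : _, H.Reachable ⟨.inr j, trivial, hj⟩ x := by
        intro x
        by_cases hx : x.1 = .inr j
        · rw [show x = ⟨.inr j, trivial, hj⟩ from Subtype.ext hx]
        · exact ((hHadj _ _).2 ⟨Ne.symm hx, fun a b h => by cases h⟩).reachable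
      have h1 : H.oddComponents.ncard ≤ 1 := by
        refine Set.ncard_le_one (Set.toFinite _) |>.2 fun a _ b _ => ?_
        induction a using SimpleGraph.ConnectedComponent.ind with | _ a =>
        induction b using SimpleGraph.ConnectedComponent.ind with | _ b =>
        exact SimpleGraph.ConnectedComponent.eq.2 ((hconn a).symm.trans (hconn b))
      have h2 : u = ∅ := (Set.ncard_eq_zero (Set.toFinite _)).1 (by omega)
      have h3 : Odd H.oddComponents.ncard := by
        rw [show H.oddComponents.ncard = 1 by omega]
        exact odd_one
      rw [SimpleGraph.odd_ncard_oddComponents, Nat.card_coe_set_eq, h2] at h3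
      rw [← Nat.not_odd_iff_even] at hd
      apply hd
      simpa [Set.ncard_univ, Nat.card_sum] using h3
    set e := (Set.toFinite H.oddComponents).equivFinOfCardEq
      (n := H.oddComponents.ncard) rfl with he
    refine ⟨Sum.inl ⁻¹' u, H.oddComponents.ncard,
      fun i => {a | ∃ h, H.connectedComponentMk ⟨.inl a, h⟩ = (e.symm i).1}, ?_, ?_, fun i => ?_⟩
    · refine lt_of_le_of_lt ?_ hu
      have h1 : u = Sum.inl '' (Sum.inl ⁻¹' u) ∪ Set.range Sum.inr := by
        ext x
        rcases x with a | j <;> simp [hinr]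
      conv_rhs => rw [h1]
      rw [Set.ncard_union_eq (by
          rw [Set.disjoint_left]
          rintro _ ⟨a, -, rfl⟩ ⟨j, h⟩
          cases h) (Set.toFinite _) (Set.toFinite _),
        Set.ncard_image_of_injective _ Sum.inl_injective, ← Set.image_univ,
        Set.ncard_image_of_injective _ Sum.inr_injective, Set.ncard_univ, Nat.card_fin]
    · intro i j hij
      rw [Function.onFun, Set.disjoint_left]
      rintro a ⟨h, h1⟩ ⟨h', h2⟩
      exact hij (e.symm.injective (Subtype.ext (h1.symm.trans h2)))
    · refine ⟨?_, ?_, ?_⟩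
      · rw [Set.disjoint_left]
        rintro a ⟨h, -⟩ ha
        exact h.2 ha
      · have h1 : Odd (e.symm i).1.supp.ncard := (e.symm i).2
        rw [← Set.ncard_image_of_injective _ Subtype.val_injective] at h1
        rw [← Set.ncard_image_of_injective _ Sum.inl_injective (β := α ⊕ Fin d)]
        convert h1 using 2
        ext x
        constructor
        · rintro ⟨a, ⟨h, h2⟩, rfl⟩
          exact ⟨_, h2, rfl⟩
        · rintro ⟨⟨x, hx⟩, h2, rfl⟩
          rcases x with a | j
          · exact ⟨a, ⟨hx, h2⟩, rfl⟩
          · exact absurd (hinr j) hx.2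
      · rintro x ⟨h, h1⟩ y hy hxy
        refine ⟨⟨trivial, hy⟩, ?_⟩
        rw [← h1]
        refine SimpleGraph.ConnectedComponent.eq.2 (SimpleGraph.Adj.reachable ?_)
        refine (hHadj _ _).2 ⟨fun h => hxy.ne (Sum.inl_injective h).symm, fun a b ha hb => ?_⟩
        cases ha
        cases hb
        exact hxy.symm

end OddCycles

/-! ### From a Tutte obstruction to a small odd cycle cover -/

namespace OddCycles

variable {V : Type*}

lemma ConnIn.of_preconnected {G : SimpleGraph V} {P : Set V} (h : (G.induce P).Preconnected)
    {a b : V} (ha : a ∈ P) (hb : b ∈ P) : ConnIn G P a b := by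
  have key : ∀ {u v : P}, (G.induce P).Walk u v → ConnIn G P u v := by
    intro u v w
    induction w with
    | nil => exact .refl (Subtype.prop _)
    | @cons u v _ h _ ih =>
      exact (ConnIn.of_adj (G := G) (SimpleGraph.comap_adj.1 h) u.2 v.2).trans ih
  obtain ⟨w⟩ := h ⟨a, ha⟩ ⟨b, hb⟩
  exact key w

/-- Two copies of `G` with corresponding vertices joined, after isolating the vertices in `D`. -/
def layered (G : SimpleGraph V) (D : Set (V × Bool)) : SimpleGraph (V × Bool) where
  Adj p q := p ∉ D ∧ q ∉ D ∧ ((G.Adj p.1 q.1 ∧ p.2 = q.2) ∨ (p.1 = q.1 ∧ p.2 ≠ q.2))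
  symm := ⟨fun _ _ h => ⟨h.2.1, h.1, h.2.2.imp (fun h => ⟨h.1.symm, h.2.symm⟩)
    fun h => ⟨h.1.symm, h.2.symm⟩⟩⟩
  loopless := ⟨fun _ h => h.2.2.elim (fun h => G.loopless.irrefl _ h.1) fun h => h.2 rfl⟩

/-- Exchange the two copies of a vertex. -/
def flipLayer (p : V × Bool) : V × Bool := (p.1, !p.2)

lemma flipLayer_flipLayer (p : V × Bool) : flipLayer (flipLayer p) = p := by simp [flipLayer]

lemma flipLayer_ne (p : V × Bool) : flipLayer p ≠ p := fun h => by
  simpa [flipLayer] using congrArg Prod.snd h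

lemma eq_or_eq_flipLayer {p q : V × Bool} (h : p.1 = q.1) : p = q ∨ p = flipLayer q := by
  rcases Bool.eq_or_eq_not p.2 q.2 with h' | h'
  exacts [.inl (Prod.ext h h'), .inr (Prod.ext h h')]

variable [DecidableEq V]

lemma even_card_of_involutive {α : Type*} {s : Finset α} {τ : α → α} (hτ : ∀ a, τ (τ a) = a)
    (hne : ∀ a ∈ s, τ a ≠ a) (hs : ∀ a ∈ s, τ a ∈ s) : Even s.card := by
  have h := Finset.sum_involution (s := s) (f := fun _ => (1 : ZMod 2)) (fun a _ => τ a)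
    (fun _ _ => by decide) (fun a ha _ => hne a ha) hs fun a _ => hτ a
  simp only [Finset.sum_const, nsmul_eq_mul, mul_one] at h
  exact (ZMod.natCast_eq_zero_iff_even).1 h

/-- A graph whose layered graph has a Tutte obstruction has a small odd cycle cover. -/
lemma exists_small_cover [Fintype V] {G : SimpleGraph V} {k : ℕ}
    (hconn : ∀ S : Set V, S.ncard ≤ 2 * k → (G.induce Sᶜ).Preconnected) {L : Finset V}
    (hL : 2 * k < L.card) (f : V → Bool) {U : Set (V × Bool)} {q : ℕ} {K : Fin q → Set (V × Bool)}
    (hq : U.ncard + (2 * L.card - 2 * k) < q) (hK : Pairwise (Function.onFun Disjoint K))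
    (hKU : ∀ i, Disjoint (K i) U) (hodd : ∀ i, Odd (K i).ncard)
    (hcl : ∀ i, ∀ x ∈ K i, ∀ y ∉ U,
      (layered G {p | p.1 ∈ L ∧ p.2 ≠ f p.1}).Adj x y → y ∈ K i) :
    ∃ X : Set V, X.ncard < 2 * k ∧ ∃ c, ProperOn G Xᶜ c := by
  classical
  have : Nonempty (V × Bool) := by
    obtain ⟨v, -⟩ : L.Nonempty := Finset.card_pos.1 (by omega)
    exact ⟨(v, true)⟩
  set D : Set (V × Bool) := {p | p.1 ∈ L ∧ p.2 ≠ f p.1} with hD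
  have hDc : D.ncard = L.card := by
    have : D = (fun v => (v, !f v)) '' (L : Set V) := by
      ext ⟨v, b⟩
      simp only [hD, Set.mem_ofPred_eq, Set.mem_image, Finset.mem_coe, Prod.mk.injEq]
      constructor
      · rintro ⟨h, h'⟩
        exact ⟨v, h, rfl, (Bool.eq_not.2 h').symm⟩
      · rintro ⟨w, hw, rfl, rfl⟩
        exact ⟨hw, by simp⟩
    rw [this, Set.ncard_image_of_injective _ fun a b h => (Prod.mk.inj h).1, Set.ncard_coe_finset]
  set J : Finset (Fin q) := Finset.univ.filter fun i => Disjoint (K i) D with hJ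
  have hJc : q ≤ J.card + (D \ U).ncard := by
    have h1 : J.card + (Finset.univ.filter fun i => ¬ Disjoint (K i) D).card = q := by
      rw [hJ, Finset.card_filter_add_card_filter_not, Finset.card_univ, Fintype.card_fin]
    have h2 : (Finset.univ.filter fun i => ¬ Disjoint (K i) D).card ≤ (D \ U).ncard := by
      have h3 : ∀ i ∈ Finset.univ.filter fun i => ¬ Disjoint (K i) D, ∃ p ∈ D \ U, p ∈ K i := by
        intro i hi
        obtain ⟨p, hp, hpD⟩ := Set.not_disjoint_iff.1 (Finset.mem_filter.1 hi).2
        exact ⟨p, ⟨hpD, Set.disjoint_left.1 (hKU i) hp⟩, hp⟩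
      choose! g hg hgK using h3
      rw [← Set.ncard_coe_finset]
      refine Set.ncard_le_ncard_of_injOn g hg (fun i hi j hj hij => ?_) (Set.toFinite _)
      by_contra hne
      exact Set.disjoint_left.1 (hK hne) (hgK i hi) (hij ▸ hgK j hj)
    omega
  -- Every component outside `J` uses up its own vertex of D \ U, and |D \ U| ≤ |L|; hence the
  -- deficiency survives as |U'| < |J| + 2k.
  set U' := U ∪ D with hU'
  have hU'c : U'.ncard < J.card + 2 * k := by
    have h1 : U'.ncard ≤ U.ncard + (D \ U).ncard := by
      rw [hU', ← Set.union_sdiff_self]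
      exact Set.ncard_union_le _ _
    have h2 := Set.ncard_le_ncard (s := D \ U) (t := D) Set.sdiff_subset (Set.toFinite _)
    omega
  have hKU' : ∀ i ∈ J, ∀ p ∈ K i, p ∉ U' := fun i hi p hp h => h.elim
    (Set.disjoint_left.1 (hKU i) hp) (Set.disjoint_left.1 (Finset.mem_filter.1 hi).2 hp)
  have hcl' : ∀ i ∈ J, ∀ p ∈ K i, ∀ y ∉ U',
      ((G.Adj p.1 y.1 ∧ p.2 = y.2) ∨ (p.1 = y.1 ∧ p.2 ≠ y.2)) → y ∈ K i := by
    intro i hi p hp y hy h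
    exact hcl i p hp y (fun h => hy (.inl h)) ⟨fun h => hKU' i hi p hp (.inr h),
      fun h => hy (.inr h), h⟩
  have hflip : ∀ i ∈ J, ∀ p ∈ K i, flipLayer p ∉ U' → flipLayer p ∈ K i := fun i hi p hp h =>
    hcl' i hi p hp _ h (.inr ⟨rfl, by simp [flipLayer]⟩)
  -- The layer exchange has no fixed points, so an odd set cannot be closed under it.
  have hb : ∀ i ∈ J, ∃ p ∈ K i, flipLayer p ∈ U' := by
    intro i hi
    by_contra! h
    have h1 := even_card_of_involutive (s := (Set.toFinite (K i)).toFinset) flipLayer_flipLayer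
      (fun a _ => flipLayer_ne a) fun a ha => by
        rw [Set.Finite.mem_toFinset] at ha ⊢
        exact hflip i hi a ha (h a ha)
    rw [← Set.ncard_eq_toFinset_card (K i) (Set.toFinite _)] at h1
    exact Nat.not_odd_iff_even.2 h1 (hodd i)
  choose! p hpK hpU using hb
  set b : Fin q → V := fun i => (p i).1 with hb
  have hbinj : Set.InjOn b J := by
    intro i hi j hj hij
    by_contra hne
    rcases eq_or_eq_flipLayer hij with h | h
    · exact Set.disjoint_left.1 (hK hne) (hpK i hi) (h ▸ hpK j hj)
    · exact hKU' i hi _ (hpK i hi) (h ▸ hpU j hj)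
  have hbU : b '' J ⊆ Prod.fst '' U' := by
    rintro _ ⟨i, hi, rfl⟩
    exact ⟨_, hpU i hi, rfl⟩
  set X : Set V := Prod.fst '' U' \ b '' J with hX
  have hXc : X.ncard < 2 * k := by
    rw [hX, Set.ncard_sdiff hbU (Set.toFinite _), hbinj.ncard_image,
      Set.ncard_coe_finset]
    have := Set.ncard_image_le (s := U') (f := Prod.fst) (Set.toFinite _)
    have h := Set.ncard_le_ncard hbU (Set.toFinite _)
    rw [hbinj.ncard_image, Set.ncard_coe_finset] at h
    omega
  have hnot : ∀ v, v ∉ Prod.fst '' U' → ∀ β, (v, β) ∉ U' := fun v hv β h => hv ⟨_, h, rfl⟩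
  -- If both copies of v avoided U', the vertices with the same property and the same component
  -- would be closed under adjacency away from X and at most one vertex `b i`. Connectivity would
  -- carry the property to a vertex of L, one of whose copies lies in D.
  have hall : ∀ v, v ∈ Prod.fst '' U' := by
    intro v
    by_contra hv
    set Q : Set (Fin q) := {i | i ∈ J ∧ (v, false) ∈ K i} with hQ
    have hQc : Q.ncard ≤ 1 := by
      refine (Set.ncard_le_one (Set.toFinite _)).2 fun i hi j hj => ?_
      by_contra hne
      exact Set.disjoint_left.1 (hK hne) hi.2 hj.2
    have hS : (X ∪ b '' Q).ncard ≤ 2 * k := by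
      have h1 := Set.ncard_union_le X (b '' Q)
      have h2 := Set.ncard_image_le (s := Q) (f := b) (Set.toFinite _)
      omega
    have hvS : v ∈ (X ∪ b '' Q)ᶜ := by
      rintro (h | ⟨i, hi, h⟩)
      · exact hv h.1
      · exact hv (hbU ⟨i, hi.1, h⟩)
    obtain ⟨l, hl, hlS⟩ : ∃ l ∈ L, l ∉ X ∪ b '' Q := by
      by_contra! h
      have := Set.ncard_le_ncard (s := (L : Set V)) h (Set.toFinite _)
      rw [Set.ncard_coe_finset] at this
      omega
    have h1 := ConnIn.mem_of_closed (ConnIn.of_preconnected (hconn _ hS) hvS hlS)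
      (R := {w | w ∉ Prod.fst '' U' ∧ ∀ i ∈ J, (w, false) ∈ K i ↔ i ∈ Q})
      ⟨hv, fun i hi => ⟨fun h => ⟨hi, h⟩, fun h => h.2⟩⟩ (fun x hx y hy hxR hxy => by
        by_cases hyU : y ∈ Prod.fst '' U'
        · exfalso
          apply hy
          by_cases hyb : y ∈ b '' J
          · obtain ⟨i, hi, rfl⟩ := hyb
            refine .inr ⟨i, (hxR.2 i hi).1 ?_, rfl⟩
            have h2 : (x, (p i).2) ∈ K i := hcl' i hi (p i) (hpK i hi) _ (hnot x hxR.1 _)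
              (.inl ⟨hxy.symm, rfl⟩)
            rcases eq_or_eq_flipLayer (p := (x, false)) (q := (x, (p i).2)) rfl with h | h
            · rwa [h]
            · rw [h]
              exact hflip i hi _ h2 (h ▸ hnot x hxR.1 _)
          · exact .inl ⟨hyU, hyb⟩
        · refine ⟨hyU, fun i hi => Iff.trans ⟨fun h => ?_, fun h => ?_⟩ (hxR.2 i hi)⟩
          · exact hcl' i hi _ h _ (hnot x hxR.1 _) (.inl ⟨hxy.symm, rfl⟩)
          · exact hcl' i hi _ h _ (hnot y hyU _) (.inl ⟨hxy, rfl⟩))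
    exact h1.1 ⟨(l, !f l), .inr ⟨hl, by simp⟩, rfl⟩
  have : Nonempty (Fin q) := ⟨⟨0, by omega⟩⟩
  have hR : ∀ v ∈ Xᶜ, ∃ i ∈ J, b i = v := fun v hv => by
    by_contra h
    exact hv ⟨hall v, fun h' => h h'⟩
  choose! r hrJ hrb using hR
  -- Every vertex outside X is some `b i` and is coloured by the layer of `p i`. Adjacent vertices
  -- of equal colour would put their copies into the same component, forcing the vertices to
  -- coincide.
  refine ⟨X, hXc, fun v => (p (r v)).2, fun x hx y hy hxy hc => ?_⟩
  have h5 := hcl' _ (hrJ x hx) _ (hpK _ (hrJ x hx)) (p (r y))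
    (hKU' _ (hrJ y hy) _ (hpK _ (hrJ y hy)))
    (.inl ⟨by
      rw [show (p (r x)).1 = x from hrb x hx, show (p (r y)).1 = y from hrb y hy]
      exact hxy, hc⟩)
  have h6 : r x = r y := by
    by_contra hne
    exact Set.disjoint_left.1 (hK hne) h5 (hpK _ (hrJ y hy))
  rw [← hrb x hx, ← hrb y hy, h6] at hxy
  exact G.loopless.irrefl _ hxy

end OddCycles

/-! ### Orbits of two involutions -/

namespace OddCycles

/-- The graph joining each point to its images under two maps. -/
def orbitGraph {α : Type*} (m τ : α → α) : SimpleGraph α where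
  Adj a b := a ≠ b ∧ (b = m a ∨ b = τ a ∨ a = m b ∨ a = τ b)
  symm := ⟨fun a b h => ⟨h.1.symm, by tauto⟩⟩
  loopless := ⟨fun _ h => h.1 rfl⟩

variable {α : Type*} [DecidableEq α] {m τ : α → α}

/-- Degrees in the orbit graph are at most 2, less one for each involution fixing the vertex, while
a connected graph on n vertices has at least n - 1 edges. -/
lemma card_fixed_add_card_fixed_le (hm : Function.Involutive m) (hτ : Function.Involutive τ)
    {C : Finset α} (hC : ((orbitGraph m τ).induce (C : Set α)).Connected) :
    (C.filter fun a => m a = a).card + (C.filter fun a => τ a = a).card ≤ 2 := by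
  classical
  set H := (orbitGraph m τ).induce (C : Set α) with hH
  have h1 := hC.card_vert_le_card_edgeSet_add_one
  have h2 := H.sum_degrees_eq_twice_card_edges
  have h3 : ∀ a : (C : Set α), H.degree a + ((if m a.1 = a.1 then 1 else 0) +
      (if τ a.1 = a.1 then 1 else 0)) ≤ 2 := by
    intro a
    have h4 : H.degree a ≤ (({m a.1, τ a.1} : Finset α).erase a.1).card := by
      rw [← SimpleGraph.card_neighborFinset_eq_degree,
        ← Finset.card_image_of_injective _ Subtype.val_injective]
      refine Finset.card_le_card fun x hx => ?_
      obtain ⟨y, hy, rfl⟩ := Finset.mem_image.1 hx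
      obtain ⟨hne, h⟩ : (orbitGraph m τ).Adj a.1 y.1 := by simpa [hH] using hy
      have h5 := hm y.1
      have h6 := hτ y.1
      simp only [Finset.mem_erase, Finset.mem_insert, Finset.mem_singleton]
      refine ⟨hne.symm, ?_⟩
      rcases h with h | h | h | h
      · exact .inl h
      · exact .inr h
      · exact .inl (by rw [h, h5])
      · exact .inr (by rw [h, h6])
    refine (Nat.add_le_add_right h4 _).trans ?_
    by_cases h5 : m a.1 = a.1 <;> by_cases h6 : τ a.1 = a.1
    · simp [h5, h6]
    · have : ({m a.1, τ a.1} : Finset α).erase a.1 ⊆ {τ a.1} := by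
        intro x
        simp [h5]
      have := Finset.card_le_card this
      simp only [Finset.card_singleton, h5, h6, if_true, if_false] at this ⊢
      omega
    · have : ({m a.1, τ a.1} : Finset α).erase a.1 ⊆ {m a.1} := by
        intro x
        simp [h6]
        tauto
      have := Finset.card_le_card this
      simp only [Finset.card_singleton, h5, h6, if_true, if_false] at this ⊢
      omega
    · have := (Finset.card_le_card (Finset.erase_subset a.1 {m a.1, τ a.1})).trans
        Finset.card_le_two
      simp only [h5, h6, if_false]
      omega
  have h4 := Finset.sum_le_sum fun a (_ : a ∈ (Finset.univ : Finset (C : Set α))) => h3 a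
  rw [Finset.sum_add_distrib, Finset.sum_add_distrib, h2] at h4
  have h5 : ∀ P : α → Prop, [DecidablePred P] →
      ∑ a : (C : Set α), (if P a.1 then 1 else 0) = (C.filter P).card := by
    intro P _
    rw [Finset.card_filter]
    convert Finset.sum_finset_coe (fun a => if P a then 1 else 0) C
  rw [h5 (fun a => m a = a), h5 (fun a => τ a = a), Finset.sum_const, Finset.card_univ] at h4
  have h6 : Nat.card H.edgeSet = H.edgeFinset.card := by
    rw [Nat.card_eq_fintype_card, SimpleGraph.edgeFinset_card]
  rw [h6, Nat.card_eq_fintype_card] at h1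
  simp only [smul_eq_mul] at h4
  omega

lemma even_card_add_card_fixed {τ : α → α} (hτ : Function.Involutive τ) {C : Finset α}
    (hC : ∀ a ∈ C, τ a ∈ C) : Even (C.card + (C.filter fun a => τ a = a).card) := by
  have h1 := even_card_of_involutive (s := C.filter fun a => ¬ τ a = a) hτ
    (fun a ha => (Finset.mem_filter.1 ha).2) fun a ha => by
      obtain ⟨h, h'⟩ := Finset.mem_filter.1 ha
      exact Finset.mem_filter.2 ⟨hC a h, fun h2 => h' (by rw [hτ] at h2; exact h2.symm)⟩
  have h2 := Finset.card_filter_add_card_filter_not (s := C) (fun a => τ a = a)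
  rw [← h2]
  obtain ⟨r, hr⟩ := h1
  exact ⟨(C.filter fun a => τ a = a).card + r, by omega⟩

/-- If `τ` has at least `2 * k` more fixed points than `m`, then there are `k` disjoint sets closed
under `m` and `τ`, containing two fixed points of `τ` but none of `m`. -/
lemma exists_orbits [Fintype α] (hm : Function.Involutive m) (hτ : Function.Involutive τ) {k : ℕ}
    (h : (Finset.univ.filter fun a => m a = a).card + 2 * k ≤
      (Finset.univ.filter fun a => τ a = a).card) :
    ∃ C : Fin k → Finset α, Pairwise (Function.onFun Disjoint C) ∧
      ∀ i, (∀ a ∈ C i, m a ∈ C i ∧ τ a ∈ C i ∧ m a ≠ a) ∧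
        ((C i).filter fun a => τ a = a).card = 2 := by
  classical
  set Γ := orbitGraph m τ with hΓ
  set B : Γ.ConnectedComponent → Finset α :=
    fun c => Finset.univ.filter fun a => Γ.connectedComponentMk a = c with hB
  have hmem : ∀ c a, a ∈ B c ↔ Γ.connectedComponentMk a = c := by simp [hB]
  have hstep : ∀ a b, b = m a ∨ b = τ a → Γ.connectedComponentMk b = Γ.connectedComponentMk a := by
    intro a b hab
    by_cases hne : a = b
    · rw [hne]
    · refine SimpleGraph.ConnectedComponent.eq.2 (SimpleGraph.Adj.reachable ?_)
      exact SimpleGraph.Adj.symm ⟨hne, by tauto⟩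
  have hmB : ∀ c, ∀ a ∈ B c, m a ∈ B c := fun c a ha => by
    rw [hmem] at ha ⊢
    rw [hstep a _ (.inl rfl), ha]
  have hτB : ∀ c, ∀ a ∈ B c, τ a ∈ B c := fun c a ha => by
    rw [hmem] at ha ⊢
    rw [hstep a _ (.inr rfl), ha]
  have hsum : ∀ P : α → Prop, [DecidablePred P] →
      (Finset.univ.filter P).card = ∑ c, ((B c).filter P).card := by
    intro P _
    rw [Finset.card_eq_sum_card_fiberwise (f := Γ.connectedComponentMk) (t := Finset.univ)
      fun _ _ => Finset.mem_coe.2 (Finset.mem_univ _)]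
    refine Finset.sum_congr rfl fun c _ => congrArg _ ?_
    ext a
    simp [hB, and_comm]
  set good : Finset Γ.ConnectedComponent := Finset.univ.filter fun c =>
    ((B c).filter fun a => m a = a).card = 0 ∧ ((B c).filter fun a => τ a = a).card = 2 with hgood
  -- Both numbers of fixed points have the parity of the component and their sum is at most 2. So
  -- `τ` exceeds `m` only in a good component, and then by 2.
  have hle : ∀ c, ((B c).filter fun a => τ a = a).card ≤
      ((B c).filter fun a => m a = a).card + if c ∈ good then 2 else 0 := by
    intro c
    have h1 := card_fixed_add_card_fixed_le hm hτ (C := B c) (by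
      have h2 := c.connected_toSimpleGraph
      have h3 : (B c : Set α) = c.supp := by
        ext a
        simp [hB]
      rw [h3]
      exact h2)
    obtain ⟨r, hr⟩ := even_card_add_card_fixed hm (hmB c)
    obtain ⟨r', hr'⟩ := even_card_add_card_fixed hτ (hτB c)
    split_ifs with hc
    · omega
    · have : ¬(((B c).filter fun a => m a = a).card = 0 ∧
        ((B c).filter fun a => τ a = a).card = 2) := fun h =>
        hc (Finset.mem_filter.2 ⟨Finset.mem_univ _, h⟩)
      omega
  have h1 := Finset.sum_le_sum fun c (_ : c ∈ (Finset.univ : Finset Γ.ConnectedComponent)) => hle c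
  rw [Finset.sum_add_distrib, ← hsum, ← hsum, ← Finset.sum_filter, Finset.filter_mem_eq_inter,
    Finset.univ_inter, Finset.sum_const, smul_eq_mul] at h1
  obtain ⟨g, hg⟩ : ∃ g : Fin k → Γ.ConnectedComponent, Function.Injective g ∧ ∀ i, g i ∈ good := by
    obtain ⟨s, hs, hsk⟩ := Finset.exists_subset_card_eq (s := good) (n := k) (by omega)
    exact ⟨fun i => (s.equivFinOfCardEq hsk).symm i,
      Subtype.val_injective.comp (Equiv.injective _), fun i => hs (Subtype.prop _)⟩
  refine ⟨fun i => B (g i), fun i j hij => ?_, fun i => ?_⟩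
  · rw [Function.onFun, Finset.disjoint_left]
    intro a ha hb
    rw [hmem] at ha hb
    exact hij (hg.1 (ha.symm.trans hb))
  · obtain ⟨h2, h3⟩ := (Finset.mem_filter.1 (hg.2 i)).2
    exact ⟨fun a ha => ⟨hmB _ a ha, hτB _ a ha,
      (Finset.filter_eq_empty_iff.1 (Finset.card_eq_zero.1 h2)) ha⟩, h3⟩

/-- A two-valued function changing along `m` and off the fixed points of `τ` along `τ` separates the
two fixed points of `τ`. -/
lemma exists_fixed_ne {m τ : α → α} (hm : Function.Involutive m) (hτ : Function.Involutive τ)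
    {C : Finset α} (hmC : ∀ a ∈ C, m a ∈ C) (hτC : ∀ a ∈ C, τ a ∈ C) (g : α → Bool)
    (hgm : ∀ a ∈ C, g (m a) ≠ g a) (hgτ : ∀ a ∈ C, τ a ≠ a → g (τ a) ≠ g a) {x y : α}
    (hxy : ((C.filter fun a => τ a = a) : Set α) = {x, y}) (hne : x ≠ y) : g x ≠ g y := by
  classical
  -- An involution changing `g` balances its two values. Apply this to `m` on C and to `τ` off its
  -- fixed points; then x and y must balance as well.
  have hcard : ∀ (σ : α → α), Function.Involutive σ → ∀ S : Finset α,
      (∀ a ∈ S, σ a ∈ S ∧ g (σ a) ≠ g a) →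
      (S.filter fun a => g a = true).card = (S.filter fun a => g a = false).card := by
    intro σ hσ S hS
    refine Finset.card_bij' (fun a _ => σ a) (fun a _ => σ a) ?_ ?_ (fun a _ => hσ a)
      (fun a _ => hσ a)
    · intro a ha
      obtain ⟨h, h'⟩ := Finset.mem_filter.1 ha
      have := (hS a h).2
      exact Finset.mem_filter.2 ⟨(hS a h).1, by simpa [h'] using this⟩
    · intro a ha
      obtain ⟨h, h'⟩ := Finset.mem_filter.1 ha
      have := (hS a h).2
      exact Finset.mem_filter.2 ⟨(hS a h).1, by simpa [h'] using this⟩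
  have h1 := hcard m hm C fun a ha => ⟨hmC a ha, hgm a ha⟩
  have h2 := hcard τ hτ (C.filter fun a => ¬ τ a = a) fun a ha => by
    obtain ⟨h, h'⟩ := Finset.mem_filter.1 ha
    exact ⟨Finset.mem_filter.2 ⟨hτC a h, fun h2 => h' (by rw [hτ] at h2; exact h2.symm)⟩,
      hgτ a h h'⟩
  have hfix : (C.filter fun a => τ a = a) = {x, y} := by
    rw [← Finset.coe_inj, Finset.coe_insert, Finset.coe_singleton]
    exact_mod_cast hxy
  have h3 : ∀ b : Bool, (C.filter fun a => g a = b).card =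
      (({x, y} : Finset α).filter fun a => g a = b).card +
        ((C.filter fun a => ¬ τ a = a).filter fun a => g a = b).card := by
    intro b
    rw [← hfix, Finset.filter_filter, Finset.filter_filter,
      ← Finset.card_filter_add_card_filter_not (s := C.filter fun a => g a = b) (fun a => τ a = a),
      Finset.filter_filter, Finset.filter_filter]
    simp only [and_comm]
  have h4 := h3 true
  have h5 := h3 false
  intro heq
  cases hb : g y <;>
    simp [Finset.filter_insert, Finset.filter_singleton, heq, hb, hne] at h4 h5 <;> omega

end OddCycles

/-! ### The Erdős–Pósa dichotomy -/

namespace OddCycles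

variable {V : Type*} [DecidableEq V]

/-- A sufficiently connected graph contains `k` disjoint non-bipartite subgraphs or it has an odd
cycle cover with fewer than `2 * k` vertices. -/
theorem exists_disjoint_or_small_cover [Fintype V] [Nonempty V] {G : SimpleGraph V} {k : ℕ}
    (hk : 1 ≤ k) (hd : ∀ v, 50 * k ≤ (nbrsIn G Finset.univ v).card)
    (hconn : ∀ S : Set V, S.ncard ≤ 2 * k → (G.induce Sᶜ).Preconnected) :
    (∃ Z : Fin k → Set V, Pairwise (Function.onFun Disjoint Z) ∧
      ∀ i, ¬ ∃ c, ProperOn G (Z i) c) ∨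
    ∃ X : Set V, X.ncard < 2 * k ∧ ∃ c, ProperOn G Xᶜ c := by
  classical
  obtain ⟨f, L, hL, hlink⟩ := exists_linked_crossing hk hd
  -- The involution `τ` below has 2|L| fixed points, so this many unmatched vertices leave the
  -- surplus 2k needed for k orbits.
  rcases tutte_berge (layered G {p | p.1 ∈ L ∧ p.2 ≠ f p.1}) (2 * L.card - 2 * k) (by
      rw [Nat.card_eq_fintype_card, Fintype.card_prod, Fintype.card_bool]
      exact ⟨Fintype.card V + (L.card - k), by omega⟩) with
    ⟨m, hm, hmadj, hmc⟩ | ⟨U, q, K, hq, hK, hKp⟩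
  swap
  · exact .inr (exists_small_cover hconn hL f hq hK (fun i => (hKp i).1) (fun i => (hKp i).2.1)
      fun i => (hKp i).2.2)
  left
  set τ : V × Bool → V × Bool := fun p => if p.1 ∈ L then p else flipLayer p with hτdef
  have hτL : ∀ p, p.1 ∈ L → τ p = p := fun p hp => if_pos hp
  have hτL' : ∀ p, p.1 ∉ L → τ p = flipLayer p := fun p hp => if_neg hp
  have hτfix : ∀ p, τ p = p ↔ p.1 ∈ L := fun p =>
    ⟨fun h => by_contra fun hp => flipLayer_ne p (hτL' p hp ▸ h), hτL p⟩
  have hτ : Function.Involutive τ := fun p => by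
    by_cases hp : p.1 ∈ L
    · rw [hτL p hp, hτL p hp]
    · rw [hτL' p hp, hτL' (flipLayer p) hp, flipLayer_flipLayer]
  obtain ⟨C, hCd, hC⟩ := exists_orbits hm hτ (k := k) (by
    have h1 : (Finset.univ.filter fun p => τ p = p) = L ×ˢ (Finset.univ : Finset Bool) := by
      ext p
      simp [hτfix]
    rw [h1, Finset.card_product, Finset.card_univ, Fintype.card_bool]
    have h2 : (Finset.univ.filter fun p => m p = p).card ≤ 2 * L.card - 2 * k := by
      rw [← Set.ncard_coe_finset]
      simpa using hmc
    omega)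
  have hadj : ∀ i, ∀ p ∈ C i, (layered G {p | p.1 ∈ L ∧ p.2 ≠ f p.1}).Adj p (m p) :=
    fun i p hp => hmadj p ((hC i).1 p hp).2.2
  -- The copies of L in the wrong layer are isolated, hence fixed by `m`, and so absent from the
  -- chosen orbits.
  have hlay : ∀ i, ∀ p ∈ C i, p.1 ∈ L → p.2 = f p.1 := fun i p hp hpL => by
    by_contra h
    exact (hadj i p hp).1 ⟨hpL, h⟩
  have hsame : ∀ i j, ∀ p ∈ C i, ∀ q ∈ C j, p.1 = q.1 → i = j := by
    intro i j p hp q hq hpq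
    by_contra hij
    have hpj : p ∉ C j := Finset.disjoint_left.1 (hCd hij) hp
    rcases eq_or_eq_flipLayer hpq with h | h
    · exact hpj (h ▸ hq)
    · by_cases hqL : q.1 ∈ L
      · apply hpj
        rwa [Prod.ext hpq ((hlay i p hp (hpq ▸ hqL)).trans (hpq ▸ (hlay j q hq hqL).symm))]
      · apply hpj
        rw [h, ← hτL' q hqL]
        exact ((hC j).1 q hq).2.1
  have hxy : ∀ i, ∃ x y, x ≠ y ∧ ((C i).filter fun p => τ p = p) = {x, y} := fun i =>
    Finset.card_eq_two.1 (hC i).2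
  choose x y hne hfix using hxy
  have hx : ∀ i, x i ∈ C i ∧ (x i).1 ∈ L := fun i => by
    have : x i ∈ (C i).filter fun p => τ p = p := by simp [hfix i]
    exact ⟨(Finset.mem_filter.1 this).1, (hτfix _).1 (Finset.mem_filter.1 this).2⟩
  have hy : ∀ i, y i ∈ C i ∧ (y i).1 ∈ L := fun i => by
    have : y i ∈ (C i).filter fun p => τ p = p := by simp [hfix i]
    exact ⟨(Finset.mem_filter.1 this).1, (hτfix _).1 (Finset.mem_filter.1 this).2⟩
  have hmemL : ∀ i, ∀ p ∈ C i, p.1 ∈ L → p.1 = (x i).1 ∨ p.1 = (y i).1 := by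
    intro i p hp hpL
    have : p ∈ (C i).filter fun p => τ p = p := Finset.mem_filter.2 ⟨hp, hτL p hpL⟩
    rw [hfix i, Finset.mem_insert, Finset.mem_singleton] at this
    exact this.imp (congrArg _) (congrArg _)
  set T₀ : Finset V := Finset.univ.image (fun i => (x i).1) ∪ Finset.univ.image fun i => (y i).1
    with hT₀
  have hT₀L : T₀ ⊆ L := by
    intro v hv
    rcases Finset.mem_union.1 hv with h | h
    · obtain ⟨i, -, rfl⟩ := Finset.mem_image.1 h
      exact (hx i).2
    · obtain ⟨i, -, rfl⟩ := Finset.mem_image.1 h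
      exact (hy i).2
  have hT₀c : T₀.card ≤ 2 * k := by
    have h1 : T₀.card ≤ _ := Finset.card_union_le _ _
    have h2 := Finset.card_image_le (s := Finset.univ) (f := fun i : Fin k => (x i).1)
    have h3 := Finset.card_image_le (s := Finset.univ) (f := fun i : Fin k => (y i).1)
    rw [Finset.card_univ, Fintype.card_fin] at h2 h3
    omega
  have hxT : ∀ i, (x i).1 ∈ T₀ := fun i =>
    Finset.mem_union_left _ (Finset.mem_image_of_mem _ (Finset.mem_univ i))
  have hyT : ∀ i, (y i).1 ∈ T₀ := fun i =>
    Finset.mem_union_right _ (Finset.mem_image_of_mem _ (Finset.mem_univ i))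
  obtain ⟨T, hT₀T, hTL, hTc⟩ := Finset.exists_subsuperset_card_eq hT₀L hT₀c hL.le
  obtain ⟨P, hPd, hP⟩ := hlink T hTL hTc (Fin k) (fun i => (x i).1) (fun i => (y i).1)
    (fun i => ⟨hT₀T (hxT i), hT₀T (hyT i)⟩) fun i j hij =>
      ⟨fun h => hij (hsame i j _ (hx i).1 _ (hx j).1 h),
        fun h => hij (hsame i j _ (hx i).1 _ (hy j).1 h),
        fun h => hij (hsame i j _ (hy i).1 _ (hy j).1 h)⟩
  have hCP : ∀ i j, i ≠ j → Disjoint (Prod.fst '' (C i : Set (V × Bool))) (P j) := by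
    intro i j hij
    rw [Set.disjoint_left]
    rintro _ ⟨p, hp, rfl⟩ hpP
    have hpT : p.1 ∈ T := by
      rcases hmemL i p hp ((hP j).1 hpP) with h | h
      exacts [hT₀T (h ▸ hxT i), hT₀T (h ▸ hyT i)]
    rcases (hP j).2.2 ⟨hpP, hpT⟩ with h | h
    exacts [hij (hsame i j _ hp _ (hx j).1 h), hij (hsame i j _ hp _ (hy j).1 h)]
  refine ⟨fun i => Prod.fst '' (C i : Set (V × Bool)) ∪ P i, fun i j hij => ?_, ?_⟩
  · refine Set.disjoint_union_left.2 ⟨Set.disjoint_union_right.2 ⟨?_, hCP i j hij⟩,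
      Set.disjoint_union_right.2 ⟨(hCP j i hij.symm).symm, hPd hij⟩⟩
    rw [Set.disjoint_left]
    rintro _ ⟨p, hp, rfl⟩ ⟨q, hq, h⟩
    exact hij (hsame i j p hp q hq h.symm)
  · rintro i ⟨c, hc⟩
    have hcC : ∀ p ∈ C i, p.1 ∈ Prod.fst '' (C i : Set (V × Bool)) ∪ P i :=
      fun p hp => .inl ⟨p, hp, rfl⟩
    -- For a proper colouring c, the sum of colour and layer changes along `m`, by an edge of G or
    -- by a change of layer, and along `τ` off its fixed points. So it differs at the two ends of
    -- the orbit.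
    have h1 := exists_fixed_ne hm hτ (fun p hp => ((hC i).1 p hp).1)
      (fun p hp => ((hC i).1 p hp).2.1) (fun p => xor (c p.1) p.2) (fun p hp => by
        rcases (hadj i p hp).2.2 with ⟨h, h'⟩ | ⟨h, h'⟩
        · have := hc _ (hcC p hp) _ (hcC _ ((hC i).1 p hp).1) h
          rw [← h']
          revert this
          cases c p.1 <;> cases c (m p).1 <;> cases p.2 <;> decide
        · rw [← h]
          revert h'
          cases c p.1 <;> cases (m p).2 <;> cases p.2 <;> decide) (fun p hp hpτ => by
        rw [hτL' p fun h => hpτ (hτL p h), flipLayer]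
        dsimp only
        cases c p.1 <;> cases p.2 <;> decide) (x := x i) (y := y i)
      (by rw [hfix i]; simp) (hne i)
    -- Along the linkage both c and f change at every edge, so their sum is constant. At the ends f
    -- is the layer, so this contradicts the previous step.
    have h2 := (hP i).2.1.mem_of_closed
      (R := {v | xor (c v) (f v) = xor (c (x i).1) (f (x i).1)}) rfl fun u hu v hv huR huv => by
        have h3 := hc u (.inr hu) v (.inr hv) huv.1
        have h4 := huv.2
        rw [Set.mem_ofPred_eq] at huR ⊢
        rw [← huR]
        revert h3 h4
        cases c u <;> cases c v <;> cases f u <;> cases f v <;> decide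
    apply h1
    rw [hlay i _ (hx i).1 (hx i).2, hlay i _ (hy i).1 (hy i).2]
    exact (show _ = _ from h2).symm

end OddCycles

/-! ### Matchings from odd cycles, and existence of nice partitions -/

namespace OddCycles

variable {V : Type*}

lemma IsVertexConnected.preconnected {G : SimpleGraph V} {m : ℕ} (hG : IsVertexConnected G m)
    {S : Set V} (hS : S.ncard < m) : (G.induce Sᶜ).Preconnected :=
  (hG.2 S hS).preconnected

lemma IsVertexConnected.le_card_nbrsIn [Fintype V] {G : SimpleGraph V} {m : ℕ}
    (hG : IsVertexConnected G m) (v : V) : m ≤ (nbrsIn G Finset.univ v).card := by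
  classical
  by_contra! h
  have h1 := hG.1
  rw [Nat.card_eq_fintype_card, ← Finset.card_univ] at h1
  obtain ⟨w, -, hw⟩ := Finset.exists_mem_notMem_of_card_lt_card
    (s := insert v (nbrsIn G Finset.univ v)) (t := Finset.univ)
    ((Finset.card_insert_le _ _).trans_lt (by omega))
  rw [Finset.mem_insert, not_or] at hw
  have h2 := hG.preconnected (S := nbrsIn G Finset.univ v) (by rwa [Set.ncard_coe_finset])
  have h3 := (ConnIn.of_preconnected h2 (a := v) (b := w)
    (fun h => G.loopless.irrefl v (mem_nbrsIn.1 h).2) hw.2).mem_of_closed (R := {v}) rfl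
    fun x hx y hy hxv hxy => by
      rw [Set.mem_singleton_iff] at hxv
      subst hxv
      exact absurd (mem_nbrsIn.2 ⟨Finset.mem_univ y, hxy⟩) hy
  exact hw.1 h3

/-! ### Matchings across a partition -/

lemma hasMatchingOfSize_iff {H : SimpleGraph V} {k : ℕ} :
    HasMatchingOfSize H k ↔ ∃ w : Fin k × Bool → V, Function.Injective w ∧
      ∀ i, H.Adj (w (i, false)) (w (i, true)) := by
  constructor
  · rintro ⟨M, hM, hMk⟩
    -- For k = 0 the edge set could be infinite, because `ncard` is then 0 as well.
    rcases Nat.eq_zero_or_pos k with rfl | hk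
    · exact ⟨fun p => p.1.elim0, fun p => p.1.elim0, fun i => i.elim0⟩
    have hfin : M.edgeSet.Finite := Set.finite_of_ncard_pos (by omega)
    set e := hfin.equivFinOfCardEq hMk
    have hrep : ∀ i, ∃ u v, s(u, v) = (e.symm i).1 := fun i => by
      induction (e.symm i).1 using Sym2.ind with | _ u v => exact ⟨u, v, rfl⟩
    choose u v huv using hrep
    have hadj : ∀ i, M.Adj (u i) (v i) := fun i => by
      rw [← SimpleGraph.Subgraph.mem_edgeSet, huv i]
      exact (e.symm i).2
    have hinj : ∀ i j, s(u i, v i) = s(u j, v j) → i = j := fun i j h =>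
      e.symm.injective (Subtype.ext (by rw [← huv, ← huv, h]))
    refine ⟨fun p => bif p.2 then v p.1 else u p.1, ?_, fun i => (hadj i).adj_sub⟩
    rintro ⟨i, a⟩ ⟨j, b⟩ h
    have hij : i = j := by
      apply hinj
      have h1 := hadj i
      have h2 := hadj j
      cases a <;> cases b <;> simp only [cond_true, cond_false] at h
      · rw [← h] at h2 ⊢
        rw [hM.eq_of_adj_left h1 h2]
      · rw [← h] at h2 ⊢
        rw [hM.eq_of_adj_left h1 h2.symm, Sym2.eq_swap]
      · rw [← h] at h2 ⊢
        rw [hM.eq_of_adj_left h1.symm h2, Sym2.eq_swap]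
      · rw [← h] at h2 ⊢
        rw [hM.eq_of_adj_left h1.symm h2.symm]
    subst hij
    have h1 := (hadj i).ne
    cases a <;> cases b <;> simp_all
  · rintro ⟨w, hw, hadj⟩
    have hdisj : ∀ i j, i ≠ j → ∀ a b, w (i, a) ≠ w (j, b) := fun i j hij a b h =>
      hij (congrArg Prod.fst (hw h))
    refine ⟨⨆ i, H.subgraphOfAdj (hadj i), SimpleGraph.Subgraph.IsMatching.iSup
      (fun i => SimpleGraph.Subgraph.IsMatching.subgraphOfAdj _) fun i j hij => ?_, ?_⟩
    · refine Set.disjoint_left.2 fun x hx hx' => ?_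
      have h1 : x ∈ (H.subgraphOfAdj (hadj i)).verts :=
        SimpleGraph.Subgraph.support_subset_verts _ hx
      have h2 : x ∈ (H.subgraphOfAdj (hadj j)).verts :=
        SimpleGraph.Subgraph.support_subset_verts _ hx'
      simp only [SimpleGraph.subgraphOfAdj_verts, Set.mem_insert_iff,
        Set.mem_singleton_iff] at h1 h2
      have := hdisj i j hij
      rcases h1 with rfl | rfl <;> rcases h2 with h2 | h2 <;> exact this _ _ h2
    · rw [SimpleGraph.Subgraph.edgeSet_iSup]
      have h1 : (⋃ i, (H.subgraphOfAdj (hadj i)).edgeSet) =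
          Set.range fun i => s(w (i, false), w (i, true)) := by
        ext e
        simp [eq_comm]
      rw [h1, ← Set.image_univ, Set.ncard_image_of_injective, Set.ncard_univ, Nat.card_fin]
      intro i j h
      by_contra hij
      have h2 := hdisj i j hij
      rcases Sym2.eq_iff.1 h with h | h
      exacts [h2 _ _ h.1, h2 _ _ h.1]

/-- Colouring by membership in A fails on each non-bipartite set, which yields an edge inside a
part. -/
lemma HasDisjointOddCycles.hasMatchingOfSize {G : SimpleGraph V} {k : ℕ}
    (h : HasDisjointOddCycles G k) {A B : Set V} (hAB : IsCompl A B) :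
    HasMatchingOfSize (partGraph G A B) k := by
  classical
  obtain ⟨Z, hZ, hodd⟩ := hasDisjointOddCycles_iff.1 h
  have hex : ∀ i, ∃ x y, x ∈ Z i ∧ y ∈ Z i ∧ (partGraph G A B).Adj x y := by
    intro i
    have h1 := not_exists.1 (hodd i) fun v => decide (v ∈ A)
    simp only [ProperOn] at h1
    push Not at h1
    obtain ⟨x, hx, y, hy, hxy, hc⟩ := h1
    refine ⟨x, y, hx, hy, hxy, ?_⟩
    rw [← hAB.compl_eq, Set.mem_compl_iff, Set.mem_compl_iff]
    have : x ∈ A ↔ y ∈ A := by simpa using hc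
    tauto
  choose x y hx hy hxy using hex
  refine hasMatchingOfSize_iff.2 ⟨fun p => bif p.2 then y p.1 else x p.1, ?_, hxy⟩
  rintro ⟨i, a⟩ ⟨j, b⟩ h
  have hmem : ∀ i a, (bif a then y i else x i) ∈ Z i := fun i a => by
    cases a
    exacts [hx i, hy i]
  have hij : i = j := by
    by_contra hij
    exact Set.disjoint_left.1 (hZ hij) (hmem i a) (by
      rw [show (bif a then y i else x i) = _ from h]
      exact hmem j b)
  subst hij
  have h1 := (hxy i).ne
  cases a <;> cases b <;> simp_all

/-! ### Nice partitions -/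

lemma exists_isMinOddCycleCover [Finite V] (G : SimpleGraph V) :
    ∃ X, IsMinOddCycleCover G X := by
  obtain ⟨X, hX, hmin⟩ := Set.exists_min_image {X : Set V | IsOddCycleCover G X} Set.ncard
    (Set.toFinite _) ⟨Set.univ, isBipartite_induce_iff.2
      ⟨fun _ => true, fun x hx => absurd (Set.mem_univ x) hx⟩⟩
  exact ⟨X, hX, hmin⟩

lemma isBipartition_induce_iff {G : SimpleGraph V} {X A B : Set V} (hAB : IsCompl A B) :
    IsBipartition (G.induce Xᶜ) (Subtype.val ⁻¹' A) (Subtype.val ⁻¹' B) ↔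
      ∀ u ∉ X, ∀ v ∉ X, ¬ (partGraph G A B).Adj u v := by
  obtain rfl := hAB.compl_eq
  refine ⟨fun h u hu v hv huv => ?_, fun h => ⟨isCompl_compl, ?_⟩⟩
  · have h1 : (partGraph (G.induce Xᶜ) (Subtype.val ⁻¹' A) (Subtype.val ⁻¹' Aᶜ)).Adj
      ⟨u, hu⟩ ⟨v, hv⟩ := huv
    rw [h.2] at h1
    exact h1
  · rw [eq_bot_iff]
    intro u v huv
    exact h u u.2 v v.2 huv

lemma exists_isNicePartition [Finite V] (G : SimpleGraph V) : ∃ A B, IsNicePartition G A B := by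
  classical
  obtain ⟨X, hX⟩ := exists_isMinOddCycleCover G
  obtain ⟨c, hc⟩ := isBipartite_induce_iff.1 hX.1
  set A₀ : Set V := {v | v ∉ X ∧ c v = true} with hA₀
  set B₀ : Set V := {v | v ∉ X ∧ c v = false} with hB₀
  -- Ties go to the second part.
  set A : Set V := A₀ ∪ {x | x ∈ X ∧ (G.neighborSet x ∩ A₀).ncard < (G.neighborSet x ∩ B₀).ncard}
    with hA
  have hAX : A \ X = A₀ := by
    ext v
    simp only [hA, hA₀, Set.mem_sdiff, Set.mem_union, Set.mem_ofPred_eq]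
    tauto
  have hBX : Aᶜ \ X = B₀ := by
    ext v
    simp only [hA, hA₀, hB₀, Set.mem_sdiff, Set.mem_compl_iff, Set.mem_union, Set.mem_ofPred_eq]
    cases c v <;> simp <;> tauto
  refine ⟨A, Aᶜ, isCompl_compl, X, hX, (isBipartition_induce_iff isCompl_compl).2 ?_, ?_⟩
  · rintro u hu v hv ⟨huv, h⟩
    apply hc u hu v hv huv
    rcases h with ⟨h1, h2⟩ | ⟨h1, h2⟩
    · have h3 : u ∈ A \ X := ⟨h1, hu⟩
      have h4 : v ∈ A \ X := ⟨h2, hv⟩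
      rw [hAX] at h3 h4
      rw [h3.2, h4.2]
    · have h3 : u ∈ Aᶜ \ X := ⟨h1, hu⟩
      have h4 : v ∈ Aᶜ \ X := ⟨h2, hv⟩
      rw [hBX] at h3 h4
      rw [h3.2, h4.2]
  · intro x hx
    rw [hAX, hBX]
    refine ⟨fun h => .inr ⟨hx, h⟩, fun h h' => ?_⟩
    rcases h' with h' | h'
    · exact h'.1 hx
    · exact lt_asymm h h'.2

end OddCycles

/-! ### From a matching and a small cover to odd cycles -/

namespace OddCycles

variable {V : Type*}

lemma ncard_nbrs_le_add [Finite V] {G : SimpleGraph V} {X A B : Set V} (hAB : IsCompl A B) (x : V) :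
    (G.neighborSet x).ncard ≤ (G.neighborSet x ∩ (A \ X)).ncard +
      (G.neighborSet x ∩ (B \ X)).ncard + X.ncard := by
  obtain rfl := hAB.compl_eq
  have h : G.neighborSet x ⊆
      (G.neighborSet x ∩ (A \ X)) ∪ (G.neighborSet x ∩ (Aᶜ \ X)) ∪ X := by
    intro y hy
    simp only [Set.mem_union, Set.mem_inter_iff, Set.mem_sdiff, Set.mem_compl_iff]
    tauto
  have h1 := Set.ncard_le_ncard h (Set.toFinite _)
  have h2 := Set.ncard_union_le
    ((G.neighborSet x ∩ (A \ X)) ∪ (G.neighborSet x ∩ (Aᶜ \ X))) X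
  have h3 := Set.ncard_union_le (G.neighborSet x ∩ (A \ X)) (G.neighborSet x ∩ (Aᶜ \ X))
  omega

/-- A vertex of the cover has many neighbours on the other side of an induced partition. -/
lemma Induces.le_ncard_opposite [Finite V] {G : SimpleGraph V} {X A B : Set V} {m : ℕ}
    (h : Induces G X A B) (hAB : IsCompl A B) (hd : ∀ v, m ≤ (G.neighborSet v).ncard)
    {x : V} (hx : x ∈ X) :
    m ≤ 2 * {y | G.Adj x y ∧ y ∉ X ∧ (y ∈ A ↔ x ∉ A)}.ncard + X.ncard := by
  have h1 := ncard_nbrs_le_add (G := G) (X := X) hAB x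
  have h2 := hd x
  obtain rfl := hAB.compl_eq
  obtain ⟨h3, h4⟩ := h.2 x hx
  by_cases hxA : x ∈ A
  · have h5 : {y | G.Adj x y ∧ y ∉ X ∧ (y ∈ A ↔ x ∉ A)} = G.neighborSet x ∩ (Aᶜ \ X) := by
      ext y
      simp only [hxA, Set.mem_ofPred_eq, Set.mem_inter_iff, SimpleGraph.mem_neighborSet,
        Set.mem_sdiff, Set.mem_compl_iff]
      tauto
    rw [h5]
    have h6 := mt h4 (not_not_intro hxA)
    omega
  · have h5 : {y | G.Adj x y ∧ y ∉ X ∧ (y ∈ A ↔ x ∉ A)} = G.neighborSet x ∩ (A \ X) := by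
      ext y
      simp only [hxA, Set.mem_ofPred_eq, Set.mem_inter_iff, SimpleGraph.mem_neighborSet,
        Set.mem_sdiff]
      tauto
    rw [h5]
    have h6 := mt h3 hxA
    omega

variable [DecidableEq V]

/-- Deleting a small set from a highly connected graph leaves a graph in which all small sets are
linked. -/
lemma IsVertexConnected.linked [Fintype V] {G : SimpleGraph V} {k : ℕ}
    (hG : IsVertexConnected G (50 * k)) {X T : Finset V} (hX : X.card < 2 * k)
    (hT : T ⊆ Finset.univ \ X) (hTk : T.card ≤ 2 * k) : Linked G (Finset.univ \ X) T := by
  set W := Finset.univ \ X with hW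
  have hV : 50 * k < Fintype.card V := by simpa [Nat.card_eq_fintype_card] using hG.1
  refine Massed.linked hTk hT ⟨?_, fun A B hs hlt => ?_⟩
  · refine lt_of_lt_of_le ?_ (sum_card_nbrsIn_le_dartCount hT)
    have h1 : ∀ v ∈ W \ T, 2 * (10 * k) + 1 ≤
        (nbrsIn G (W \ T) v).card + 2 * (nbrsIn G T v).card := by
      intro v _
      have h2 := hG.le_card_nbrsIn v
      have h3 : nbrsIn G Finset.univ v ⊆ nbrsIn G (W \ T) v ∪ nbrsIn G T v ∪ X := by
        intro w hw
        have := mem_nbrsIn.1 hw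
        simp only [Finset.mem_union, mem_nbrsIn, hW, Finset.mem_sdiff, Finset.mem_univ]
        tauto
      have h4 := Finset.card_le_card h3
      have h5 := Finset.card_union_le (nbrsIn G (W \ T) v ∪ nbrsIn G T v) X
      have h6 := Finset.card_union_le (nbrsIn G (W \ T) v) (nbrsIn G T v)
      omega
    have h2 := Finset.card_nsmul_le_sum (W \ T) _ _ h1
    rw [smul_eq_mul, mul_comm, Nat.add_mul] at h2
    have h3 := Finset.le_card_sdiff X Finset.univ
    have h4 := Finset.le_card_sdiff T W
    rw [Finset.card_univ, ← hW] at h3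
    omega
  · rcases (B \ A).eq_empty_or_nonempty with h | ⟨b, hb⟩
    · rw [h, dartCount_empty]
      exact Nat.zero_le _
    exfalso
    obtain ⟨hbB, hbA⟩ := Finset.mem_sdiff.1 hb
    obtain ⟨a, ha, haB⟩ : ∃ a ∈ A, a ∉ B := by
      by_contra! h
      rw [Finset.inter_eq_left.2 h] at hlt
      exact absurd (Finset.card_le_card hs.sub) (by omega)
    -- A separation of small order with both sides proper would, together with X, disconnect G by
    -- fewer than 4k vertices.
    have h1 : ((X ∪ A ∩ B : Finset V) : Set V).ncard < 50 * k := by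
      rw [Set.ncard_coe_finset]
      have := Finset.card_union_le X (A ∩ B)
      omega
    have hmem : ∀ v, v ∈ W → (v ∉ A ∨ v ∉ B) → v ∈ ((X ∪ A ∩ B : Finset V) : Set V)ᶜ := by
      intro v hv h
      have := (Finset.mem_sdiff.1 hv).2
      simp only [Set.mem_compl_iff, Finset.mem_coe, Finset.mem_union, Finset.mem_inter]
      tauto
    have h2 := (ConnIn.of_preconnected (hG.preconnected h1)
      (hmem a (hs.left_subset ha) (.inr haB)) (hmem b (hs.right_subset hbB) (.inl hbA))
      ).mem_of_closed (R := {v | v ∈ A ∧ v ∉ B}) ⟨ha, haB⟩ fun x _ y hy hxR hxy => by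
        simp only [Set.mem_compl_iff, Finset.mem_coe, Finset.mem_union, Finset.mem_inter,
          not_or] at hy
        have hyW : y ∈ W := Finset.mem_sdiff.2 ⟨Finset.mem_univ y, hy.1⟩
        have h3 := hs.mem_or hyW
        have h4 := hs.not_adj x hxR.1 hxR.2 y
        rw [Set.mem_ofPred_eq]
        tauto
    exact hbA h2.1

/-- Replace the elements of an injective family that lie in `X` by new elements. -/
lemma exists_injective_replacement [Fintype V] {ι : Type*} [Fintype ι] {X : Set V} {w : ι → V}
    (hw : Function.Injective w) (N : V → Set V) (hN : ∀ x ∈ X, 2 * Fintype.card ι ≤ (N x).ncard)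
    (hι : Fintype.card ι ≤ Fintype.card V) :
    ∃ t : ι → V, Function.Injective t ∧ ∀ e, (w e ∉ X → t e = w e) ∧ (w e ∈ X → t e ∈ N (w e)) := by
  classical
  -- Candidates avoid all old values, which leaves at least as many as there are indices, as Hall's
  -- condition requires. For indices that keep their value, `Finset.univ` is only a dummy choice.
  set S : ι → Finset V := fun e =>
    if w e ∈ X then (N (w e)).toFinset \ Finset.univ.image w else Finset.univ with hS
  have hSc : ∀ e, Fintype.card ι ≤ (S e).card := by
    intro e
    by_cases he : w e ∈ X
    · simp only [hS, if_pos he]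
      have h1 := hN _ he
      have h2 := Finset.le_card_sdiff (Finset.univ.image w) (N (w e)).toFinset
      have h3 := Finset.card_image_le (s := Finset.univ) (f := w)
      rw [Finset.card_univ] at h3
      rw [Set.ncard_eq_toFinset_card'] at h1
      omega
    · simp only [hS, if_neg he]
      rwa [Finset.card_univ]
  obtain ⟨r, hr, hrS⟩ := (Finset.all_card_le_biUnion_card_iff_exists_injective S).1 fun s => by
    rcases s.eq_empty_or_nonempty with rfl | ⟨e, he⟩
    · simp
    · exact (Finset.card_le_univ s).trans ((hSc e).trans
        (Finset.card_le_card (Finset.subset_biUnion_of_mem S he)))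
  have hrX : ∀ e, w e ∈ X → r e ∈ N (w e) ∧ ∀ e', w e' ≠ r e := by
    intro e he
    have h1 := hrS e
    simp only [hS, if_pos he, Finset.mem_sdiff, Set.mem_toFinset, Finset.mem_image,
      Finset.mem_univ, true_and, not_exists] at h1
    exact h1
  refine ⟨fun e => if w e ∈ X then r e else w e, fun e e' h => ?_, fun e => ⟨fun h => if_neg h,
    fun h => ?_⟩⟩
  · dsimp only at h
    split_ifs at h with h1 h2 h2
    · exact hr h
    · exact absurd h.symm ((hrX e h1).2 e')
    · exact absurd h ((hrX e' h2).2 e)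
    · exact hw h
  · dsimp only
    rw [if_pos h]
    exact (hrX e h).1

/-- A matching inside the parts of a nice partition yields disjoint odd cycles if the minimum odd
cycle cover is small. -/
lemma hasDisjointOddCycles_of_matching [Fintype V] {G : SimpleGraph V} {k : ℕ}
    (hG : IsVertexConnected G (50 * k)) {X A B : Set V} (hAB : IsCompl A B)
    (hX : Induces G X A B) (hXk : X.ncard < 2 * k)
    (hM : HasMatchingOfSize (partGraph G A B) k) : HasDisjointOddCycles G k := by
  classical
  obtain ⟨w, hw, hadj⟩ := hasMatchingOfSize_iff.1 hM
  have hdeg : ∀ v, 50 * k ≤ (G.neighborSet v).ncard := fun v => by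
    have h1 : (nbrsIn G Finset.univ v : Set V) = G.neighborSet v := by
      ext u
      simp [mem_nbrsIn]
    rw [← h1, Set.ncard_coe_finset]
    exact hG.le_card_nbrsIn v
  have hcard : Fintype.card (Fin k × Bool) = 2 * k := by
    rw [Fintype.card_prod, Fintype.card_fin, Fintype.card_bool, mul_comm]
  -- Since |X| < 2k, a vertex of X has at least (50k - 2k)/2 = 24k opposite neighbours outside X,
  -- well above the 4k needed.
  obtain ⟨t, ht, htw⟩ := exists_injective_replacement (X := X) hw
    (fun x => {y | G.Adj x y ∧ y ∉ X ∧ (y ∈ A ↔ x ∉ A)}) (fun x hx => by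
      have := hX.le_ncard_opposite hAB hdeg hx
      omega) (Fintype.card_le_of_injective w hw)
  have htX : ∀ e, t e ∉ X := fun e => by
    by_cases he : w e ∈ X
    · exact ((htw e).2 he).2.1
    · rwa [(htw e).1 he]
  set T := Finset.univ.image t with hT
  have htT : ∀ e, t e ∈ T := fun e => Finset.mem_image_of_mem _ (Finset.mem_univ e)
  obtain ⟨P, hPd, hP⟩ := hG.linked (X := X.toFinset) (T := T)
    (by rwa [← Set.ncard_eq_toFinset_card'])
    (fun v hv => by
      obtain ⟨e, -, rfl⟩ := Finset.mem_image.1 hv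
      simpa using htX e)
    (Finset.card_image_le.trans (by rw [Finset.card_univ, hcard])) (Fin k)
    (fun i => t (i, false)) (fun i => t (i, true)) (fun i => ⟨htT _, htT _⟩)
    fun i j hij => ⟨fun h => hij (congrArg Prod.fst (ht h)), fun h => hij (congrArg Prod.fst (ht h)),
      fun h => hij (congrArg Prod.fst (ht h))⟩
  have hPX : ∀ i, ∀ v ∈ P i, v ∉ X := fun i v hv => by simpa using (hP i).1 hv
  have htP : ∀ i b, t (i, b) ∈ P i := fun i b => by
    cases b
    exacts [(hP i).2.1.left_mem, (hP i).2.1.right_mem]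
  -- An end met by a linkage lies outside X, so it was not replaced and is itself a terminal;
  -- linkages contain no terminals of other pairs.
  have hwP : ∀ i j b, i ≠ j → w (i, b) ∉ P j := by
    intro i j b hij h
    have h1 := (htw (i, b)).1 (hPX j _ h)
    rw [← h1] at h
    rcases (hP j).2.2 ⟨h, htT _⟩ with h2 | h2 <;> exact hij (congrArg Prod.fst (ht h2))
  refine hasDisjointOddCycles_iff.2 ⟨fun i => P i ∪ Set.range fun b => w (i, b),
    fun i j hij => ?_, ?_⟩
  · refine Set.disjoint_union_left.2 ⟨Set.disjoint_union_right.2 ⟨hPd hij, ?_⟩,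
      Set.disjoint_union_right.2 ⟨?_, ?_⟩⟩ <;> rw [Set.disjoint_left]
    · rintro _ h ⟨b, rfl⟩
      exact hwP j i b hij.symm h
    · rintro _ ⟨b, rfl⟩ h
      exact hwP i j b hij h
    · rintro _ ⟨b, rfl⟩ ⟨b', h⟩
      exact hij (congrArg Prod.fst (hw h)).symm
  · rintro i ⟨c, hc⟩
    -- The sum of colour and side is constant along edges between A and B, hence along the
    -- replacement edges and the linkage. The matching edge changes the colour but not the side.
    have hflip : ∀ x y, c x ≠ c y → (y ∈ A ↔ x ∉ A) →
        xor (c x) (decide (x ∈ A)) = xor (c y) (decide (y ∈ A)) := by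
      intro x y h1 h2
      revert h1
      by_cases hx : x ∈ A
      · have : y ∉ A := fun h => h2.1 h hx
        simp only [hx, this, decide_true, decide_false]
        cases c x <;> cases c y <;> decide
      · have : y ∈ A := h2.2 hx
        simp only [hx, this, decide_true, decide_false]
        cases c x <;> cases c y <;> decide
    have hwt : ∀ b, xor (c (w (i, b))) (decide (w (i, b) ∈ A)) =
        xor (c (t (i, b))) (decide (t (i, b) ∈ A)) := by
      intro b
      by_cases hb : w (i, b) ∈ X
      · obtain ⟨h1, -, h2⟩ := (htw (i, b)).2 hb
        exact hflip _ _ (hc _ (.inr ⟨b, rfl⟩) _ (.inl (htP i b)) h1) h2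
      · rw [(htw (i, b)).1 hb]
    have hside := (isBipartition_induce_iff hAB).1 hX.1
    obtain rfl := hAB.compl_eq
    have h1 := (hP i).2.1.mem_of_closed
      (R := {v | xor (c v) (decide (v ∈ A)) = xor (c (t (i, false))) (decide (t (i, false) ∈ A))})
      rfl fun x hx y hy hxR hxy => by
        have h2 := hside x (hPX i x hx) y (hPX i y hy)
        rw [Set.mem_ofPred_eq] at hxR ⊢
        rw [← hxR]
        refine (hflip x y (hc x (.inl hx) y (.inl hy) hxy) ?_).symm
        by_contra h3
        refine h2 ⟨hxy, ?_⟩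
        simp only [Set.mem_compl_iff]
        tauto
    have h2 : xor (c (w (i, true))) (decide (w (i, true) ∈ A)) =
        xor (c (w (i, false))) (decide (w (i, false) ∈ A)) := by
      rw [hwt, hwt]
      exact h1
    have h3 := hc _ (.inr ⟨false, rfl⟩) _ (.inr ⟨true, rfl⟩) (hadj i).1
    have h4 : w (i, true) ∈ A ↔ w (i, false) ∈ A := by
      have := (hadj i).2
      simp only [Set.mem_compl_iff] at this
      tauto
    rw [show decide (w (i, true) ∈ A) = decide (w (i, false) ∈ A) from by simp [h4]] at h2
    exact h3 (Bool.xor_left_inj.1 h2).symm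

end OddCycles

theorem mainTheorem10 {V : Type*} [Finite V] (G : SimpleGraph V) (k : ℕ)
    (hG : OddCycles.IsVertexConnected G (50 * k)) :
    Xor (OddCycles.HasDisjointOddCycles G k)
      (∀ A B : Set V, OddCycles.IsNicePartition G A B →
        ¬ OddCycles.HasMatchingOfSize (OddCycles.partGraph G A B) k) := by
  classical
  cases nonempty_fintype V
  by_cases h : OddCycles.HasDisjointOddCycles G k
  · obtain ⟨A, B, hAB⟩ := OddCycles.exists_isNicePartition G
    exact .inl ⟨h, fun h' => h' A B hAB (h.hasMatchingOfSize hAB.1)⟩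
  · refine .inr ⟨?_, h⟩
    rintro A B ⟨hAB, X, hX, hind⟩ hM
    apply h
    -- For k = 0 the empty family of cycles works, and the matching is not needed.
    rcases Nat.eq_zero_or_pos k with rfl | hk
    · exact ⟨fun i => i.elim0, fun i => i.elim0, fun i => i.elim0, fun i => i.elim0⟩
    have hne : Nonempty V := (Nat.card_pos_iff.1 (by have := hG.1; omega)).1
    rcases OddCycles.exists_disjoint_or_small_cover hk hG.le_card_nbrsIn
      (fun S hS => hG.preconnected (by omega)) with hZ | ⟨Y, hY, hc⟩
    · exact OddCycles.hasDisjointOddCycles_iff.2 hZ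
    · exact OddCycles.hasDisjointOddCycles_of_matching hG hAB hind
        ((hX.2 Y (OddCycles.isBipartite_induce_iff.2 hc)).trans_lt hY) hM
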